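/- **Machine model.** A deterministic-control quantum Turing machine (dcq-TM) $\mathsf T$ has a finite set $Q$ of control states, with distinct starting and halting states, a two-way infinite classical tape over $\{0,1,\Box\}$, a two-way infinite tape of qubits, and a transition function $\delta: Q\times\{0,1,\Box\}\to \mathbb U\times\{L,N,R\}\times\{0,1,\Box\}\times\{L,N,R\}\times Q$ which, from the control state and the scanned classical symbol, gives the gate from $\mathbb U=\{I,H,S,T=\mathrm{diag}(1,e^{i\pi/4}),\mathrm{SWAP},\mathrm{CNOT}\}$ to be applied at the quantum head (two-qubit gates act on the scanned cell and its right neighbour), the move of the quantum head, the symbol to be written, the move of the classical head, and the next control state. Natural numbers are identified with binary strings by $0,1,2,3,\ldots\mapsto\epsilon,0,1,00,\ldots$, and tuples of strings are encoded as $(x_1,\dots,x_k)=1^{|x_1|}0x_1\cdots 1^{|x_{k-1}|}0x_{k-1}x_k$. On input $(x;\rho)$, with $x$ a binary string and $\rho$ an $n$-qubit density matrix, both heads start at cell $0$, the classical tape holds $x\Box n$ from cell $1$ on, cells $1,\dots,n$ of the quantum tape are in the state $\rho$, and all other cells are blank, respectively $|0\rangle$. We write $\mathsf T(x;\rho)=(y;\tau)$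 if $\mathsf T$ halts with $y\Box m\Box$ on the classical tape from cell $1$ on and with $\tau$ the reduced state of the quantum cells $1,\dots,m$; then $\mathsf T^{(C)}(x;\rho)=y$ and $\mathsf T^{(Q)}(x;\rho)=\tau$. Empty inputs and outputs are written $\Box$ (classical) and $\epsilon$ (quantum). A dcq-TM $\mathsf U$ is *universal* if (i) for every dcq-TM $\mathsf T$ there is a string $t$ with $\mathsf U((t,x);\rho)=\mathsf T(x;\rho)$ for all $x,\rho$, and (ii) (s-m-n property) for every dcq-TM $\mathsf T$ there are a computable map $s$ on binary strings and a constant $c$ such that, for all $p$, $|s(p)|\le|p|+c$ and $\mathsf U((s(p),x);\rho)=\mathsf T((p,x);\rho)$ for all $x,\rho$. (In both equations one side is defined if and only if the other is.) **States.** Let $D(\rho,\sigma)=\tfrac12\mathrm{Tr}|\rho-\sigma|$. A state $\rho$ is *directly dcq-computable* if $\mathsf T(\Box;\epsilon)=(\Box;\rho)$ for some dcq-TM $\mathsf T$. It is *dcq-computable* if there are a dcq-TM $\mathsf T$ and directly dcq-computable states $\sigma_k$ with $\mathsf T(k;\epsilon)=(\Box;\sigma_k)$ and $D(\rho,\sigma_k)\le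 1/k$ for all $k\ge1$. A string $e$ is an index of the real number $r$ if, for every $k\ge1$, $\mathsf U^{(C)}((e,k);\epsilon)$ is (the encoding of) a rational $q$ with $|r-q|\le 1/k$. A string encodes the classical representation $\boldsymbol\sigma$ of a state $\sigma$ if it is the tuple consisting of the number of qubits of $\sigma$ and, row by row, of indices of the real and imaginary parts of the entries of the density matrix of $\sigma$ in the computational basis. **Complexity.** For a universal dcq-TM $\mathsf U$, $\mathrm K_{\mathsf U}(\rho\mid x;\sigma)$ is the infimum of the lengths $|p|$ of the binary strings $p$ such that, for all $k\ge1$, $\mathsf U^{(Q)}((p,x,k);\sigma)$ is defined, has as many qubits as $\rho$, and $D\bigl(\mathsf U^{(Q)}((p,x,k);\sigma),\rho\bigr)\le 1/k$. The quantity $\mathrm K_{\mathsf U}(\rho\mid\boldsymbol\sigma;\epsilon)$ is the infimum of the lengths $|p|$ of the $p$ that satisfy this condition, with quantum input $\epsilon$, for every string $x$ that encodes $\boldsymbol\sigma$. **Statement.** For every universal dcq-TM $\mathsf U$ there is a constant $c\in\mathbb N$, depending only on $\mathsf U$, such that for all dcq-computable states $\rho$ and $\sigma$ (of any numbers of qubits)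 $$\mathrm K_{\mathsf U}(\rho\mid\boldsymbol\sigma;\epsilon)\le \mathrm K_{\mathsf U}(\rho\mid\Box;\sigma)+c .$$ That is, up to an additive constant, having the classical description of $\sigma$ as a resource is at least as useful as having the physical state $\sigma$. -/

import Mathlib

open scoped Kronecker Matrix ComplexOrder

noncomputable section

/-! ### Binary strings and their encodings -/

/-- Binary strings. -/
abbrev BStr := List Bool

/-- The standard one-to-one correspondence `0, 1, 2, 3, 4, … ↦ ε, 0, 1, 00, 01, …` between natural
numbers and binary strings: the string of `n` is the binary expansion of `n + 1`, most significant
digit first, without its leading digit `1`. -/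
def natStr (n : ℕ) : BStr := (Nat.bits (n + 1)).dropLast.reverse

/-- The encoding `(x₁, …, xₖ) = 1^|x₁| 0 x₁ ⋯ 1^|xₖ₋₁| 0 xₖ₋₁ xₖ` of a tuple of strings. -/
def strTuple : List BStr → BStr
  | [] => []
  | [x] => x
  | x :: y :: l => List.replicate x.length true ++ false :: (x ++ strTuple (y :: l))

/-- A rational number as the tuple of its sign (`1` if negative), numerator and denominator. -/
def ratStr (q : ℚ) : BStr := strTuple [[decide (q < 0)], natStr q.num.natAbs, natStr q.den]

/-! ### Quantum states and trace distance -/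

/-- An `n`-qubit quantum state: a density matrix in the computational basis. A basis vector is
`a : Fin n → Bool`, where `a 0` is the bit of the first qubit. -/
structure QState (n : ℕ) where
  mat : Matrix (Fin n → Bool) (Fin n → Bool) ℂ
  posSemidef : mat.PosSemidef
  trace_eq_one : mat.trace = 1

/-- The empty (zero-qubit) quantum state `ε`. -/
def QState.empty : QState 0 where
  mat := 1
  posSemidef := Matrix.PosSemidef.one
  trace_eq_one := by simp [Matrix.trace_one]

/-- The trace norm `Tr √(Mᴴ M)`, i.e. the sum of the singular values of `M`. -/
def traceNorm {ι : Type*} [Fintype ι] [DecidableEq ι] (M : Matrix ι ι ℂ) : ℝ :=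
  ∑ i, √((Matrix.isHermitian_conjTranspose_mul_self M).eigenvalues i)

/-- The trace distance `D(ρ, σ) = ½ Tr |ρ - σ|`. -/
def traceDist {n : ℕ} (ρ σ : QState n) : ℝ := traceNorm (ρ.mat - σ.mat) / 2

/-! ### Gates and the quantum tape -/

/-- The gate set: identity, Hadamard, phase, `π/8`, swap, controlled not. -/
inductive Gate
  | id | had | phase | piEighth | swap | cnot

/-- A one-qubit operator with rows `(a b)` and `(c d)`; `false` is `|0⟩` and `true` is `|1⟩`. -/
def qubitMat (a b c d : ℂ) : Matrix Bool Bool ℂ :=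
  Matrix.of fun i j => if i then (if j then d else c) else (if j then b else a)

/-- The unitary of a gate on the pair (cell under the head, next cell to the right). One-qubit gates
act on the cell under the head; the control qubit of `cnot` is the cell under the head. -/
def Gate.mat : Gate → Matrix (Bool × Bool) (Bool × Bool) ℂ
  | .id => 1
  | .had => qubitMat (1 / (√2 : ℝ)) (1 / (√2 : ℝ)) (1 / (√2 : ℝ)) (-(1 / (√2 : ℝ))) ⊗ₖ 1
  | .phase => qubitMat 1 0 0 Complex.I ⊗ₖ 1
  | .piEighth => qubitMat 1 0 0 (Complex.exp (Real.pi / 4 * Complex.I)) ⊗ₖ 1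
  | .swap => Matrix.of fun i j => if i = (j.2, j.1) then 1 else 0
  | .cnot => Matrix.of fun i j => if i = (j.1, xor j.1 j.2) then 1 else 0

/-- A computational-basis assignment of the cells of the two-way infinite quantum tape. -/
abbrev QBasis := ℤ → Bool

/-- The density matrix of the whole quantum tape, in the computational basis. On every tape that
occurs in a computation all but finitely many cells are in the state `|0⟩`, so that it has only
finitely many nonzero entries. -/
abbrev QTape := QBasis → QBasis → ℂ

/-- Overwrite the cells `j` and `j + 1`. -/
def QBasis.set (x : QBasis) (j : ℤ) (a : Bool × Bool) : QBasis :=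
  Function.update (Function.update x j a.1) (j + 1) a.2

/-- Conjugation `G ρ Gᴴ` of the tape's state by the gate `g` placed on the cells `j`, `j + 1`. -/
def QTape.applyGate (ρ : QTape) (g : Gate) (j : ℤ) : QTape := fun x y =>
  ∑ a : Bool × Bool, ∑ b : Bool × Bool,
    g.mat (x j, x (j + 1)) a * ρ (x.set j a) (y.set j b) * star (g.mat (y j, y (j + 1)) b)

open Classical in
/-- The tape with `ρ` on the cells `1, …, n` and `|0⟩` on all other cells. -/
def QTape.init {n : ℕ} (ρ : QState n) : QTape := fun x y =>
  if ∀ i : ℤ, ¬(1 ≤ i ∧ i ≤ n) → x i = false ∧ y i = false then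
    ρ.mat (fun i => x ((i : ℕ) + 1)) (fun i => y ((i : ℕ) + 1))
  else 0

/-- The basis assignment with `a` on the cells `1, …, m` and `z` on the other cells. -/
def QBasis.glue {m : ℕ} (a : Fin m → Bool) (z : {i : ℤ // ¬(1 ≤ i ∧ i ≤ m)} → Bool) : QBasis :=
  fun i => if h : 1 ≤ i ∧ i ≤ m then a ⟨(i - 1).toNat, by omega⟩ else z ⟨i, h⟩

/-- The reduced density matrix of the cells `1, …, m`: the partial trace over all other cells. -/
def QTape.reduced (ρ : QTape) (m : ℕ) : Matrix (Fin m → Bool) (Fin m → Bool) ℂ :=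
  Matrix.of fun a b => ∑ᶠ z, ρ (QBasis.glue a z) (QBasis.glue b z)

/-! ### The machine -/

/-- Head displacements: left, none, right. -/
inductive Dir
  | L | N | R

def Dir.toInt : Dir → ℤ
  | .L => -1
  | .N => 0
  | .R => 1

/-- A deterministic-control quantum Turing machine. The alphabet `{0, 1, □}` of the classical tape is
`Option Bool`, with `none` for the blank `□`. From the control state and the scanned classical symbol,
`δ` gives the gate to be applied, the move of the quantum head, the symbol to be written, the move of
the classical head, and the next control state. -/
structure DcqTM where
  Q : Type
  finite : Finite Q
  start : Q
  halt : Q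
  start_ne_halt : start ≠ halt
  δ : Q × Option Bool → Gate × Dir × Option Bool × Dir × Q

namespace DcqTM

/-- A configuration: control state, the two tapes, and the positions of the two heads. -/
structure Config (T : DcqTM) where
  state : T.Q
  ctape : ℤ → Option Bool
  chead : ℤ
  qtape : QTape
  qhead : ℤ

open Classical in
/-- One step of the computation; a halted machine does nothing. -/
def step (T : DcqTM) (c : T.Config) : T.Config :=
  if c.state = T.halt then c
  else
    match T.δ (c.state, c.ctape c.chead) with
    | (g, dq, s, dc, q) =>
      { state := q
        ctape := Function.update c.ctape c.chead s
        chead := c.chead + dc.toInt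
        qtape := c.qtape.applyGate g c.qhead
        qhead := c.qhead + dq.toInt }

/-- The starting configuration on input `(x; ρ)`: both heads are on their anchor cells, which have
index `0`, the classical tape holds `x □ n` from cell `1` on, with `n` the number of qubits of `ρ`, and
is blank elsewhere. -/
def init (T : DcqTM) (x : BStr) {n : ℕ} (ρ : QState n) : T.Config where
  state := T.start
  ctape := fun i =>
    if 1 ≤ i then (x.map some ++ none :: (natStr n).map some).getD (i - 1).toNat none else none
  chead := 0
  qtape := QTape.init ρ
  qhead := 0

/-- The classical tape reads `y □ m □` from cell `1` on. -/
def ReadsOutput (tape : ℤ → Option Bool) (y : BStr) (m : ℕ) : Prop :=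
  ∀ (i : ℕ) (h : i < (y.map some ++ none :: ((natStr m).map some ++ [none])).length),
    tape (i + 1) = (y.map some ++ none :: ((natStr m).map some ++ [none]))[i]

/-- `T(x; ρ) = (y; σ)`: on input `(x; ρ)` the machine halts, with output `(y; σ)`. -/
def Outputs (T : DcqTM) (x : BStr) {n : ℕ} (ρ : QState n) (y : BStr) {m : ℕ} (σ : QState m) : Prop :=
  ∃ t : ℕ, (T.step^[t] (T.init x ρ)).state = T.halt ∧
    ReadsOutput (T.step^[t] (T.init x ρ)).ctape y m ∧
    (T.step^[t] (T.init x ρ)).qtape.reduced m = σ.mat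

/-- A universal dcq-TM that has the s-m-n property. -/
structure IsUniversal (U : DcqTM) : Prop where
  /-- Every machine `T` has a program `t` with `U((t, x); ρ) = T(x; ρ)` for all inputs (in
  particular, one side is defined if and only if the other is). -/
  universal : ∀ T : DcqTM, ∃ t : BStr,
    ∀ (x : BStr) (n : ℕ) (ρ : QState n) (y : BStr) (m : ℕ) (σ : QState m),
      U.Outputs (strTuple [t, x]) ρ y σ ↔ T.Outputs x ρ y σ
  /-- Programs `p` of any machine `T` are translated effectively into programs `s p` of `U`, at the
  expense of at most a constant number of additional bits. -/
  smn : ∀ T : DcqTM, ∃ (s : BStr → BStr) (c : ℕ), Computable s ∧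
    (∀ p, (s p).length ≤ p.length + c) ∧
    ∀ (p x : BStr) (n : ℕ) (ρ : QState n) (y : BStr) (m : ℕ) (σ : QState m),
      U.Outputs (strTuple [s p, x]) ρ y σ ↔ T.Outputs (strTuple [p, x]) ρ y σ

end DcqTM

/-! ### Computable states -/

/-- `ρ` is directly dcq-computable: `T(□; ε) = (□; ρ)` for some dcq-TM `T`. -/
def DirectlyDcqComputable {n : ℕ} (ρ : QState n) : Prop :=
  ∃ T : DcqTM, T.Outputs [] QState.empty [] ρ

/-- `ρ` is dcq-computable: some dcq-TM outputs, on each input `k ≥ 1`, a directly dcq-computable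
state at trace distance at most `1 / k` from `ρ`. -/
def DcqComputable {n : ℕ} (ρ : QState n) : Prop :=
  ∃ (T : DcqTM) (σ : ℕ → QState n), ∀ k : ℕ, 1 ≤ k →
    DirectlyDcqComputable (σ k) ∧
    T.Outputs (natStr k) QState.empty [] (σ k) ∧
    traceDist ρ (σ k) ≤ 1 / (k : ℝ)

/-! ### Classical representations -/

/-- `U_e` computes the real number `r`: on each input `k ≥ 1` its classical output is a rational
number at distance at most `1 / k` from `r`. The classical output of a dcq-TM depends only on its
classical tape, so that `e ↦ U_e` is an enumeration of the classical Turing machines when `U` is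
universal. -/
def ComputesReal (U : DcqTM) (e : BStr) (r : ℝ) : Prop :=
  ∀ k : ℕ, 1 ≤ k → ∃ (q : ℚ) (m : ℕ) (τ : QState m),
    U.Outputs (strTuple [e, natStr k]) QState.empty (ratStr q) τ ∧ |r - q| ≤ 1 / (k : ℝ)

/-- The `r`-th computational-basis vector of `n` qubits, the first qubit being the most significant
bit. -/
def basisVec (n : ℕ) (r : Fin (2 ^ n)) : Fin n → Bool := fun i => Nat.testBit r (n - 1 - i)

/-- The string `d` encodes the density matrix of `σ`: it is the tuple that consists of the number of
qubits of `σ` and, row by row, of indices of Turing machines that compute the real and the imaginary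
parts of the entries. -/
def EncodesState (U : DcqTM) (d : BStr) {n : ℕ} (σ : QState n) : Prop :=
  ∃ e f : Fin (2 ^ n) → Fin (2 ^ n) → BStr,
    (∀ r s, ComputesReal U (e r s) (σ.mat (basisVec n r) (basisVec n s)).re ∧
      ComputesReal U (f r s) (σ.mat (basisVec n r) (basisVec n s)).im) ∧
    d = strTuple (natStr n ::
      (List.ofFn fun r => (List.ofFn fun s => [e r s, f r s]).flatten).flatten)

/-! ### Conditional algorithmic complexity -/

/-- The program `p` computes `ρ` on the machine `T` given `(x; σ)`: for all `k ≥ 1`, the quantum output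
of `T` on `((p, x, k); σ)` is at trace distance at most `1 / k` from `ρ`. -/
def ProgramFor (T : DcqTM) (p : BStr) {n : ℕ} (ρ : QState n) (x : BStr) {m : ℕ} (σ : QState m) :
    Prop :=
  ∀ k : ℕ, 1 ≤ k → ∃ (y : BStr) (τ : QState n),
    T.Outputs (strTuple [p, x, natStr k]) σ y τ ∧ traceDist τ ρ ≤ 1 / (k : ℝ)

/-- `K_T(ρ | x; σ)`, the conditional complexity of `ρ` given the string `x` and the physical state `σ`;
it is `⊤` if there is no program. -/
def condK (T : DcqTM) {n : ℕ} (ρ : QState n) (x : BStr) {m : ℕ} (σ : QState m) : ℕ∞ :=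
  sInf {l : ℕ∞ | ∃ p : BStr, ProgramFor T p ρ x σ ∧ l = p.length}

/-- `K_U(ρ | 𝛔; τ)`, where the bold `𝛔` is the classical representation of `σ`: the program has to
work with every string that encodes the matrix of `σ`. -/
def condKRepr (U : DcqTM) {n : ℕ} (ρ : QState n) {m : ℕ} (σ : QState m) {l : ℕ} (τ : QState l) : ℕ∞ :=
  sInf {k : ℕ∞ | ∃ p : BStr, (∀ d : BStr, EncodesState U d σ → ProgramFor U p ρ d τ) ∧ k = p.length}

end

/-! Under deterministic control the quantum data never influence the control: the gates, the head
moves, the halting time and the classical output depend only on the classical input and on the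
number of qubits (`DcqTM.outputs_iff`, `DcqTM.Runs.unique`). So the run of `U` on `((p, □, K); σ)`
is a fixed list of gates `C`, found classically without `σ`, that is applied to `σ` and followed by
a partial trace. From indices of the entries of `σ` the resulting matrix can be computed to any
precision, and for large `K` it is close to `ρ`.

It remains to prepare a state close to this matrix. As `ρ` is dcq-computable, there are circuits
`C'` that prepare arbitrarily good approximations of `ρ` from the blank tape. A blind search over
all circuits therefore succeeds, and since it uses no knowledge of how `ρ` is computed, the additive
constant does not depend on `ρ`.

The search needs an effective acceptance test. The matrix prepared by `C'`, and the matrix obtained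
by `C` from rational approximations of the entries, are finite sums of matrix units whose
coefficients are rational multiples of powers of `zeta8`. The squared Frobenius norm of their
difference is then `a + b / √2` with rational `a` and `b` (`fro_red_toC_sq`), and a bound on it can
be certified with rational bounds of `1 / √2` (`FroTest`). The Frobenius norm controls the trace
distance up to a factor depending on the dimension. The resulting predicate `Accepts` on
certificates is primitive recursive; `Accepts.sound` says that a certificate yields a good circuit,
and `exists_accepts` that there is one.

The search is a partial recursive function from the input `(p, d, k)` to a circuit and a number of
qubits. `exists_dcqTM_of_partrec` provides one machine `T` that evaluates it and then runs the
circuit: the function is compiled to a machine with four stacks, whose stacks are interleaved on a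
single tape. Finally the s-m-n property translates a program `p` of `T` into a program of `U` at the
cost of a constant. -/

noncomputable section

/-! ### Machines with possibly infinitely many states -/

lemma QBasis.set_self (x : QBasis) (j : ℤ) : x.set j (x j, x (j + 1)) = x := by
  simp [QBasis.set]

/-- Every transition applies some gate, so purely classical steps use `.id`, which has to leave the
quantum tape alone. -/
lemma QTape.applyGate_id (ρ : QTape) (j : ℤ) : ρ.applyGate .id j = ρ := by
  funext x y
  simp only [QTape.applyGate, Gate.mat, Matrix.one_apply]
  rw [Finset.sum_eq_single (x j, x (j + 1)) (by intro b _ hb; simp [Ne.symm hb]) (by simp),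
    Finset.sum_eq_single (y j, y (j + 1)) (by intro b _ hb; simp [Ne.symm hb]) (by simp)]
  simp [QBasis.set_self]

/-- A configuration of a machine with an arbitrary type of states. -/
structure MConf (Q : Type) where
  state : Q
  ctape : ℤ → Option Bool
  chead : ℤ
  qtape : QTape
  qhead : ℤ

/-- A transition function on an arbitrary type of states. -/
abbrev MTrans (Q : Type) := Q → Option Bool → Gate × Dir × Option Bool × Dir × Q

namespace MConf

variable {Q : Type}

/-- The successor of a configuration. -/
def next (δ : MTrans Q) (c : MConf Q) : MConf Q :=
  { state := (δ c.state (c.ctape c.chead)).2.2.2.2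
    ctape := Function.update c.ctape c.chead (δ c.state (c.ctape c.chead)).2.2.1
    chead := c.chead + (δ c.state (c.ctape c.chead)).2.2.2.1.toInt
    qtape := c.qtape.applyGate (δ c.state (c.ctape c.chead)).1 c.qhead
    qhead := c.qhead + (δ c.state (c.ctape c.chead)).2.1.toInt }

/-- One step from a configuration that has not halted. -/
def Step (δ : MTrans Q) (halt : Q) (c c' : MConf Q) : Prop := c.state ≠ halt ∧ c' = c.next δ

/-- Finitely many steps. -/
abbrev Reaches (δ : MTrans Q) (halt : Q) : MConf Q → MConf Q → Prop :=
  Relation.ReflTransGen (Step δ halt)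

/-- The starting configuration on a classical input and no qubits. -/
def start (q : Q) (x : BStr) : MConf Q where
  state := q
  ctape := fun i => if 1 ≤ i then (x.map some).getD (i - 1).toNat none else none
  chead := 0
  qtape := QTape.init QState.empty
  qhead := 0

end MConf

lemma natStr_zero : natStr 0 = [] := by simp [natStr]

open Classical in
/-- The machine that runs a transition function inside a finite closed set of states. -/
def DcqTM.ofTrans {Q : Type} (δ : MTrans Q) (F : Set Q) (hF : F.Finite) (s h : F) (hsh : s ≠ h) :
    DcqTM where
  Q := F
  finite := hF
  start := s
  halt := h
  start_ne_halt := hsh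
  δ := fun p =>
    let r := δ p.1 p.2
    -- The fallback `s` makes the function total; it is never taken if `F` is closed under the
    -- transitions.
    (r.1, r.2.1, r.2.2.1, r.2.2.2.1, if hr : r.2.2.2.2 ∈ F then ⟨_, hr⟩ else s)

/-- A configuration inside the closed set, as a configuration of the machine. -/
def MConf.restrict {Q : Type} (δ : MTrans Q) {F : Set Q} (hF : F.Finite) {s h : F} (hsh : s ≠ h)
    (c : MConf Q) (hc : c.state ∈ F) : (DcqTM.ofTrans δ F hF s h hsh).Config where
  state := (⟨c.state, hc⟩ : F)
  ctape := c.ctape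
  chead := c.chead
  qtape := c.qtape
  qhead := c.qhead

open Classical in
lemma MConf.step_restrict {Q : Type} {δ : MTrans Q} {F : Set Q} {hF : F.Finite} {s h : F}
    {hsh : s ≠ h} {c : MConf Q} (hc : c.state ∈ F) (hc' : (c.next δ).state ∈ F)
    (hne : c.state ≠ h) :
    DcqTM.step _ (c.restrict δ hF hsh hc) = (c.next δ).restrict δ hF hsh hc' := by
  have h1 : ¬ (c.restrict δ hF hsh hc).state = (DcqTM.ofTrans δ F hF s h hsh).halt :=
    fun e => hne (congrArg Subtype.val e)
  unfold DcqTM.step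
  rw [if_neg h1]
  have h2 : (if hr : (δ c.state (c.ctape c.chead)).2.2.2.2 ∈ F then
      (⟨_, hr⟩ : F) else s) = ⟨_, hc'⟩ := dif_pos hc'
  unfold MConf.restrict DcqTM.ofTrans
  exact congrArg (fun q : F => (⟨q, _, _, _, _⟩ : (DcqTM.ofTrans δ F hF s h hsh).Config)) h2

/-- The input `x □ n` with `n = 0` ends in the empty string `natStr 0`, so it reads as `x` followed
by blanks. -/
lemma MConf.restrict_start {Q : Type} {δ : MTrans Q} {F : Set Q} {hF : F.Finite} {s h : F}
    {hsh : s ≠ h} (x : BStr) :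
    (DcqTM.ofTrans δ F hF s h hsh).init x QState.empty =
      (MConf.start (s : Q) x).restrict δ hF hsh s.2 := by
  have : (fun i : ℤ => if 1 ≤ i then
      (x.map some ++ none :: (natStr 0).map some).getD (i - 1).toNat none else none) =
      (MConf.start (s : Q) x).ctape := by
    funext i
    simp only [MConf.start]
    split_ifs
    · rw [natStr_zero]
      simp only [List.map_nil, List.getD_eq_getElem?_getD]
      rcases lt_or_ge (i - 1).toNat (x.map some).length with hl | hl
      · rw [List.getElem?_append_left hl]
      · rw [List.getElem?_append_right hl, List.getElem?_eq_none hl]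
        rcases (i - 1).toNat - (x.map some).length with _ | k <;> simp
    · rfl
  unfold DcqTM.init MConf.restrict
  rw [this]
  rfl

/-- Control states are built below from infinite types of labels. A finite set of states that is
closed under the transitions is enough to obtain a genuine machine. -/
theorem DcqTM.ofTrans_outputs {Q : Type} {δ : MTrans Q} {F : Set Q} {hF : F.Finite} {s h : F}
    {hsh : s ≠ h} (hcl : ∀ q ∈ F, ∀ o, (δ q o).2.2.2.2 ∈ F) {x : BStr} {c : MConf Q}
    (hr : MConf.Reaches δ h (MConf.start (s : Q) x) c) (hc : c.state = h)
    {y : BStr} {m : ℕ} {σ : QState m} (h1 : ReadsOutput c.ctape y m)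
    (h2 : c.qtape.reduced m = σ.mat) :
    (DcqTM.ofTrans δ F hF s h hsh).Outputs x QState.empty y σ := by
  set T := DcqTM.ofTrans δ F hF s h hsh with hT
  have key : ∃ t : ℕ, ∃ hs : c.state ∈ F, T.step^[t] (T.init x QState.empty) =
      c.restrict δ hF hsh hs := by
    clear hc h1 h2
    induction hr with
    | refl => exact ⟨0, s.2, MConf.restrict_start x⟩
    | tail _ hst ih =>
      obtain ⟨t, hs, ht⟩ := ih
      obtain ⟨hne, rfl⟩ := hst
      refine ⟨t + 1, hcl _ hs _, ?_⟩
      rw [Function.iterate_succ_apply', ht, MConf.step_restrict hs (hcl _ hs _) hne]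
  obtain ⟨t, hs, ht⟩ := key
  refine ⟨t, ?_, ?_, ?_⟩ <;> rw [ht]
  · exact Subtype.ext hc
  · exact h1
  · exact h2

/-! ### Stack programs -/

/-- The stacks: `none` is the stack of the input and the output, on the right of the tape. -/
abbrev Track := Option Turing.PartrecToTM2.K'

/-- The cell below the bottom of a stack. It is always blank. -/
def Track.off : Track → ℤ
  | none => 0
  | some .main => -1
  | some .rev => -2
  | some .aux => -3
  | some .stack => -4

/-- The distance of consecutive cells of a stack. -/
def Track.stride : Track → ℤ
  | none => 1
  | some _ => -4

/-- The cell of the `j`-th symbol of a stack, counted from the bottom. -/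
def Track.cell (k : Track) (j : ℕ) : ℤ := Track.off k + Track.stride k * (j + 1)

/-- The four stacks on the left occupy the residue classes modulo 4 of the cells below `-4`, and the
input/output stack occupies the positive cells. -/
lemma Track.cell_inj {k k' : Track} {j j' : ℕ} (h : Track.cell k j = Track.cell k' j') :
    k = k' ∧ j = j' := by
  rcases k with _ | _ | _ | _ | _ <;> rcases k' with _ | _ | _ | _ | _ <;>
    simp only [Track.cell, Track.off, Track.stride] at h <;> simp <;> omega

/-- The cells `-4, …, 0` carry no data. A blank in `k.off` tells a head walking down the stack `k`
that it has passed the bottom. -/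
lemma Track.cell_ne_off (k k' : Track) (j : ℕ) : Track.cell k j ≠ Track.off k' := by
  rcases k with _ | _ | _ | _ | _ <;> rcases k' with _ | _ | _ | _ | _ <;>
    simp only [Track.cell, Track.off, Track.stride] <;> omega

/-- Instructions of programs that operate on binary stacks and on the quantum tape. -/
inductive Instr (L : Type)
  | push (k : Track) (b : Bool) (l : L)
  | pop (k : Track) (f : Option Bool → L)
  | gate (g : Gate) (d : Dir) (l : L)
  | halt

/-- The labels to which an instruction can jump. -/
def Instr.targets {L : Type} : Instr L → Set L
  | .push _ _ l => {l}
  | .pop _ f => Set.range f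
  | .gate _ _ l => {l}
  | .halt => ∅

/-- Configurations of stack programs. The head of a list is the top of the stack. -/
structure SConf (L : Type) where
  lab : L
  stk : Track → BStr
  qtape : QTape
  qhead : ℤ

/-- One step of a stack program, unless it halts. -/
inductive SStep {L : Type} (P : L → Instr L) : SConf L → SConf L → Prop
  | push {l S q h k b l'} (e : P l = .push k b l') :
      SStep P ⟨l, S, q, h⟩ ⟨l', Function.update S k (b :: S k), q, h⟩
  | pop {l S q h k f} (e : P l = .pop k f) :
      SStep P ⟨l, S, q, h⟩ ⟨f (S k).head?, Function.update S k (S k).tail, q, h⟩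
  | gate {l S q h g d l'} (e : P l = .gate g d l') :
      SStep P ⟨l, S, q, h⟩ ⟨l', S, q.applyGate g h, h + d.toInt⟩

/-- States of the machine that runs a stack program. -/
inductive Ctl (L : Type)
  | lab (l : L)
  | walk (l : L)
  | popat (l : L)
  | back (k : Track) (l : L)
  | erase
  | fin

/-- The behaviour of the machine, with head moves of several cells. -/
def Ctl.act {L : Type} (P : L → Instr L) :
    Ctl L → Option Bool → Gate × Dir × Option Bool × ℤ × Ctl L
  | .lab l, s => match P l with
    | .push k _ _ => (.id, .N, s, k.off + k.stride, .walk l)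
    | .pop k _ => (.id, .N, s, k.off + k.stride, .walk l)
    | .gate g d l' => (g, d, s, 0, .lab l')
    | .halt => (.id, .N, s, 1, .erase)
  | .walk l, some b => match P l with
    | .push k _ _ => (.id, .N, some b, k.stride, .walk l)
    | .pop k _ => (.id, .N, some b, k.stride, .walk l)
    | _ => (.id, .N, some b, 0, .fin)
  | .walk l, none => match P l with
    | .push k b l' => (.id, .N, some b, -k.stride, .back k l')
    | .pop k _ => (.id, .N, none, -k.stride, .popat l)
    | _ => (.id, .N, none, 0, .fin)
  | .popat l, some b => match P l with
    | .pop k f => (.id, .N, none, -k.stride, .back k (f (some b)))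
    | _ => (.id, .N, none, 0, .fin)
  | .popat l, none => match P l with
    | .pop k f => (.id, .N, none, -k.off, .lab (f none))
    | _ => (.id, .N, none, 0, .fin)
  | .back k l, some b => (.id, .N, some b, -k.stride, .back k l)
  | .back k l, none => (.id, .N, none, -k.off, .lab l)
  | .erase, _ => (.id, .N, none, 0, .fin)
  | .fin, _ => (.id, .N, none, 0, .fin)

/-- The machine that runs a stack program; the second component of a state is the pending move. -/
def ctlTrans {L : Type} (P : L → Instr L) : MTrans (Ctl L × ℤ) := fun q s =>
  if q.2 = 0 then
    let r := q.1.act P s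
    (r.1, r.2.1, r.2.2.1, .N, (r.2.2.2.2, r.2.2.2.1))
  else if 0 < q.2 then (.id, .N, s, .R, (q.1, q.2 - 1))
  else (.id, .N, s, .L, (q.1, q.2 + 1))

section Run

variable {L : Type} (P : L → Instr L)

/-- Reachability for the machine that runs the program. -/
abbrev CtlReaches : MConf (Ctl L × ℤ) → MConf (Ctl L × ℤ) → Prop :=
  MConf.Reaches (ctlTrans P) (.fin, 0)

lemma ctlReaches_move (q : Ctl L) (hq : q ≠ .fin) (z : ℤ) (t : ℤ → Option Bool) (i : ℤ) (ρ : QTape)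
    (h : ℤ) : CtlReaches P ⟨(q, z), t, i, ρ, h⟩ ⟨(q, 0), t, i + z, ρ, h⟩ := by
  induction hn : z.natAbs generalizing z i with
  | zero =>
    obtain rfl : z = 0 := by omega
    rw [add_zero]
  | succ n ih =>
    rcases lt_or_gt_of_ne (show z ≠ 0 by omega) with hz | hz
    · refine .head ⟨by simp [hq], rfl⟩ ?_
      have := ih (z + 1) (i - 1) (by omega)
      have e : i - 1 + (z + 1) = i + z := by ring
      rw [e] at this
      simpa [MConf.next, ctlTrans, hz.ne, not_lt.2 hz.le, QTape.applyGate_id, Dir.toInt,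
        sub_eq_add_neg] using this
    · refine .head ⟨by simp [hq], rfl⟩ ?_
      have := ih (z - 1) (i + 1) (by omega)
      have e : i + 1 + (z - 1) = i + z := by ring
      rw [e] at this
      simpa [MConf.next, ctlTrans, hz.ne', hz, QTape.applyGate_id, Dir.toInt] using this

lemma ctlReaches_act (q : Ctl L) (hq : q ≠ .fin) (t : ℤ → Option Bool) (i : ℤ) (ρ : QTape)
    (h : ℤ) {g : Gate} {d : Dir} {w : Option Bool} {z : ℤ} {q' : Ctl L}
    (hact : q.act P (t i) = (g, d, w, z, q')) (hq' : q' ≠ .fin ∨ z = 0) :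
    CtlReaches P ⟨(q, 0), t, i, ρ, h⟩
      ⟨(q', 0), Function.update t i w, i + z, ρ.applyGate g h, h + d.toInt⟩ := by
  refine .head (b := ⟨(q', z), Function.update t i w, i, ρ.applyGate g h, h + d.toInt⟩)
    ⟨by simp [hq], ?_⟩ ?_
  · simp [MConf.next, ctlTrans, hact, Dir.toInt]
  · rcases hq' with hq' | rfl
    · exact ctlReaches_move P q' hq' _ _ _ _ _
    · rw [add_zero]

/-- The special case of a classical action that keeps the scanned symbol. -/
lemma ctlReaches_keep (q : Ctl L) (hq : q ≠ .fin) (t : ℤ → Option Bool) (i : ℤ) (ρ : QTape)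
    (h : ℤ) {z : ℤ} {q' : Ctl L} (hact : q.act P (t i) = (.id, .N, t i, z, q')) (hq' : q' ≠ .fin) :
    CtlReaches P ⟨(q, 0), t, i, ρ, h⟩ ⟨(q', 0), t, i + z, ρ, h⟩ := by
  have := ctlReaches_act P q hq t i ρ h hact (.inl hq')
  simpa [QTape.applyGate_id, Dir.toInt] using this

/-- The tape holds the stacks. -/
def Holds (t : ℤ → Option Bool) (S : Track → BStr) : Prop :=
  ∀ k : Track, t k.off = none ∧ ∀ j : ℕ, t (k.cell j) = (S k).reverse[j]?

variable {P}

/-- The top of a stack is the symbol farthest from cell `0`, whence the reversal in `Holds`; a push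
writes to the first blank cell. -/
lemma Holds.push {t : ℤ → Option Bool} {S : Track → BStr} (H : Holds t S) (k : Track) (b : Bool) :
    Holds (Function.update t (k.cell (S k).length) (some b)) (Function.update S k (b :: S k)) := by
  intro k'
  refine ⟨?_, fun j => ?_⟩
  · rw [Function.update_of_ne (Track.cell_ne_off _ _ _).symm]; exact (H k').1
  · by_cases hk : k' = k
    · subst hk
      by_cases hj : j = (S k').length
      · subst hj; simp
      · rw [Function.update_of_ne (fun e => hj (Track.cell_inj e).2), (H k').2]
        simp only [Function.update_self, List.reverse_cons]
        rcases lt_or_gt_of_ne hj with h | h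
        · rw [List.getElem?_append_left (by simpa using h)]
        · rw [List.getElem?_eq_none (by simp; omega), List.getElem?_eq_none (by simp; omega)]
    · rw [Function.update_of_ne (fun e => hk (Track.cell_inj e).1), (H k').2,
        Function.update_of_ne hk]

lemma Holds.pop {t : ℤ → Option Bool} {S : Track → BStr} (H : Holds t S) (k : Track) {b : Bool}
    {w : BStr} (hw : S k = b :: w) :
    Holds (Function.update t (k.cell w.length) none) (Function.update S k w) := by
  intro k'
  refine ⟨?_, fun j => ?_⟩
  · rw [Function.update_of_ne (Track.cell_ne_off _ _ _).symm]; exact (H k').1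
  · by_cases hk : k' = k
    · subst hk
      by_cases hj : j = w.length
      · subst hj; simp
      · rw [Function.update_of_ne (fun e => hj (Track.cell_inj e).2), (H k').2]
        simp only [Function.update_self, hw, List.reverse_cons]
        rcases lt_or_gt_of_ne hj with h | h
        · rw [List.getElem?_append_left (by simpa using h)]
        · rw [List.getElem?_eq_none (by simp; omega), List.getElem?_eq_none (by simp; omega)]
    · rw [Function.update_of_ne (fun e => hk (Track.cell_inj e).1), (H k').2,
        Function.update_of_ne hk]

lemma Holds.nonblank {t : ℤ → Option Bool} {S : Track → BStr} (H : Holds t S) (k : Track) {j : ℕ}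
    (hj : j < (S k).length) : ∃ b, t (k.cell j) = some b := by
  rw [(H k).2, List.getElem?_eq_getElem (by simpa using hj)]
  exact ⟨_, rfl⟩

lemma Holds.top {t : ℤ → Option Bool} {S : Track → BStr} (H : Holds t S) (k : Track) :
    t (k.cell (S k).length) = none := by
  rw [(H k).2, List.getElem?_eq_none (by simp)]

lemma Track.cell_add (k : Track) (j : ℕ) : k.cell j + k.stride = k.cell (j + 1) := by
  simp only [Track.cell]; push_cast; ring

/-- The head walks up a stack. -/
lemma ctlReaches_walk {t : ℤ → Option Bool} (k : Track) (l : L) (ρ : QTape) (h : ℤ)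
    (hP : (∃ b l', P l = .push k b l') ∨ ∃ f, P l = .pop k f) (n : ℕ)
    (ht : ∀ j < n, ∃ b, t (k.cell j) = some b) :
    CtlReaches P ⟨(.walk l, 0), t, k.cell 0, ρ, h⟩ ⟨(.walk l, 0), t, k.cell n, ρ, h⟩ := by
  induction n with
  | zero => exact .refl
  | succ n ih =>
    refine (ih fun j hj => ht j (by omega)).trans ?_
    obtain ⟨b, hb⟩ := ht n (by omega)
    have := ctlReaches_keep P (.walk l) (by simp) t (k.cell n) ρ h (z := k.stride) (q' := .walk l)
      (by rcases hP with ⟨b, l', hP⟩ | ⟨f, hP⟩ <;> simp [Ctl.act, hb, hP]) (by simp)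
    rwa [Track.cell_add] at this

/-- The head walks down a stack and returns to its resting position. -/
lemma ctlReaches_back {t : ℤ → Option Bool} (k : Track) (l : L) (ρ : QTape) (h : ℤ) (n : ℕ)
    (ht : ∀ j < n, ∃ b, t (k.cell j) = some b) (h0 : t k.off = none) :
    CtlReaches P ⟨(.back k l, 0), t, k.cell n - k.stride, ρ, h⟩ ⟨(.lab l, 0), t, 0, ρ, h⟩ := by
  induction n with
  | zero =>
    have e : k.cell 0 - k.stride = k.off := by simp [Track.cell]
    rw [e]
    have := ctlReaches_keep P (.back k l) (by simp) t k.off ρ h (z := -k.off) (q' := .lab l)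
      (by simp [Ctl.act, h0]) (by simp)
    simpa using this
  | succ n ih =>
    refine .trans ?_ (ih fun j hj => ht j (by omega))
    obtain ⟨b, hb⟩ := ht n (by omega)
    rw [← Track.cell_add, add_sub_cancel_right]
    exact ctlReaches_keep P (.back k l) (by simp) t (k.cell n) ρ h (z := -k.stride)
      (q' := .back k l) (by simp [Ctl.act, hb]) (by simp)

lemma Track.off_add_stride (k : Track) : 0 + (k.off + k.stride) = k.cell 0 := by
  simp [Track.cell]

/-- The machine simulates a step of the program. -/
theorem ctlReaches_of_sstep {c c' : SConf L} (hs : SStep P c c') {t : ℤ → Option Bool}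
    (H : Holds t c.stk) : ∃ t', Holds t' c'.stk ∧
      CtlReaches P ⟨(.lab c.lab, 0), t, 0, c.qtape, c.qhead⟩
        ⟨(.lab c'.lab, 0), t', 0, c'.qtape, c'.qhead⟩ := by
  cases hs with
  | @gate l S ρ h g d l' e =>
    refine ⟨t, H, ?_⟩
    have := ctlReaches_act P (.lab l) (by simp) t 0 ρ h (g := g) (d := d) (w := t 0) (z := 0)
      (q' := .lab l') (by simp [Ctl.act, e]) (by simp)
    simpa using this
  | @push l S ρ h k b l' e =>
    refine ⟨_, H.push k b, ?_⟩
    have h1 := ctlReaches_keep P (.lab l) (by simp) t 0 ρ h (z := k.off + k.stride)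
      (q' := .walk l) (by simp [Ctl.act, e]) (by simp)
    rw [Track.off_add_stride] at h1
    refine h1.trans ((ctlReaches_walk k l ρ h (.inl ⟨b, l', e⟩) (S k).length
      (fun j hj => H.nonblank k hj)).trans ?_)
    have h2 := ctlReaches_act P (.walk l) (by simp) t (k.cell (S k).length) ρ h (g := .id)
      (d := .N) (w := some b) (z := -k.stride) (q' := .back k l')
      (by simp only [] at H; simp [Ctl.act, H.top k, e]) (by simp)
    rw [QTape.applyGate_id] at h2
    simp only [Dir.toInt, add_zero] at h2
    refine h2.trans (ctlReaches_back k l' ρ h (S k).length (fun j hj => ?_) ?_)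
    · rw [Function.update_of_ne (fun e => hj.ne (Track.cell_inj e).2)]
      exact H.nonblank k hj
    · rw [Function.update_of_ne (Track.cell_ne_off _ _ _).symm]; exact (H k).1
  | @pop l S ρ h k f e =>
    have h1 := ctlReaches_keep P (.lab l) (by simp) t 0 ρ h (z := k.off + k.stride)
      (q' := .walk l) (by simp [Ctl.act, e]) (by simp)
    rw [Track.off_add_stride] at h1
    have h2 := h1.trans (ctlReaches_walk k l ρ h (.inr ⟨f, e⟩) (S k).length
      (fun j hj => H.nonblank k hj))
    have h3 := h2.trans (ctlReaches_keep P (.walk l) (by simp) t (k.cell (S k).length) ρ h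
      (z := -k.stride) (q' := .popat l)
      (by simp only [] at H; simp [Ctl.act, H.top k, e]) (by simp))
    -- On an empty stack the walk up stops at once, and the step back leads to the blank cell
    -- `k.off`; this is how emptiness is noticed.
    rcases hS : S k with _ | ⟨b, w⟩
    · refine ⟨t, ?_, h3.trans ?_⟩
      · simp only [List.tail_nil]
        rw [← hS, Function.update_eq_self]; exact H
      · rw [hS]
        have e0 : k.cell ([] : BStr).length + -k.stride = k.off := by simp [Track.cell]
        rw [e0]
        have := ctlReaches_keep P (.popat l) (by simp) t k.off ρ h (z := -k.off)
          (q' := .lab (f none)) (by simp [Ctl.act, (H k).1, e]) (by simp)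
        simpa using this
    · refine ⟨_, by simpa [hS] using H.pop k hS, h3.trans ?_⟩
      rw [hS]
      have e0 : k.cell (b :: w).length + -k.stride = k.cell w.length := by
        rw [List.length_cons, ← Track.cell_add]; ring
      rw [e0]
      have hb : t (k.cell w.length) = some b := by
        rw [(H k).2]; simp [hS]
      have h4 := ctlReaches_act P (.popat l) (by simp) t (k.cell w.length) ρ h (g := .id)
        (d := .N) (w := none) (z := -k.stride) (q' := .back k (f (some b)))
        (by simp [Ctl.act, hb, e]) (by simp)
      rw [QTape.applyGate_id] at h4
      simp only [Dir.toInt, add_zero] at h4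
      refine h4.trans (ctlReaches_back k _ ρ h w.length (fun j hj => ?_) ?_)
      · rw [Function.update_of_ne (fun e => hj.ne (Track.cell_inj e).2)]
        exact H.nonblank k (by simp [hS]; omega)
      · rw [Function.update_of_ne (Track.cell_ne_off _ _ _).symm]; exact (H k).1

theorem ctlReaches_of_reaches {c c' : SConf L} (hs : Relation.ReflTransGen (SStep P) c c')
    {t : ℤ → Option Bool} (H : Holds t c.stk) : ∃ t', Holds t' c'.stk ∧
      CtlReaches P ⟨(.lab c.lab, 0), t, 0, c.qtape, c.qhead⟩
        ⟨(.lab c'.lab, 0), t', 0, c'.qtape, c'.qhead⟩ := by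
  induction hs with
  | refl => exact ⟨t, H, .refl⟩
  | tail _ h ih =>
    obtain ⟨t', H', h'⟩ := ih
    obtain ⟨t'', H'', h''⟩ := ctlReaches_of_sstep h H'
    exact ⟨t'', H'', h'.trans h''⟩

end Run

/-- A stack program that can reach finitely many labels only is run by a machine. The output string
is on the stack `none`, above a symbol that is erased. -/
theorem exists_dcqTM_of_program {L : Type} (P : L → Instr L) (l₀ : L) (F : Set L) (hF : F.Finite)
    (h₀ : l₀ ∈ F) (hcl : ∀ l ∈ F, (P l).targets ⊆ F) :
    ∃ T : DcqTM, ∀ (x : BStr) (c : SConf L) (b : Bool) (n : ℕ) (τ : QState n),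
      Relation.ReflTransGen (SStep P)
        ⟨l₀, Function.update (fun _ => []) none x.reverse, QTape.init QState.empty, 0⟩ c →
      P c.lab = .halt → c.stk none = (b :: natStr n).reverse → c.qtape.reduced n = τ.mat →
      T.Outputs x QState.empty [] τ := by
  classical
  -- A pending move starts as a sum of at most one offset and one stride, up to sign, so it stays
  -- within `±8`. This bounds the counter in the state.
  let G : Set (Ctl L × ℤ) := {q | (∀ l, (q.1 = .lab l ∨ q.1 = .walk l ∨ q.1 = .popat l ∨
    ∃ k, q.1 = .back k l) → l ∈ F) ∧ q.2 ∈ Set.Icc (-8) 8}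
  have hG : G.Finite := by
    have : Finite F := hF
    have h1 : (Set.range fun l : F => Ctl.lab l.1).Finite := Set.finite_range _
    have h2 : (Set.range fun l : F => Ctl.walk l.1).Finite := Set.finite_range _
    have h3 : (Set.range fun l : F => Ctl.popat l.1).Finite := Set.finite_range _
    have hK : Finite Turing.PartrecToTM2.K' :=
      Finite.of_surjective (fun i : Fin 4 => match i with
        | 0 => Turing.PartrecToTM2.K'.main
        | 1 => .rev
        | 2 => .aux
        | 3 => .stack) (by rintro (_ | _ | _ | _); exacts [⟨0, rfl⟩, ⟨1, rfl⟩, ⟨2, rfl⟩, ⟨3, rfl⟩])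
    have h4 : (Set.range fun l : Track × F => Ctl.back l.1 l.2.1).Finite := Set.finite_range _
    refine (((((h1.union h2).union h3).union h4).union (Set.toFinite {.erase, .fin})).prod
      (Set.finite_Icc (-8 : ℤ) 8)).subset ?_
    rintro ⟨q, z⟩ ⟨hq, hz⟩
    refine ⟨?_, hz⟩
    rcases q with l | l | l | ⟨k, l⟩ | _ | _
    · exact .inl (.inl (.inl (.inl ⟨⟨l, hq l (by simp)⟩, rfl⟩)))
    · exact .inl (.inl (.inl (.inr ⟨⟨l, hq l (by simp)⟩, rfl⟩)))
    · exact .inl (.inl (.inr ⟨⟨l, hq l (by simp)⟩, rfl⟩))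
    · exact .inl (.inr ⟨(k, ⟨l, hq l (by simp)⟩), rfl⟩)
    · simp
    · simp
  have hcl' : ∀ q ∈ G, ∀ o, (ctlTrans P q o).2.2.2.2 ∈ G := by
    rintro ⟨q, z⟩ ⟨hq, hz⟩ o
    by_cases h0 : z = 0
    · have hb (k : Track) : k.off ∈ Set.Icc (-4 : ℤ) 0 ∧ k.stride ∈ Set.Icc (-4 : ℤ) 1 := by
        rcases k with _ | _ | _ | _ | _ <;> simp [Track.off, Track.stride]
      have hb2 (k : Track) : -8 ≤ k.off + k.stride ∧ k.off + k.stride ≤ 8 ∧ -8 ≤ -k.off ∧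
          -k.off ≤ 8 ∧ -8 ≤ k.stride ∧ k.stride ≤ 8 ∧ -8 ≤ -k.stride ∧ -k.stride ≤ 8 := by
        have := hb k
        simp only [Set.mem_Icc] at this
        omega
      subst h0
      simp only [ctlTrans, if_true]
      rcases q with l | l | l | ⟨k, l⟩ | _ | _ <;> rcases o with _ | o <;>
        simp only [Ctl.act] <;>
        (try have hl := hq l (by simp)) <;> (try have hl' := hcl l hl) <;>
        (try cases hP : P l with
          | push k b l' => ?_
          | pop k f => ?_
          | gate g d l' => ?_
          | halt => ?_) <;>
        (try simp only [hP, Instr.targets, Set.singleton_subset_iff, Set.range_subset_iff] at hl') <;>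
        (try have hk := hb2 k) <;>
        (simp only [G, Set.mem_ofPred_eq, Set.mem_Icc]; simp [*])
    · have hz' := Set.mem_Icc.1 hz
      simp only [ctlTrans, h0, if_false]
      split_ifs with h
      · exact ⟨hq, Set.mem_Icc.2 (by simp only; omega)⟩
      · exact ⟨hq, Set.mem_Icc.2 (by simp only; omega)⟩
  let s : G := ⟨(.lab l₀, 0), by simp [G, h₀]⟩
  let h : G := ⟨(.fin, 0), by simp [G]⟩
  refine ⟨DcqTM.ofTrans (ctlTrans P) G hG s h (by simp [s, h]), ?_⟩
  intro x c b n τ hr hhalt hout hτ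
  -- The input starts at cell `1`, so its last symbol is on top of the stack `none`.
  have H0 : Holds (MConf.start s.1 x).ctape (Function.update (fun _ => []) none x.reverse) := by
    intro k
    rcases k with _ | k
    · refine ⟨by simp [MConf.start, Track.off], fun j => ?_⟩
      simp only [MConf.start, Track.cell, Track.off, Track.stride]
      rw [if_pos (by omega)]
      simp only [Function.update_self, List.reverse_reverse, List.getD_eq_getElem?_getD]
      have : (0 + 1 * ((j : ℤ) + 1) - 1).toNat = j := by omega
      rw [this, List.getElem?_map]
      cases x[j]? <;> rfl
    · have h1 : ∀ i : ℤ, i ≤ 0 → (MConf.start s.1 x).ctape i = none := fun i hi => by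
        simp only [MConf.start]; rw [if_neg (by omega)]
      refine ⟨h1 _ (by cases k <;> simp [Track.off]), fun j => ?_⟩
      rw [h1 _ (by cases k <;> simp only [Track.cell, Track.off, Track.stride] <;> omega)]
      simp
  obtain ⟨t', H', hr'⟩ := ctlReaches_of_reaches hr H0
  -- At the end the head erases the bottom symbol `b` in cell `1`. The blank left there is the
  -- separator after the empty classical output, and `natStr n` follows from cell `2` on.
  have h1 := ctlReaches_keep P (.lab c.lab) (by simp) t' 0 c.qtape c.qhead (z := 1)
    (q' := .erase) (by simp [Ctl.act, hhalt]) (by simp)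
  have h2 := ctlReaches_act P .erase (by simp) t' (0 + 1) c.qtape c.qhead (g := .id) (d := .N)
    (w := none) (z := 0) (q' := .fin) (by simp [Ctl.act]) (by simp)
  refine DcqTM.ofTrans_outputs hcl' ((hr'.trans h1).trans h2) rfl (y := []) ?_ ?_
  · intro i hi
    simp only [List.map_nil, List.nil_append]
    rcases i with _ | i
    · simp
    · have hi' : i < (natStr n).length + 1 := by simpa using hi
      have := (H' none).2 (i + 1)
      rw [hout, List.reverse_reverse] at this
      simp only [Track.cell, Track.off, Track.stride] at this
      rw [Function.update_of_ne (by push_cast; omega)]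
      have e : ((i + 1 : ℕ) : ℤ) + 1 = 0 + 1 * (((i + 1 : ℕ) : ℤ) + 1) := by ring
      rw [e, this]
      simp only [List.getElem?_cons_succ, List.getElem_cons_succ]
      rcases Nat.lt_succ_iff_lt_or_eq.1 hi' with h | rfl
      · rw [List.getElem_append_left (by simpa using h)]
        simp [h]
      · simp
  · simpa [QTape.applyGate_id] using hτ

/-! ### Coding strings by numbers -/

/-- The number with the binary digits `x`, least significant first, and a leading digit `1`. -/
def strCode : BStr → ℕ
  | [] => 1
  | b :: x => Nat.bit b (strCode x)

lemma strCode_pos (x : BStr) : 0 < strCode x := by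
  induction x with
  | nil => simp [strCode]
  | cons b x ih => cases b <;> simp [strCode, Nat.bit, ih]

/-- The leading digit `1` preserves the high-order zeros of the string. -/
lemma strCode_injective : Function.Injective strCode := by
  intro x
  induction x with
  | nil =>
    rintro (_ | ⟨b, y⟩) h
    · rfl
    · have := strCode_pos y
      cases b <;> (simp [strCode, Nat.bit] at h; omega)
  | cons b x ih =>
    rintro (_ | ⟨b', y⟩) h
    · have := strCode_pos x
      cases b <;> simp [strCode, Nat.bit, this.ne'] at h
    · have h1 : b = b' ∧ strCode x = strCode y := by
        cases b <;> cases b' <;> simp [strCode, Nat.bit] at h ⊢ <;> omega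
      rw [h1.1, ih h1.2]

open Turing.PartrecToTM2 in
/-- The stack symbol of a binary digit. -/
def bitSym (b : Bool) : Γ' := if b then .bit1 else .bit0

-- On the stack of the simulated machine, the code of a string is the string itself followed by one
-- more digit. Hence input and output need only copying, no arithmetic.
open Turing.PartrecToTM2 in
lemma trNat_strCode (x : BStr) : trNat (strCode x) = x.map bitSym ++ [.bit1] := by
  induction x with
  | nil => rfl
  | cons b x ih =>
    have hpos := strCode_pos x
    have h1 : trNat (strCode (b :: x)) = bitSym b :: trNat (strCode x) := by
      simp only [trNat, strCode, ← Num.ofNat'_eq, Num.ofNat'_bit]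
      rcases h : Num.ofNat' (strCode x) with _ | p
      · exfalso
        have h2 := congrArg (fun n : Num => (n : ℕ)) h
        simp only [Num.ofNat'_eq, Num.to_of_nat] at h2
        rw [h2] at hpos
        exact absurd hpos (by decide)
      · cases b <;> rfl
    rw [h1, ih]
    rfl

/-! ### Circuits and their encoding by strings -/

/-- A sequence of gates and moves of the quantum head. -/
abbrev Circuit := List (Gate × Dir)

/-- The effect of a circuit on the quantum tape and on the position of the quantum head. -/
def Circuit.run (C : Circuit) (p : QTape × ℤ) : QTape × ℤ :=
  C.foldl (fun p a => (p.1.applyGate a.1 p.2, p.2 + a.2.toInt)) p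

lemma Circuit.run_cons (a : Gate × Dir) (C : Circuit) (p : QTape × ℤ) :
    Circuit.run (a :: C) p = Circuit.run C (p.1.applyGate a.1 p.2, p.2 + a.2.toInt) := rfl

lemma Circuit.run_append (C C' : Circuit) (p : QTape × ℤ) :
    Circuit.run (C ++ C') p = Circuit.run C' (Circuit.run C p) := List.foldl_append

/-- The number of a gate. -/
def Gate.toNat : Gate → ℕ
  | .id => 0
  | .had => 1
  | .phase => 2
  | .piEighth => 3
  | .swap => 4
  | .cnot => 5

/-- The gate with a given number. -/
def Gate.ofNat : ℕ → Gate
  | 0 => .id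
  | 1 => .had
  | 2 => .phase
  | 3 => .piEighth
  | 4 => .swap
  | _ => .cnot

/-- The number of a direction. -/
def Dir.toNat : Dir → ℕ
  | .L => 0
  | .N => 1
  | .R => 2

/-- The direction with a given number. -/
def Dir.ofNat : ℕ → Dir
  | 0 => .L
  | 1 => .N
  | _ => .R

/-- The string of the `j`-th elementary operation. -/
def tokStr (j : ℕ) : BStr := List.replicate j true ++ [false]

/-- The operation of a gate and a move. -/
def opTok (a : Gate × Dir) : ℕ := 3 * a.1.toNat + a.2.toNat

/-- The instructions to run a circuit and to output a string. -/
def progStr (C : Circuit) (s : BStr) : BStr :=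
  C.flatMap (fun a => tokStr (opTok a)) ++
    (tokStr 18 ++ (s.flatMap (fun b => tokStr (18 + b.toNat)) ++ tokStr 20))

/-! ### Simulation of a stack machine with four symbols -/

namespace StackSim

open Turing Turing.PartrecToTM2 Relation

/-- The two bits of a stack symbol. -/
def symBits : Γ' → Bool × Bool
  | .consₗ => (false, true)
  | .cons => (false, false)
  | .bit0 => (true, false)
  | .bit1 => (true, true)

/-- The stack symbol with the given bits. -/
def symOf : Bool → Bool → Γ'
  | false, true => .consₗ
  | false, false => .cons
  | true, false => .bit0
  | true, true => .bit1

lemma symOf_symBits (s : Γ') : symOf (symBits s).1 (symBits s).2 = s := by cases s <;> rfl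

/-- The first bit marks binary digits and the second is the digit, so `tok` may discard the first
and test only the second. -/
lemma symBits_bitSym (b : Bool) : symBits (bitSym b) = (true, b) := by cases b <;> rfl

/-- The binary content of a stack. -/
def encStack (w : List Γ') : BStr := w.flatMap fun s => [(symBits s).1, (symBits s).2]

lemma encStack_cons (s : Γ') (w : List Γ') :
    encStack (s :: w) = (symBits s).1 :: (symBits s).2 :: encStack w := rfl

/-- Statements of the simulated machine. -/
abbrev St := TM2.Stmt (fun _ : K' => Γ') Λ' (Option Γ')

/-- Labels of the simulating program. -/
inductive Lab
  | feed
  | push2 (k : K') (s : Γ') (l : Lab)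
  | push1 (k : K') (s : Γ') (l : Lab)
  | run (q : St) (v : Option Γ')
  | popped (q : St) (v : Option Γ') (b : Bool)
  | tok (j : ℕ)
  | tok' (j : ℕ)
  | exec (j : ℕ)

/-- The simulating program, for the simulated machine started at `l₀`. -/
def prog (l₀ : Λ') : Lab → Instr Lab
  | .feed => .pop none fun o => match o with
    | none => .run (tr l₀) none
    | some b => .push2 .main (bitSym b) .feed
  | .push2 k s l => .push (some k) (symBits s).2 (.push1 k s l)
  | .push1 k s l => .push (some k) (symBits s).1 l
  | .run (.push k f q) v => .push (some k) (symBits (f v)).2 (.push1 k (f v) (.run q v))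
  | .run (.peek k f q) v => .pop (some k) fun o => match o with
    | none => .run q (f v none)
    | some b => .popped (.peek k f q) v b
  | .run (.pop k f q) v => .pop (some k) fun o => match o with
    | none => .run q (f v none)
    | some b => .popped (.pop k f q) v b
  | .run (.load a q) v => .gate .id .N (.run q (a v))
  | .run (.branch f q₁ q₂) v => .gate .id .N (.run (cond (f v) q₁ q₂) v)
  | .run (.goto l) v => .gate .id .N (.run (tr (l v)) v)
  | .run .halt _ => .gate .id .N (.tok 0)
  | .popped (.peek k f q) v b => .pop (some k) fun o =>
      .push2 k (symOf b (o.getD false)) (.run q (f v (some (symOf b (o.getD false)))))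
  | .popped (.pop k f q) v b => .pop (some k) fun o =>
      .run q (f v (some (symOf b (o.getD false))))
  | .popped _ _ _ => .halt
  | .tok j => .pop (some .main) fun _ => .tok' j
  | .tok' j => .pop (some .main) fun o => if o = some true then .tok (min (j + 1) 20) else .exec j
  | .exec j =>
    if j < 18 then .gate (Gate.ofNat (j / 3)) (Dir.ofNat (j % 3)) (.tok 0)
    else if j = 18 then .push none false (.tok 0)
    else if j = 19 then .push none true (.tok 0)
    else .halt

/-- The label at which the program starts. -/
def startLab : Lab := .push2 .main .cons (.push2 .main .bit1 .feed)

/-- The type `Lab` is infinite, but only substatements of the statements of the finite support `S`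
are run, and token counters stop at 20. `A` collects the labels between two operations, `B` adds the
nested push of `startLab`, and `F` adds the labels inside a two-bit push or pop. -/
lemma finite_closed (l₀ : Λ') (S : Finset Λ') (h₀ : l₀ ∈ S)
    (hS : ∀ q ∈ S, TM2.SupportsStmt S (tr q)) :
    ∃ F : Set Lab, F.Finite ∧ startLab ∈ F ∧ ∀ l ∈ F, (prog l₀ l).targets ⊆ F := by
  let Q : Set St := {q | ∃ l ∈ S, q ∈ TM2.stmts₁ (tr l)}
  have hQ : Q.Finite := by
    have : Q = ⋃ l ∈ S, (↑(TM2.stmts₁ (tr l)) : Set St) := by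
      ext q; simp [Q]
    rw [this]
    exact S.finite_toSet.biUnion fun l _ => Finset.finite_toSet _
  have hQ0 : ∀ l ∈ S, tr l ∈ Q := fun l hl => ⟨l, hl, TM2.stmts₁_self⟩
  have hQs : ∀ q ∈ Q, TM2.SupportsStmt S q := fun q ⟨l, hl, hq⟩ =>
    TM2.stmts₁_supportsStmt_mono hq (hS l hl)
  have hQt : ∀ q ∈ Q, ∀ q' ∈ TM2.stmts₁ q, q' ∈ Q := fun q ⟨l, hl, hq⟩ q' hq' =>
    ⟨l, hl, TM2.stmts₁_trans hq hq'⟩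
  let A : Set Lab := {.feed} ∪ Set.image2 Lab.run Q Set.univ ∪ Lab.tok '' Set.Iic 20 ∪
    Lab.tok' '' Set.Iic 20 ∪ Lab.exec '' Set.Iic 20
  have hA : A.Finite := ((((Set.finite_singleton _).union
    (hQ.image2 _ Set.finite_univ)).union ((Set.finite_Iic _).image _)).union
    ((Set.finite_Iic _).image _)).union ((Set.finite_Iic _).image _)
  let B : Set Lab := insert (.push2 .main .bit1 .feed) A
  have hK : Finite K' :=
    Finite.of_surjective (fun i : Fin 4 => match i with
      | 0 => K'.main
      | 1 => .rev
      | 2 => .aux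
      | 3 => .stack) (by rintro (_ | _ | _ | _); exacts [⟨0, rfl⟩, ⟨1, rfl⟩, ⟨2, rfl⟩, ⟨3, rfl⟩])
  have : Finite B := hA.insert _
  have : Finite Q := hQ
  let F : Set Lab := A ∪ (Set.range fun p : K' × Γ' × B => Lab.push2 p.1 p.2.1 p.2.2.1) ∪
    (Set.range fun p : K' × Γ' × B => Lab.push1 p.1 p.2.1 p.2.2.1) ∪
    (Set.range fun p : Q × Option Γ' × Bool => Lab.popped p.1.1 p.2.1 p.2.2)
  have mfeed : Lab.feed ∈ A := by simp [A]
  have mrun : ∀ q ∈ Q, ∀ v, Lab.run q v ∈ A := fun q hq v => by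
    simp only [A, Set.mem_union]; exact .inl (.inl (.inl (.inr ⟨q, hq, v, trivial, rfl⟩)))
  have mtok : ∀ j ≤ 20, Lab.tok j ∈ A := fun j hj => by
    simp only [A, Set.mem_union]; exact .inl (.inl (.inr ⟨j, hj, rfl⟩))
  have mtok' : ∀ j ≤ 20, Lab.tok' j ∈ A := fun j hj => by
    simp only [A, Set.mem_union]; exact .inl (.inr ⟨j, hj, rfl⟩)
  have mexec : ∀ j ≤ 20, Lab.exec j ∈ A := fun j hj => by
    simp only [A, Set.mem_union]; exact .inr ⟨j, hj, rfl⟩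
  have mA : A ⊆ F := fun l hl => .inl (.inl (.inl hl))
  have mp2 : ∀ k s, ∀ l ∈ B, Lab.push2 k s l ∈ F := fun k s l hl =>
    .inl (.inl (.inr ⟨(k, s, ⟨l, hl⟩), rfl⟩))
  have mp1 : ∀ k s, ∀ l ∈ B, Lab.push1 k s l ∈ F := fun k s l hl =>
    .inl (.inr ⟨(k, s, ⟨l, hl⟩), rfl⟩)
  have mpp : ∀ q ∈ Q, ∀ v b, Lab.popped q v b ∈ F := fun q hq v b => .inr ⟨(⟨q, hq⟩, v, b), rfl⟩
  have mB : B ⊆ F := by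
    rintro l (rfl | hl)
    · exact mp2 _ _ _ (.inr mfeed)
    · exact mA hl
  refine ⟨F, (((hA.union (Set.finite_range _)).union (Set.finite_range _)).union
    (Set.finite_range _)), mp2 _ _ _ (.inl rfl), ?_⟩
  rintro l (((hl | ⟨⟨k, s, l', hl'⟩, rfl⟩) | ⟨⟨k, s, l', hl'⟩, rfl⟩) | ⟨⟨⟨q, hq⟩, v, b⟩, rfl⟩)
  · rcases hl with (((rfl | ⟨q, hq, v, -, rfl⟩) | ⟨j, hj, rfl⟩) | ⟨j, hj, rfl⟩) | ⟨j, hj, rfl⟩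
    · rintro _ ⟨o, rfl⟩
      rcases o with _ | b
      · exact mA (mrun _ (hQ0 _ h₀) _)
      · exact mp2 _ _ _ (.inr mfeed)
    · cases q with
      | push k f q =>
        rintro _ rfl
        exact mp1 _ _ _ (.inr (mrun _ (hQt _ hq _ (by simp [TM2.stmts₁, TM2.stmts₁_self])) _))
      | peek k f q =>
        rintro _ ⟨o, rfl⟩
        rcases o with _ | b
        · exact mA (mrun _ (hQt _ hq _ (by simp [TM2.stmts₁, TM2.stmts₁_self])) _)
        · exact mpp _ hq _ _
      | pop k f q =>
        rintro _ ⟨o, rfl⟩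
        rcases o with _ | b
        · exact mA (mrun _ (hQt _ hq _ (by simp [TM2.stmts₁, TM2.stmts₁_self])) _)
        · exact mpp _ hq _ _
      | load a q =>
        rintro _ rfl
        exact mA (mrun _ (hQt _ hq _ (by simp [TM2.stmts₁, TM2.stmts₁_self])) _)
      | branch f q₁ q₂ =>
        rintro _ rfl
        refine mA (mrun _ (hQt _ hq _ ?_) _)
        cases f v <;> simp [TM2.stmts₁, TM2.stmts₁_self]
      | goto l =>
        rintro _ rfl
        exact mA (mrun _ (hQ0 _ (hQs _ hq v)) _)
      | halt =>
        rintro _ rfl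
        exact mA (mtok _ (by simp))
    · rintro _ ⟨o, rfl⟩
      exact mA (mtok' _ hj)
    · rintro _ ⟨o, rfl⟩
      simp only
      split_ifs
      · exact mA (mtok _ (min_le_right _ _))
      · exact mA (mexec _ hj)
    · simp only [prog]
      split_ifs
      · rintro _ rfl; exact mA (mtok _ (by simp))
      · rintro _ rfl; exact mA (mtok _ (by simp))
      · rintro _ rfl; exact mA (mtok _ (by simp))
      · simp [Instr.targets]
  · rintro _ rfl
    exact mp1 _ _ _ hl'
  · rintro _ rfl
    exact mB hl'
  · cases q with
    | peek k f q =>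
      rintro _ ⟨o, rfl⟩
      exact mp2 _ _ _ (.inr (mrun _ (hQt _ hq _ (by simp [TM2.stmts₁, TM2.stmts₁_self])) _))
    | pop k f q =>
      rintro _ ⟨o, rfl⟩
      exact mA (mrun _ (hQt _ hq _ (by simp [TM2.stmts₁, TM2.stmts₁_self])) _)
    | _ => simp [prog, Instr.targets]

/-- The binary stacks that represent the stacks `S`, with `o` on the input/output stack. -/
def encStk (S : K' → List Γ') (o : BStr) : Track → BStr
  | none => o
  | some k => encStack (S k)

lemma encStk_some (S : K' → List Γ') (o : BStr) (k : K') :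
    encStk S o (some k) = encStack (S k) := rfl

lemma update_encStk (S : K' → List Γ') (o : BStr) (k : K') (w : List Γ') :
    Function.update (encStk S o) (some k) (encStack w) = encStk (Function.update S k w) o := by
  funext k'
  rcases k' with _ | k'
  · simp [encStk]
  · by_cases h : k' = k
    · subst h; simp [encStk]
    · rw [Function.update_of_ne (by simpa using h)]
      simp [encStk, Function.update_of_ne h]

lemma update_encStk_none (S : K' → List Γ') (o o' : BStr) :
    Function.update (encStk S o) none o' = encStk S o' := by
  funext k'
  rcases k' with _ | k' <;> simp [encStk]

variable {l₀ : Λ'}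

/-- Reachability for the simulating program. -/
abbrev PReaches (l₀ : Λ') : SConf Lab → SConf Lab → Prop := ReflTransGen (SStep (prog l₀))

lemma reaches_goto {l l' : Lab} (h : prog l₀ l = .gate .id .N l') (S : Track → BStr) (ρ : QTape)
    (i : ℤ) : PReaches l₀ ⟨l, S, ρ, i⟩ ⟨l', S, ρ, i⟩ := by
  have := SStep.gate (S := S) (q := ρ) (h := i) h
  rw [QTape.applyGate_id] at this
  simp only [Dir.toInt, add_zero] at this
  exact .single this

lemma reaches_push1 (k : K') (s : Γ') (l : Lab) (S : K' → List Γ') (o : BStr) (ρ : QTape) (i : ℤ) :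
    PReaches l₀ ⟨.push1 k s l,
        Function.update (encStk S o) (some k) ((symBits s).2 :: encStack (S k)), ρ, i⟩
      ⟨l, encStk (Function.update S k (s :: S k)) o, ρ, i⟩ := by
  have := SStep.push (P := prog l₀) (l := .push1 k s l)
    (S := Function.update (encStk S o) (some k) ((symBits s).2 :: encStack (S k)))
    (q := ρ) (h := i) rfl
  simp only [Function.update_self, Function.update_idem] at this
  rw [← encStack_cons, update_encStk] at this
  exact .single this

lemma reaches_push2 (k : K') (s : Γ') (l : Lab) (S : K' → List Γ') (o : BStr) (ρ : QTape) (i : ℤ) :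
    PReaches l₀ ⟨.push2 k s l, encStk S o, ρ, i⟩
      ⟨l, encStk (Function.update S k (s :: S k)) o, ρ, i⟩ :=
  .head (SStep.push rfl) (reaches_push1 k s l S o ρ i)

/-- Popping a symbol in two steps. -/
lemma reaches_pop {l : Lab} {k : K'} {f : Option Bool → Lab} {f' : Bool → Option Bool → Lab}
    (h : prog l₀ l = .pop (some k) f)
    (h' : ∀ b, prog l₀ (f (some b)) = .pop (some k) (f' b)) {s : Γ'} {w : List Γ'}
    (S : K' → List Γ') (hS : S k = s :: w) (o : BStr) (ρ : QTape) (i : ℤ) :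
    PReaches l₀ ⟨l, encStk S o, ρ, i⟩
      ⟨f' (symBits s).1 (some (symBits s).2), encStk (Function.update S k w) o, ρ, i⟩ := by
  have h1 := SStep.pop (S := encStk S o) (q := ρ) (h := i) h
  rw [encStk_some, hS, encStack_cons] at h1
  have h2 := SStep.pop (S := Function.update (encStk S o) (some k) ((symBits s).2 :: encStack w))
    (q := ρ) (h := i) (h' (symBits s).1)
  simp only [Function.update_self, Function.update_idem, List.tail_cons, List.head?_cons] at h2
  rw [update_encStk] at h2
  exact .head h1 (.single h2)

lemma reaches_pop_nil {l : Lab} {k : K'} {f : Option Bool → Lab}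
    (h : prog l₀ l = .pop (some k) f) (S : K' → List Γ') (hS : S k = []) (o : BStr) (ρ : QTape)
    (i : ℤ) : PReaches l₀ ⟨l, encStk S o, ρ, i⟩ ⟨f none, encStk S o, ρ, i⟩ := by
  have h1 := SStep.pop (S := encStk S o) (q := ρ) (h := i) h
  rw [Function.update_eq_self_iff.2 (by simp [encStk, hS, encStack])] at h1
  rw [encStk_some, hS] at h1
  exact .single h1

/-- The label that corresponds to a label of the simulated machine. -/
def labOf : Option Λ' → Option Γ' → Lab
  | none, _ => .tok 0
  | some l, v => .run (tr l) v

/-- One step of the simulated machine executes a whole statement, whence the induction on it. A peek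
is simulated by a pop followed by pushing the symbol back. -/
lemma reaches_stepAux (q : St) (v : Option Γ') (S : K' → List Γ') (o : BStr) (ρ : QTape) (i : ℤ) :
    PReaches l₀ ⟨.run q v, encStk S o, ρ, i⟩
      ⟨labOf (TM2.stepAux q v S).l (TM2.stepAux q v S).var,
        encStk (TM2.stepAux q v S).stk o, ρ, i⟩ := by
  induction q generalizing v S with
  | push k f q ih =>
    exact .trans (.head (SStep.push rfl) (reaches_push1 k (f v) _ S o ρ i)) (ih _ _)
  | peek k f q ih =>
    rcases hS : S k with _ | ⟨s, w⟩
    · refine (reaches_pop_nil (l₀ := l₀) (l := .run (.peek k f q) v) rfl S hS o ρ i).trans ?_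
      have := ih (f v none) S
      simp only [TM2.stepAux, hS, List.head?_nil]
      exact this
    · have h1 := reaches_pop (l₀ := l₀) (l := .run (.peek k f q) v) rfl
        (f' := fun b o => .push2 k (symOf b (o.getD false))
          (.run q (f v (some (symOf b (o.getD false)))))) (fun b => rfl) S hS o ρ i
      simp only [Option.getD_some, symOf_symBits] at h1
      refine h1.trans ((reaches_push2 k s _ _ o ρ i).trans ?_)
      simp only [Function.update_self, Function.update_idem]
      rw [← hS, Function.update_eq_self]
      simpa [hS] using ih (f v (some s)) S
  | pop k f q ih =>
    rcases hS : S k with _ | ⟨s, w⟩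
    · refine (reaches_pop_nil (l₀ := l₀) (l := .run (.pop k f q) v) rfl S hS o ρ i).trans ?_
      have := ih (f v none) S
      simp only [TM2.stepAux, hS, List.head?_nil, List.tail_nil]
      rwa [← hS, Function.update_eq_self]
    · have h1 := reaches_pop (l₀ := l₀) (l := .run (.pop k f q) v) rfl
        (f' := fun b o => .run q (f v (some (symOf b (o.getD false))))) (fun b => rfl) S hS o ρ i
      simp only [Option.getD_some, symOf_symBits] at h1
      refine h1.trans ?_
      simpa [hS] using ih (f v (some s)) (Function.update S k w)
  | load a q ih => exact (reaches_goto rfl _ _ _).trans (ih _ _)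
  | branch f q₁ q₂ ih₁ ih₂ =>
    refine (reaches_goto rfl _ _ _).trans ?_
    cases h : f v
    · simpa [h] using ih₂ v S
    · simpa [h] using ih₁ v S
  | goto l => exact reaches_goto rfl _ _ _
  | halt => exact reaches_goto rfl _ _ _

lemma reaches_of_tm2 {c c' : Cfg'} (h : StateTransition.Reaches (TM2.step tr) c c') (o : BStr)
    (ρ : QTape) (i : ℤ) :
    PReaches l₀ ⟨labOf c.l c.var, encStk c.stk o, ρ, i⟩ ⟨labOf c'.l c'.var, encStk c'.stk o, ρ, i⟩ := by
  induction h with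
  | refl => exact .refl
  | @tail b c _ hs ih =>
    refine ih.trans ?_
    obtain ⟨l, v, S⟩ := b
    rcases l with _ | l
    · cases show none = some c from hs
    · obtain rfl := Option.some.inj (show some _ = some c from hs)
      exact reaches_stepAux _ _ _ _ _ _

/-- Stacks of which only the first one is nonempty. -/
def mainStk (w : List Γ') : K' → List Γ' := K'.elim w [] [] []

lemma update_mainStk (w w' : List Γ') : Function.update (mainStk w) .main w' = mainStk w' := by
  funext k; cases k <;> rfl

lemma mainStk_main (w : List Γ') : mainStk w .main = w := rfl

/-- Copying reverses the string. As the last symbol of the input is on top of its stack, the input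
arrives on `main` in its original order. -/
lemma reaches_feed (x : BStr) (w : List Γ') (ρ : QTape) (i : ℤ) :
    PReaches l₀ ⟨.feed, encStk (mainStk w) x, ρ, i⟩
      ⟨.run (tr l₀) none, encStk (mainStk (x.reverse.map bitSym ++ w)) [], ρ, i⟩ := by
  induction x generalizing w with
  | nil =>
    have h1 := SStep.pop (P := prog l₀) (l := .feed) (S := encStk (mainStk w) []) (q := ρ)
      (h := i) rfl
    rw [update_encStk_none] at h1
    exact .single h1
  | cons b x ih =>
    have h1 := SStep.pop (P := prog l₀) (l := .feed) (S := encStk (mainStk w) (b :: x)) (q := ρ)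
      (h := i) rfl
    rw [update_encStk_none] at h1
    have h2 := reaches_push2 (l₀ := l₀) .main (bitSym b) .feed (mainStk w) x ρ i
    rw [update_mainStk, mainStk_main] at h2
    have h3 := ih (bitSym b :: w)
    simpa using ReflTransGen.head h1 (h2.trans h3)

/-- Tokens are read in unary by the counter in the label. The cap at 20 in `prog` only keeps the
labels finite in number, and `hj` ensures that it has no effect. -/
lemma reaches_tok (j i : ℕ) (hj : i + j ≤ 20) (y : BStr) (w : List Γ') (o : BStr) (ρ : QTape)
    (h : ℤ) :
    PReaches l₀ ⟨.tok i, encStk (mainStk ((tokStr j ++ y).map bitSym ++ w)) o, ρ, h⟩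
      ⟨.exec (i + j), encStk (mainStk (y.map bitSym ++ w)) o, ρ, h⟩ := by
  have key (b : Bool) (i : ℕ) (w : List Γ') := reaches_pop (l₀ := l₀) (l := .tok i) rfl
    (f' := fun _ o => if o = some true then .tok (min (i + 1) 20) else .exec i) (fun b => rfl)
    (mainStk (bitSym b :: w)) rfl o ρ h
  simp only [update_mainStk, symBits_bitSym] at key
  induction j generalizing i with
  | zero => simpa [tokStr] using key false i (y.map bitSym ++ w)
  | succ j ih =>
    have h1 := key true i ((tokStr j ++ y).map bitSym ++ w)
    simp only [if_true, min_eq_left (show i + 1 ≤ 20 by omega)] at h1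
    have h2 := h1.trans (ih (i + 1) (by omega))
    rwa [show i + 1 + j = i + (j + 1) by omega] at h2

/-- Six gates and three moves use up the numbers below 18; the tokens 18 and 19 output a bit and 20
halts. -/
lemma opTok_lt (a : Gate × _root_.Dir) : opTok a < 18 := by
  rcases a with ⟨g, d⟩
  cases g <;> cases d <;> simp [opTok, Gate.toNat, Dir.toNat]

lemma prog_exec_opTok (a : Gate × _root_.Dir) : prog l₀ (.exec (opTok a)) = .gate a.1 a.2 (.tok 0) := by
  rcases a with ⟨g, d⟩
  cases g <;> cases d <;> simp [prog, opTok, Gate.toNat, Dir.toNat, Gate.ofNat, Dir.ofNat]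

lemma reaches_circuit (C : Circuit) (y : BStr) (w : List Γ') (o : BStr) (ρ : QTape) (h : ℤ) :
    PReaches l₀ ⟨.tok 0, encStk (mainStk ((C.flatMap (fun a => tokStr (opTok a)) ++ y).map bitSym
        ++ w)) o, ρ, h⟩
      ⟨.tok 0, encStk (mainStk (y.map bitSym ++ w)) o, (C.run (ρ, h)).1, (C.run (ρ, h)).2⟩ := by
  induction C generalizing ρ h with
  | nil => exact .refl
  | cons a C ih =>
    have h1 := reaches_tok (l₀ := l₀) (opTok a) 0 (by have := opTok_lt a; omega)
      (C.flatMap (fun a => tokStr (opTok a)) ++ y) w o ρ h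
    rw [zero_add] at h1
    have h2 := SStep.gate (S := encStk (mainStk ((C.flatMap (fun a => tokStr (opTok a)) ++ y).map
      bitSym ++ w)) o) (q := ρ) (h := h) (prog_exec_opTok (l₀ := l₀) a)
    rw [List.flatMap_cons, List.append_assoc]
    exact h1.trans (.head h2 (ih _ _))

lemma reaches_out (b : Bool) (y : BStr) (w : List Γ') (o : BStr) (ρ : QTape) (h : ℤ) :
    PReaches l₀ ⟨.tok 0, encStk (mainStk ((tokStr (18 + b.toNat) ++ y).map bitSym ++ w)) o, ρ, h⟩
      ⟨.tok 0, encStk (mainStk (y.map bitSym ++ w)) (b :: o), ρ, h⟩ := by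
  have h1 := reaches_tok (l₀ := l₀) (18 + b.toNat) 0 (by cases b <;> simp) y w o ρ h
  rw [zero_add] at h1
  have h2 := SStep.push (P := prog l₀) (l := .exec (18 + b.toNat))
    (S := encStk (mainStk (y.map bitSym ++ w)) o) (q := ρ) (h := h) (k := none) (b := b)
    (l' := .tok 0) (by cases b <;> simp [prog])
  rw [update_encStk_none] at h2
  exact h1.trans (.single h2)

lemma reaches_outs (s : BStr) (y : BStr) (w : List Γ') (o : BStr) (ρ : QTape) (h : ℤ) :
    PReaches l₀ ⟨.tok 0, encStk (mainStk ((s.flatMap (fun b => tokStr (18 + b.toNat)) ++ y).map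
        bitSym ++ w)) o, ρ, h⟩
      ⟨.tok 0, encStk (mainStk (y.map bitSym ++ w)) (s.reverse ++ o), ρ, h⟩ := by
  induction s generalizing o with
  | nil => exact .refl
  | cons b s ih =>
    rw [List.flatMap_cons, List.append_assoc]
    have := (reaches_out (l₀ := l₀) b (s.flatMap (fun b => tokStr (18 + b.toNat)) ++ y) w o ρ
      h).trans (ih (b :: o))
    simpa using this

end StackSim

open StackSim in
/-- Partial recursive functions whose values are circuits are turned into machines that run the
circuits. -/
theorem exists_dcqTM_of_partrec {f : ℕ →. ℕ} (hf : Partrec f) :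
    ∃ T : DcqTM, ∀ (x : BStr) (C : Circuit) (n : ℕ) (τ : QState n),
      strCode (progStr C (natStr n)) ∈ f (strCode x) →
      (C.run (QTape.init QState.empty, 0)).1.reduced n = τ.mat →
      T.Outputs x QState.empty [] τ := by
  obtain ⟨c, hc⟩ := Turing.ToPartrec.Code.exists_code (Nat.Partrec'.part_iff₁.2 hf)
  let l₀ := Turing.PartrecToTM2.trNormal c .halt
  have hsup := Turing.PartrecToTM2.tr_supports c .halt
  obtain ⟨F, hF, h0, hcl⟩ := finite_closed l₀ _ hsup.1 hsup.2
  obtain ⟨T, hT⟩ := exists_dcqTM_of_program (prog l₀) startLab F hF h0 hcl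
  refine ⟨T, fun x C n τ hx hτ => ?_⟩
  have h1 := Turing.PartrecToTM2.tr_eval c [strCode x]
  have h2 := hc (strCode x ::ᵥ List.Vector.nil)
  have h3 : Turing.PartrecToTM2.halt [strCode (progStr C (natStr n))] ∈
      StateTransition.eval (Turing.TM2.step Turing.PartrecToTM2.tr)
        (Turing.PartrecToTM2.init c [strCode x]) := by
    rw [h1]
    refine Part.mem_map _ ?_
    have h4 : c.eval [strCode x] = pure <$> f (strCode x) := h2
    rw [h4]
    exact Part.mem_map (fun a => [a]) hx
  have h4 := (StateTransition.mem_eval.1 h3).1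
  have i1 := reaches_push2 (l₀ := l₀) .main .cons (.push2 .main .bit1 .feed) (mainStk []) x.reverse
    (QTape.init QState.empty) 0
  have i2 := reaches_push2 (l₀ := l₀) .main .bit1 .feed (mainStk [.cons]) x.reverse
    (QTape.init QState.empty) 0
  rw [update_mainStk, mainStk_main] at i1 i2
  have i3 := reaches_feed (l₀ := l₀) x.reverse [.bit1, .cons] (QTape.init QState.empty) 0
  have i4 := reaches_of_tm2 (l₀ := l₀) h4 [] (QTape.init QState.empty) 0
  -- The leading digit `1` of the code and the end mark of the list are the two symbols that
  -- `startLab` has pushed beforehand.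
  have e1 : x.reverse.reverse.map bitSym ++ [.bit1, .cons] =
      Turing.PartrecToTM2.trList [strCode x] := by
    simp [Turing.PartrecToTM2.trList, trNat_strCode]
  rw [e1] at i3
  have e2 : Turing.PartrecToTM2.trList [strCode (progStr C (natStr n))] =
      (progStr C (natStr n)).map bitSym ++ [.bit1, .cons] := by
    simp [Turing.PartrecToTM2.trList, trNat_strCode]
  have i5 : PReaches l₀ ⟨startLab, encStk (mainStk []) x.reverse, QTape.init QState.empty, 0⟩
      ⟨.tok 0, encStk (mainStk ((progStr C (natStr n)).map bitSym ++ [.bit1, .cons])) [],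
        QTape.init QState.empty, 0⟩ := by
    rw [← e2]
    exact ((i1.trans i2).trans i3).trans i4
  unfold progStr at i5
  -- The first output bit is a dummy: it occupies the cell that is erased at the end.
  have i6 := i5.trans ((reaches_circuit _ _ _ _ _ _).trans ((reaches_out false _ _ _ _ _).trans
    (reaches_outs _ _ _ _ _ _)))
  have i7 := reaches_tok (l₀ := l₀) 20 0 le_rfl [] [.bit1, .cons]
    ((natStr n).reverse ++ [false]) (C.run (QTape.init QState.empty, 0)).1
    (C.run (QTape.init QState.empty, 0)).2
  rw [List.append_nil] at i7
  have e3 : encStk (mainStk []) x.reverse = Function.update (fun _ => []) none x.reverse := by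
    funext k
    rcases k with _ | _ | _ | _ | _ <;> rfl
  rw [e3] at i6
  refine hT x _ false n τ (i6.trans i7) ?_ ?_ hτ
  · simp [prog]
  · simp [encStk]

/-! ### Basis states given by lists of cells -/

/-- The basis assignment in which a cell holds the parity of its number of occurrences. -/
def bas (l : List ℤ) : QBasis := fun i => decide (l.count i % 2 = 1)

lemma bas_nil (i : ℤ) : bas [] i = false := by simp [bas]

lemma bas_cons (j : ℤ) (l : List ℤ) (i : ℤ) : bas (j :: l) i = xor (decide (j = i)) (bas l i) := by
  simp only [bas, List.count_cons]
  by_cases h : j = i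
  · subst h
    rcases Nat.mod_two_eq_zero_or_one (l.count j) with h | h <;> simp [h, Nat.add_mod]
  · simp [h]

/-- The branches of a gate applied to a basis state, with their phases in units of `π / 4`. -/
def half (g : Gate) (j : ℤ) (l : List ℤ) : List (ℕ × List ℤ) :=
  match g with
  | .id => [(0, l)]
  | .had => [(4 * (bas l j).toNat, l), (0, j :: l)]
  | .phase => [(2 * (bas l j).toNat, l)]
  | .piEighth => [((bas l j).toNat, l)]
  | .swap => [(0, if bas l j = bas l (j + 1) then l else j :: (j + 1) :: l)]
  | .cnot => [(0, if bas l j = true then (j + 1) :: l else l)]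

/-- Twice the square of the absolute value of the amplitude of the branches. -/
def Gate.scale : Gate → ℕ
  | .had => 1
  | _ => 2

/-- The amplitude of the branches of a gate, up to the phase. -/
def Gate.amp : Gate → ℝ
  | .had => 1 / √2
  | _ => 1

/-- Density matrices see amplitudes only in pairs, so the factor `1 / √2` of the Hadamard gate
enters as the rational number `1 / 2`. All irrationality is confined to powers of `zeta8`. -/
lemma Gate.amp_sq (g : Gate) : g.amp ^ 2 = (g.scale : ℝ) / 2 := by
  cases g <;> simp [Gate.amp, Gate.scale]

/-- The branches of a gate on the two cells on which it acts. -/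
def branch (g : Gate) (b : Bool × Bool) : List (ℕ × Bool × Bool) :=
  match g with
  | .id => [(0, b)]
  | .had => [(4 * b.1.toNat, b), (0, !b.1, b.2)]
  | .phase => [(2 * b.1.toNat, b)]
  | .piEighth => [(b.1.toNat, b)]
  | .swap => [(0, b.2, b.1)]
  | .cnot => [(0, b.1, xor b.1 b.2)]

lemma QBasis.set_apply (x : QBasis) (j : ℤ) (a : Bool × Bool) (i : ℤ) :
    x.set j a i = if i = j + 1 then a.2 else if i = j then a.1 else x i := by
  simp [QBasis.set, Function.update_apply]

/-- Prepending a cell to the list flips its bit, because `bas` takes parities. A swap flips both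
cells exactly if they differ. -/
lemma half_eq_branch (g : Gate) (j : ℤ) (l : List ℤ) :
    (half g j l).map (fun p => (p.1, bas p.2)) =
      (branch g (bas l j, bas l (j + 1))).map (fun p => (p.1, (bas l).set j p.2)) := by
  have h1 : j ≠ j + 1 := by omega
  have h0 : (bas l).set j (bas l j, bas l (j + 1)) = bas l := QBasis.set_self _ _
  cases g <;> simp only [half, branch, List.map_cons, List.map_nil, h0]
  · have : bas (j :: l) = (bas l).set j (!bas l j, bas l (j + 1)) := by
      funext i
      rw [bas_cons, QBasis.set_apply]
      by_cases h2 : i = j + 1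
      · subst h2; simp
      · by_cases h3 : i = j
        · subst h3; simp
        · simp [h2, h3, Ne.symm h3]
    rw [this]
  · have : bas (if bas l j = bas l (j + 1) then l else j :: (j + 1) :: l) =
        (bas l).set j (bas l (j + 1), bas l j) := by
      split_ifs with h
      · rw [h] at h0 ⊢; exact h0.symm
      · funext i
        rw [bas_cons, bas_cons, QBasis.set_apply]
        have h' : bas l j = !bas l (j + 1) := by
          revert h; cases bas l j <;> cases bas l (j + 1) <;> simp
        by_cases h2 : i = j + 1
        · subst h2; simp [h']
        · by_cases h3 : i = j
          · subst h3; simp [h']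
          · simp [h2, h3, Ne.symm h3, Ne.symm h2]
    rw [this]
  · have : bas (if bas l j = true then (j + 1) :: l else l) =
        (bas l).set j (bas l j, xor (bas l j) (bas l (j + 1))) := by
      split_ifs with h
      · funext i
        rw [bas_cons, QBasis.set_apply]
        by_cases h2 : i = j + 1
        · subst h2; simp [h]
        · by_cases h3 : i = j
          · subst h3; simp
          · simp [h2, h3, Ne.symm h2]
      · have h' : bas l j = false := by simpa using h
        conv_lhs => rw [← h0]
        rw [h']; simp
    rw [this]

/-- The primitive eighth root of unity. -/
def zeta8 : ℂ := Complex.exp (Real.pi / 4 * Complex.I)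

lemma zeta8_eq : zeta8 = (1 / √2 : ℝ) + (1 / √2 : ℝ) * Complex.I := by
  have h2 : (√2 : ℝ) / 2 = 1 / √2 := by
    rw [div_eq_div_iff (by norm_num) (by positivity)]; norm_num
  rw [zeta8, Complex.exp_mul_I]
  have h : (Real.pi / 4 : ℂ) = ((Real.pi / 4 : ℝ) : ℂ) := by push_cast; ring
  rw [h, ← Complex.ofReal_cos, ← Complex.ofReal_sin, Real.cos_pi_div_four, Real.sin_pi_div_four, h2]

lemma inv_sqrt_two_sq : ((1 / √2 : ℝ) : ℂ) * ((1 / √2 : ℝ) : ℂ) = 1 / 2 := by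
  rw [← Complex.ofReal_mul]
  have : (1 / √2 * (1 / √2) : ℝ) = 1 / 2 := by
    rw [div_mul_div_comm, Real.mul_self_sqrt (by norm_num)]; norm_num
  rw [this]; norm_num

lemma zeta8_sq : zeta8 ^ 2 = Complex.I := by
  have := inv_sqrt_two_sq
  rw [zeta8_eq]
  linear_combination (2 * Complex.I + Complex.I ^ 2 + 1) * this + (1 / 2 : ℂ) * Complex.I_sq

lemma zeta8_pow_four : zeta8 ^ 4 = -1 := by
  rw [show zeta8 ^ 4 = (zeta8 ^ 2) ^ 2 by ring, zeta8_sq, Complex.I_sq]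

lemma zeta8_pow_eight : zeta8 ^ 8 = 1 := by
  rw [show zeta8 ^ 8 = (zeta8 ^ 4) ^ 2 by ring, zeta8_pow_four]; norm_num

lemma zeta8_ne_zero : zeta8 ≠ 0 := Complex.exp_ne_zero _

lemma norm_zeta8 : ‖zeta8‖ = 1 := by
  have : (Real.pi / 4 * Complex.I : ℂ) = ((Real.pi / 4 : ℝ) : ℂ) * Complex.I := by push_cast; ring
  rw [zeta8, this, Complex.norm_exp_ofReal_mul_I]

/-- Conjugation thus multiplies exponents by 7, and phases can be kept as natural numbers
throughout. -/
lemma star_zeta8 : star zeta8 = zeta8 ^ 7 := by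
  have h1 : star zeta8 * zeta8 = 1 := by
    rw [Complex.star_def, Complex.conj_mul', norm_zeta8]; simp
  have h2 : zeta8 ^ 7 * zeta8 = 1 := by rw [← pow_succ, zeta8_pow_eight]
  exact mul_right_cancel₀ zeta8_ne_zero (h1.trans h2.symm)

/-- In each column of a gate, all nonzero entries have the same absolute value and differ from it by
a power of `zeta8`. -/
lemma branch_mat (g : Gate) (a b : Bool × Bool) :
    ((branch g b).map fun p => if p.2 = a then (g.amp : ℂ) * zeta8 ^ p.1 else 0).sum = g.mat a b := by
  obtain ⟨a1, a2⟩ := a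
  obtain ⟨b1, b2⟩ := b
  have h4 := zeta8_pow_four
  have h2 := zeta8_sq
  cases g
  · cases a1 <;> cases a2 <;> cases b1 <;> cases b2 <;> simp [branch, Gate.mat, Gate.amp]
  · cases a1 <;> cases a2 <;> cases b1 <;> cases b2 <;>
      simp [branch, Gate.mat, Gate.amp, qubitMat, Matrix.kroneckerMap_apply, h4]
  · cases a1 <;> cases a2 <;> cases b1 <;> cases b2 <;>
      simp [branch, Gate.mat, Gate.amp, qubitMat, Matrix.kroneckerMap_apply, h2]
  · cases a1 <;> cases a2 <;> cases b1 <;> cases b2 <;>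
      simp [branch, Gate.mat, Gate.amp, qubitMat, Matrix.kroneckerMap_apply, zeta8]
  · cases a1 <;> cases a2 <;> cases b1 <;> cases b2 <;> simp [branch, Gate.mat, Gate.amp]
  · cases a1 <;> cases a2 <;> cases b1 <;> cases b2 <;> simp [branch, Gate.mat, Gate.amp]

/-- This is the orthonormality of the columns of a gate, in terms of branches; it is what makes the
trace invariant. -/
lemma branch_unitary (g : Gate) (a b : Bool × Bool) :
    ((branch g a).map fun p => ((branch g b).map fun q =>
      if p.2 = q.2 then (g.amp : ℂ) ^ 2 * zeta8 ^ p.1 * zeta8 ^ (7 * q.1) else 0).sum).sum =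
      if a = b then 1 else 0 := by
  have h4 := zeta8_pow_four
  have h8 := zeta8_pow_eight
  have h28 : zeta8 ^ 28 = -1 := by
    rw [show zeta8 ^ 28 = (zeta8 ^ 8) ^ 3 * zeta8 ^ 4 by ring, h8, h4]; norm_num
  have h16 : zeta8 ^ 2 * zeta8 ^ 14 = 1 := by
    rw [show zeta8 ^ 2 * zeta8 ^ 14 = (zeta8 ^ 8) ^ 2 by ring, h8]; norm_num
  have h7 : zeta8 * zeta8 ^ 7 = 1 := by rw [← pow_succ', h8]
  have hs : ((√2 : ℝ) : ℂ) ^ 2 = 2 := by rw [← Complex.ofReal_pow]; norm_num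
  obtain ⟨a1, a2⟩ := a
  obtain ⟨b1, b2⟩ := b
  cases g <;> cases a1 <;> cases a2 <;> cases b1 <;> cases b2 <;>
    simp [branch, Gate.amp, h4, h28, h16, h7, hs] <;> norm_num

/-! ### Tapes as sums of matrix units -/

/-- A term `(c, u, v)` stands for `c` times the matrix unit of the basis states of `u` and `v`. -/
abbrev CTerm := ℂ × List ℤ × List ℤ

lemma sum_map_flatMap {α β M : Type*} [AddCommMonoid M] (l : List α) (f : α → List β) (h : β → M) :
    ((l.flatMap f).map h).sum = (l.map fun a => ((f a).map h).sum).sum := by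
  induction l with
  | nil => rfl
  | cons a l ih => simp [ih]

lemma list_sum_map_mul_left {α : Type*} (l : List α) (f : α → ℂ) (c : ℂ) :
    (l.map fun a => c * f a).sum = c * (l.map f).sum := by
  induction l with
  | nil => simp
  | cons a l ih => simp [ih, mul_add]

lemma list_sum_map_mul_right {α : Type*} (l : List α) (f : α → ℂ) (c : ℂ) :
    (l.map fun a => f a * c).sum = (l.map f).sum * c := by
  induction l with
  | nil => simp
  | cons a l ih => simp [ih, add_mul]

lemma list_sum_map_comm {α β M : Type*} [AddCommMonoid M] (l : List α) (s : Finset β)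
    (f : α → β → M) : ∑ b ∈ s, (l.map fun a => f a b).sum = (l.map fun a => ∑ b ∈ s, f a b).sum := by
  induction l with
  | nil => simp
  | cons a l ih => simp [ih, Finset.sum_add_distrib]

open Classical in
/-- The tape that is the sum of the given terms. -/
def sem (l : List CTerm) : QTape := fun x y =>
  (l.map fun t => if bas t.2.1 = x ∧ bas t.2.2 = y then t.1 else 0).sum

/-- The effect of a gate on a term. -/
def gateC (g : Gate) (j : ℤ) (t : CTerm) : List CTerm :=
  (half g j t.2.1).flatMap fun p => (half g j t.2.2).map fun q =>
    (t.1 * ((g.amp : ℂ) ^ 2 * zeta8 ^ p.1 * zeta8 ^ (7 * q.1)), p.2, q.2)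

/-- A sum over the branches of a gate. -/
lemma sum_half {M : Type*} [AddCommMonoid M] (g : Gate) (j : ℤ) (l : List ℤ) (f : ℕ → QBasis → M) :
    ((half g j l).map fun p => f p.1 (bas p.2)).sum =
      ((branch g (bas l j, bas l (j + 1))).map fun p => f p.1 ((bas l).set j p.2)).sum := by
  have := congrArg (fun L => (L.map fun p : ℕ × QBasis => f p.1 p.2).sum) (half_eq_branch g j l)
  simpa [Function.comp_def] using this

lemma QBasis.set_eq_iff (x u : QBasis) (j : ℤ) (a : Bool × Bool) :
    u.set j a = x ↔ x.set j (u j, u (j + 1)) = u ∧ a = (x j, x (j + 1)) := by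
  have hj : j ≠ j + 1 := by omega
  constructor
  · rintro rfl
    refine ⟨?_, ?_⟩
    · funext i
      simp only [QBasis.set_apply]
      split_ifs with h1 h2 <;> simp_all
    · simp [QBasis.set_apply]
  · rintro ⟨h, rfl⟩
    funext i
    have := congrFun h i
    simp only [QBasis.set_apply] at this ⊢
    split_ifs at this ⊢ with h1 h2 <;> simp_all

open Classical in
/-- The amplitude with which a gate maps one basis state to another. -/
lemma sum_half_amp (g : Gate) (j : ℤ) (l : List ℤ) (x : QBasis) :
    ((half g j l).map fun p => if bas p.2 = x then (g.amp : ℂ) * zeta8 ^ p.1 else 0).sum =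
      ∑ a : Bool × Bool, g.mat (x j, x (j + 1)) a * if bas l = x.set j a then 1 else 0 := by
  rw [sum_half g j l (fun k z => if z = x then (g.amp : ℂ) * zeta8 ^ k else 0)]
  rw [Finset.sum_eq_single (bas l j, bas l (j + 1))]
  · have e1 : ∀ a, (bas l).set j a = x ↔ x.set j (bas l j, bas l (j + 1)) = bas l ∧
        a = (x j, x (j + 1)) := QBasis.set_eq_iff x (bas l) j
    simp only [e1]
    have e0 : bas l = x.set j (bas l j, bas l (j + 1)) ↔
        x.set j (bas l j, bas l (j + 1)) = bas l := eq_comm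
    by_cases h : x.set j (bas l j, bas l (j + 1)) = bas l
    · rw [if_pos h.symm, mul_one, ← branch_mat]
      simp [h]
    · rw [if_neg (fun e => h e.symm)]
      simp [h]
  · intro a _ ha
    rw [if_neg, mul_zero]
    intro e
    have := (QBasis.set_eq_iff (bas l) x j a).1 e.symm
    exact ha this.2
  · simp

lemma star_zeta8_pow (k : ℕ) : star (zeta8 ^ k) = zeta8 ^ (7 * k) := by
  rw [star_pow, star_zeta8, ← pow_mul]

-- The gate acts on the left index and its adjoint on the right one. A matrix unit therefore splits
-- into all pairs of branches, the right branch with the conjugate phase `zeta8 ^ (7 * q.1)`.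
open Classical in
lemma sem_applyGate (l : List CTerm) (g : Gate) (j : ℤ) :
    (sem l).applyGate g j = sem (l.flatMap (gateC g j)) := by
  funext x y
  simp only [sem, QTape.applyGate, sum_map_flatMap]
  have h1 : ∀ a b : Bool × Bool, g.mat (x j, x (j + 1)) a *
      (l.map fun t => if bas t.2.1 = x.set j a ∧ bas t.2.2 = y.set j b then t.1 else 0).sum *
      star (g.mat (y j, y (j + 1)) b) =
      (l.map fun t => t.1 * ((g.mat (x j, x (j + 1)) a * if bas t.2.1 = x.set j a then 1 else 0) *
        star (g.mat (y j, y (j + 1)) b * if bas t.2.2 = y.set j b then 1 else 0))).sum := by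
    intro a b
    rw [← list_sum_map_mul_left, ← list_sum_map_mul_right]
    congr 1
    refine List.map_congr_left fun t _ => ?_
    by_cases h : bas t.2.1 = x.set j a <;> by_cases h' : bas t.2.2 = y.set j b <;> simp [h, h']
    ring
  simp only [h1, list_sum_map_comm]
  congr 1
  refine List.map_congr_left fun t _ => ?_
  have h2 := sum_half_amp g j t.2.1 x
  have h3 := congrArg star (sum_half_amp g j t.2.2 y)
  rw [star_sum] at h3
  simp only [← Finset.mul_sum]
  rw [← Finset.sum_mul, ← h2, ← h3, gateC, sum_map_flatMap, ← list_sum_map_mul_right,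
    ← list_sum_map_mul_left]
  congr 1
  refine List.map_congr_left fun p _ => ?_
  have h4 : star (((half g j t.2.2).map fun q =>
      if bas q.2 = y then (g.amp : ℂ) * zeta8 ^ q.1 else 0).sum) =
      ((half g j t.2.2).map fun q =>
      if bas q.2 = y then (g.amp : ℂ) * zeta8 ^ (7 * q.1) else 0).sum := by
    have : ∀ L : List (ℕ × List ℤ), star ((L.map fun q =>
      if bas q.2 = y then (g.amp : ℂ) * zeta8 ^ q.1 else 0).sum) = (L.map fun q =>
      if bas q.2 = y then (g.amp : ℂ) * zeta8 ^ (7 * q.1) else 0).sum := by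
      intro L
      induction L with
      | nil => simp
      | cons q L ih =>
        rw [List.map_cons, List.sum_cons, star_add, ih, List.map_cons, List.sum_cons]
        congr 1
        split_ifs
        · rw [star_mul', star_zeta8_pow]; simp
        · simp
    exact this _
  rw [h4, ← list_sum_map_mul_left, ← list_sum_map_mul_left, List.map_map]
  congr 1
  refine List.map_congr_left fun q _ => ?_
  simp only [Function.comp]
  by_cases h : bas p.2 = x <;> by_cases h' : bas q.2 = y <;>
    simp only [h, h', and_self, and_false, and_true, if_true, if_false] <;> ring

/-- The effect of a circuit on a list of terms, with the quantum head on the cell `j`. -/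
def Circuit.terms : Circuit → ℤ → List CTerm → List CTerm
  | [], _, l => l
  | a :: C, j, l => Circuit.terms C (j + a.2.toInt) (l.flatMap (gateC a.1 j))

lemma Circuit.run_sem (C : Circuit) (j : ℤ) (l : List CTerm) :
    (C.run (sem l, j)).1 = sem (C.terms j l) := by
  induction C generalizing j l with
  | nil => rfl
  | cons a C ih => rw [Circuit.run_cons, sem_applyGate]; exact ih _ _

lemma Circuit.terms_flatMap (C : Circuit) (j : ℤ) (l : List CTerm) :
    C.terms j l = l.flatMap fun t => C.terms j [t] := by
  induction C generalizing j l with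
  | nil => simp [Circuit.terms]
  | cons a C ih =>
    simp only [Circuit.terms, List.flatMap_cons, List.flatMap_nil, List.append_nil]
    rw [ih, List.flatMap_assoc]
    congr 1
    funext t
    rw [← ih]

/-! ### Reduced states of sums of terms -/

/-- The bits of the cells `1, …, m`. -/
def restr (m : ℕ) (x : QBasis) : Fin m → Bool := fun i => x ((i : ℕ) + 1)

/-- Agreement of two basis assignments off the cells `1, …, m`. -/
def OffEq (m : ℕ) (x y : QBasis) : Prop := ∀ i : ℤ, ¬(1 ≤ i ∧ i ≤ m) → x i = y i

lemma restr_glue {m : ℕ} (a : Fin m → Bool) (z : {i : ℤ // ¬(1 ≤ i ∧ i ≤ m)} → Bool) :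
    restr m (QBasis.glue a z) = a := by
  funext i
  have h : (1 : ℤ) ≤ (i : ℕ) + 1 ∧ ((i : ℕ) : ℤ) + 1 ≤ m := by omega
  simp [restr, QBasis.glue, h]

lemma glue_eq_iff {m : ℕ} (a : Fin m → Bool) (z : {i : ℤ // ¬(1 ≤ i ∧ i ≤ m)} → Bool)
    (x : QBasis) : QBasis.glue a z = x ↔ restr m x = a ∧ z = fun i => x i.1 := by
  constructor
  · rintro rfl
    refine ⟨restr_glue a z, ?_⟩
    funext i
    simp [QBasis.glue, i.2]
  · rintro ⟨rfl, rfl⟩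
    funext i
    simp only [QBasis.glue, restr]
    split_ifs with h
    · congr 1
      simp only [Int.pred_toNat]
      omega
    · rfl

lemma eq_of_restr_of_offEq {m : ℕ} {x y : QBasis} (h : restr m x = restr m y) (h' : OffEq m x y) :
    x = y := by
  funext i
  by_cases hi : 1 ≤ i ∧ i ≤ m
  · have := congrFun h ⟨(i - 1).toNat, by omega⟩
    simp only [restr] at this
    have e : (((i - 1).toNat : ℕ) : ℤ) + 1 = i := by omega
    rwa [e] at this
  · exact h' i hi

open Classical in
/-- The reduced matrix of a sum of terms. -/
def red (m : ℕ) (l : List CTerm) : Matrix (Fin m → Bool) (Fin m → Bool) ℂ :=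
  Matrix.of fun a b => (l.map fun t => if OffEq m (bas t.2.1) (bas t.2.2) ∧
    restr m (bas t.2.1) = a ∧ restr m (bas t.2.2) = b then t.1 else 0).sum

lemma finsum_list_sum {α β : Type*} (l : List α) (f : α → β → ℂ)
    (hf : ∀ t ∈ l, (Function.support (f t)).Finite) :
    (Function.support fun z => (l.map fun t => f t z).sum).Finite ∧
      ∑ᶠ z, (l.map fun t => f t z).sum = (l.map fun t => ∑ᶠ z, f t z).sum := by
  induction l with
  | nil => simp
  | cons t l ih =>
    obtain ⟨h1, h2⟩ := ih fun t ht => hf t (by simp [ht])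
    have h3 := hf t (by simp)
    simp only [List.map_cons, List.sum_cons]
    refine ⟨(h3.union h1).subset (Function.support_add _ _), ?_⟩
    rw [finsum_add_distrib h3 h1, h2]

-- For given `a` and `b`, a term is nonzero for at most one assignment `z` of the traced-out cells,
-- namely the restriction of its left index. This also gives the finite supports that `finsum`
-- requires.
open Classical in
lemma reduced_sem (l : List CTerm) (m : ℕ) : (sem l).reduced m = red m l := by
  ext a b
  simp only [QTape.reduced, red, Matrix.of_apply, sem]
  have key : ∀ t : CTerm, ∀ z : {i : ℤ // ¬(1 ≤ i ∧ i ≤ m)} → Bool,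
      (z ≠ fun i => bas t.2.1 i.1) →
      (if bas t.2.1 = QBasis.glue a z ∧ bas t.2.2 = QBasis.glue b z then t.1 else 0) = 0 := by
    intro t z hz
    rw [if_neg]
    rintro ⟨h, -⟩
    exact hz ((glue_eq_iff _ _ _).1 h.symm).2
  rw [(finsum_list_sum l _ ?_).2]
  · congr 1
    refine List.map_congr_left fun t _ => ?_
    rw [finsum_eq_single _ (fun i => bas t.2.1 i.1) (key t)]
    congr 1
    rw [eq_comm (a := bas t.2.1), glue_eq_iff, eq_comm (a := bas t.2.2), glue_eq_iff, eq_iff_iff]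
    constructor
    · rintro ⟨⟨h1, -⟩, h2, h3⟩
      exact ⟨fun i hi => congrFun h3 ⟨i, hi⟩, h1, h2⟩
    · rintro ⟨h3, h1, h2⟩
      exact ⟨⟨h1, rfl⟩, h2, funext fun i => h3 i.1 i.2⟩
  · intro t _
    refine (Set.finite_singleton (fun i : {i : ℤ // ¬(1 ≤ i ∧ i ≤ m)} => bas t.2.1 i.1)).subset ?_
    intro z hz
    by_contra h
    exact hz (key t z h)

/-! ### States prepared by circuits -/

open Classical in
/-- The trace of a sum of terms. -/
def trC (l : List CTerm) : ℂ := (l.map fun t => if bas t.2.1 = bas t.2.2 then t.1 else 0).sum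

lemma trace_red (m : ℕ) (l : List CTerm) : (red m l).trace = trC l := by
  classical
  simp only [Matrix.trace, Matrix.diag, red, Matrix.of_apply, trC]
  rw [list_sum_map_comm]
  congr 1
  refine List.map_congr_left fun t _ => ?_
  by_cases h : bas t.2.1 = bas t.2.2
  · rw [if_pos h, h, Finset.sum_eq_single (restr m (bas t.2.2))]
    · simp [OffEq]
    · intro a _ ha
      simp [Ne.symm ha]
    · simp
  · rw [if_neg h]
    refine Finset.sum_eq_zero fun a _ => ?_
    rw [if_neg]
    rintro ⟨h1, h2, h3⟩
    exact h (eq_of_restr_of_offEq (h2.trans h3.symm) h1)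

lemma set_eq_set_iff (x y : QBasis) (j : ℤ) (a b : Bool × Bool) :
    x.set j a = y.set j b ↔ x.set j (y j, y (j + 1)) = y ∧ a = b := by
  have hj : j ≠ j + 1 := by omega
  constructor
  · intro h
    have h' := fun i => congrFun h i
    simp only [QBasis.set_apply] at h'
    refine ⟨?_, ?_⟩
    · funext i
      have := h' i
      simp only [QBasis.set_apply]
      split_ifs at this ⊢ with h1 h2 <;> simp_all
    · have h1 := h' j
      have h2 := h' (j + 1)
      simp only [hj, if_false, if_true] at h1 h2
      exact Prod.ext h1 h2
  · rintro ⟨h, rfl⟩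
    funext i
    have := congrFun h i
    simp only [QBasis.set_apply] at this ⊢
    split_ifs at this ⊢ with h1 h2 <;> simp_all

-- Branches of basis states that differ off the cells `j` and `j + 1` never coincide; for the others
-- `branch_unitary` applies.
open Classical in
lemma trC_gateC (g : Gate) (j : ℤ) (t : CTerm) :
    trC (gateC g j t) = if bas t.2.1 = bas t.2.2 then t.1 else 0 := by
  simp only [trC, gateC, sum_map_flatMap, List.map_map, Function.comp_def]
  have h1 := sum_half g j t.2.1 (fun k z => ((half g j t.2.2).map fun q =>
    if z = bas q.2 then t.1 * ((g.amp : ℂ) ^ 2 * zeta8 ^ k * zeta8 ^ (7 * q.1)) else 0).sum)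
  have h2 := fun (k : ℕ) (z : QBasis) => sum_half g j t.2.2 (fun k' z' =>
    if z = z' then t.1 * ((g.amp : ℂ) ^ 2 * zeta8 ^ k * zeta8 ^ (7 * k')) else 0)
  simp only [h2, set_eq_set_iff] at h1 ⊢
  rw [h1]
  have h3 := branch_unitary g (bas t.2.1 j, bas t.2.1 (j + 1)) (bas t.2.2 j, bas t.2.2 (j + 1))
  by_cases h : (bas t.2.1).set j (bas t.2.2 j, bas t.2.2 (j + 1)) = bas t.2.2
  · have e : (bas t.2.1 = bas t.2.2) ↔
        (bas t.2.1 j, bas t.2.1 (j + 1)) = (bas t.2.2 j, bas t.2.2 (j + 1)) := by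
      constructor
      · intro e; rw [e]
      · intro e
        rw [← e] at h
        rwa [QBasis.set_self] at h
    simp only [h, true_and]
    have h4 : (if bas t.2.1 = bas t.2.2 then t.1 else 0) = t.1 *
        (if (bas t.2.1 j, bas t.2.1 (j + 1)) = (bas t.2.2 j, bas t.2.2 (j + 1)) then 1 else 0) := by
      by_cases h5 : bas t.2.1 = bas t.2.2
      · rw [if_pos h5, if_pos (e.1 h5), mul_one]
      · rw [if_neg h5, if_neg (fun h6 => h5 (e.2 h6)), mul_zero]
    rw [h4, ← h3]
    simp only [← list_sum_map_mul_left, mul_ite, mul_zero]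
  · rw [if_neg]
    · simp [h]
    · intro e
      rw [← e, QBasis.set_self] at h
      exact h rfl

lemma trC_terms (C : Circuit) (j : ℤ) (l : List CTerm) : trC (C.terms j l) = trC l := by
  induction C generalizing j l with
  | nil => rfl
  | cons a C ih =>
    rw [Circuit.terms, ih, trC, sum_map_flatMap, trC]
    congr 1
    exact List.map_congr_left fun t _ => trC_gateC _ _ _

/-- A tape in a pure state. -/
def QTape.IsPure (ρ : QTape) : Prop := ∃ ψ : QBasis → ℂ, ∀ x y, ρ x y = ψ x * star (ψ y)

lemma QTape.IsPure.applyGate {ρ : QTape} (h : ρ.IsPure) (g : Gate) (j : ℤ) :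
    (ρ.applyGate g j).IsPure := by
  obtain ⟨ψ, hψ⟩ := h
  refine ⟨fun x => ∑ a : Bool × Bool, g.mat (x j, x (j + 1)) a * ψ (x.set j a), fun x y => ?_⟩
  simp only [QTape.applyGate, hψ]
  rw [star_sum, Finset.sum_mul_sum]
  refine Finset.sum_congr rfl fun a _ => Finset.sum_congr rfl fun b _ => ?_
  rw [star_mul']
  ring

lemma QTape.IsPure.run {ρ : QTape} (h : ρ.IsPure) (C : Circuit) (j : ℤ) :
    (C.run (ρ, j)).1.IsPure := by
  induction C generalizing ρ j with
  | nil => exact h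
  | cons a C ih => exact ih (h.applyGate _ _) _

open Classical in
lemma init_empty : QTape.init QState.empty = sem [(1, [], [])] := by
  funext x y
  have e : (bas [] = x ∧ bas [] = y) ↔ ∀ i : ℤ, x i = false ∧ y i = false := by
    constructor
    · rintro ⟨rfl, rfl⟩ i
      simp [bas_nil]
    · intro h
      exact ⟨funext fun i => by rw [bas_nil, (h i).1], funext fun i => by rw [bas_nil, (h i).2]⟩
  have e2 : (∀ i : ℤ, ¬(1 ≤ i ∧ i ≤ ((0 : ℕ) : ℤ)) → x i = false ∧ y i = false) ↔
      ∀ i : ℤ, x i = false ∧ y i = false :=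
    ⟨fun h i => h i (by push_cast; omega), fun h i _ => h i⟩
  simp only [QTape.init, sem, List.map_cons, List.map_nil, List.sum_cons, List.sum_nil, add_zero]
  rw [if_congr e2 rfl rfl, if_congr e rfl rfl]
  congr 1

open Classical in
lemma isPure_init_empty : (QTape.init QState.empty).IsPure := by
  refine ⟨fun x => if bas [] = x then 1 else 0, fun x y => ?_⟩
  rw [init_empty]
  simp only [sem, List.map_cons, List.map_nil, List.sum_cons, List.sum_nil, add_zero]
  by_cases h : bas [] = x <;> by_cases h' : bas [] = y <;> simp [h, h']

/-- The partial trace of a pure state is a sum, over the assignments of the remaining cells, of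
matrices of the form `v vᴴ`. The list `l` shows that the wave function has finite support, so that
the sum is finite. -/
lemma posSemidef_reduced {ρ : QTape} (h : ρ.IsPure) (l : List CTerm) (hl : ρ = sem l) (m : ℕ) :
    (ρ.reduced m).PosSemidef := by
  classical
  obtain ⟨ψ, hψ⟩ := h
  have hfin : (Function.support ψ).Finite := by
    refine (l.map fun t => bas t.2.1).toFinset.finite_toSet.subset ?_
    intro x hx
    by_contra hn
    -- The diagonal entry is the squared absolute value of the wave function, so it detects the
    -- support.
    have h1 : ρ x x = 0 := by
      rw [hl, sem]
      refine List.sum_eq_zero fun c hc => ?_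
      obtain ⟨t, ht, rfl⟩ := List.mem_map.1 hc
      rw [if_neg]
      rintro ⟨rfl, -⟩
      exact hn (by simp only [List.coe_toFinset, Set.mem_ofPred_eq]; exact List.mem_map_of_mem ht)
    rw [hψ, Complex.star_def, Complex.mul_conj', sq_eq_zero_iff] at h1
    exact hx (by simpa using h1)
  let r : QBasis → ({i : ℤ // ¬(1 ≤ i ∧ i ≤ m)} → Bool) := fun x i => x i.1
  have hs : ∀ a b : Fin m → Bool, Function.support (fun z => ρ (QBasis.glue a z) (QBasis.glue b z)) ⊆
      ((hfin.toFinset.image r : Finset _) : Set _) := by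
    intro a b z hz
    have : ψ (QBasis.glue a z) ≠ 0 := by
      intro h0
      exact hz (by simp only [hψ, h0, zero_mul])
    rw [Finset.coe_image]
    exact ⟨_, by simpa using this, ((glue_eq_iff a z _).1 rfl).2.symm⟩
  have he : ρ.reduced m = ∑ z ∈ hfin.toFinset.image r,
      Matrix.vecMulVec (fun a => ψ (QBasis.glue a z)) (star fun a => ψ (QBasis.glue a z)) := by
    ext a b
    rw [Matrix.sum_apply]
    simp only [QTape.reduced, Matrix.of_apply]
    rw [finsum_eq_sum_of_support_subset _ (hs a b)]
    refine Finset.sum_congr rfl fun z _ => ?_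
    rw [hψ]
    rfl
  rw [he]
  exact Matrix.posSemidef_sum _ fun z _ => Matrix.posSemidef_vecMulVec_self_star _

/-- The reduced state of the tape after a circuit acts on the blank tape. -/
theorem exists_state_of_circuit (C : Circuit) (m : ℕ) :
    ∃ τ : QState m, (C.run (QTape.init QState.empty, 0)).1.reduced m = τ.mat := by
  have h1 : (C.run (QTape.init QState.empty, 0)).1 = sem (C.terms 0 [(1, [], [])]) := by
    rw [init_empty, Circuit.run_sem]
  refine ⟨⟨_, posSemidef_reduced (isPure_init_empty.run C 0) _ h1 m, ?_⟩, rfl⟩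
  rw [h1, reduced_sem, trace_red, trC_terms]
  simp [trC]

/-! ### Frobenius norm and trace norm -/

section Norm

variable {ι : Type*} [Fintype ι]

/-- The Frobenius norm. -/
def fro (M : Matrix ι ι ℂ) : ℝ := √(∑ i, ∑ j, ‖M i j‖ ^ 2)

lemma fro_nonneg (M : Matrix ι ι ℂ) : 0 ≤ fro M := Real.sqrt_nonneg _

lemma fro_sq (M : Matrix ι ι ℂ) : fro M ^ 2 = ∑ i, ∑ j, ‖M i j‖ ^ 2 :=
  Real.sq_sqrt (Finset.sum_nonneg fun _ _ => Finset.sum_nonneg fun _ _ => sq_nonneg _)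

lemma fro_add_le (M N : Matrix ι ι ℂ) : fro (M + N) ≤ fro M + fro N := by
  let _ := @Matrix.frobeniusNormedAddCommGroup ι ι ℂ _ _ _
  have h : ∀ A : Matrix ι ι ℂ, fro A = ‖A‖ := fun A => by
    rw [Matrix.frobenius_norm_def, fro, Real.sqrt_eq_rpow]
    simp
  rw [h, h, h]
  exact norm_add_le _ _

lemma fro_neg (M : Matrix ι ι ℂ) : fro (-M) = fro M := by simp [fro]

lemma fro_sub_comm (M N : Matrix ι ι ℂ) : fro (M - N) = fro (N - M) := by
  rw [← fro_neg, neg_sub]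

lemma fro_le_sum (M : Matrix ι ι ℂ) : fro M ≤ ∑ i, ∑ j, ‖M i j‖ := by
  have h : ∀ s : Finset (ι × ι), ∑ p ∈ s, ‖M p.1 p.2‖ ^ 2 ≤ (∑ p ∈ s, ‖M p.1 p.2‖) ^ 2 := fun s =>
    Finset.sum_sq_le_sq_sum_of_nonneg fun _ _ => norm_nonneg _
  have h' := h (Finset.univ ×ˢ Finset.univ)
  rw [Finset.sum_product, Finset.sum_product] at h'
  exact (Real.sqrt_le_left
    (Finset.sum_nonneg fun _ _ => Finset.sum_nonneg fun _ _ => norm_nonneg _)).2 h'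

variable [DecidableEq ι]

lemma sum_eigenvalues_eq (M : Matrix ι ι ℂ) :
    ∑ i, (Matrix.isHermitian_conjTranspose_mul_self M).eigenvalues i = fro M ^ 2 := by
  have h := (Matrix.isHermitian_conjTranspose_mul_self M).trace_eq_sum_eigenvalues
  have h2 : (Mᴴ * M).trace = ((∑ i, ∑ j, ‖M i j‖ ^ 2 : ℝ) : ℂ) := by
    rw [Finset.sum_comm]
    simp only [Matrix.trace, Matrix.diag, Matrix.mul_apply, Matrix.conjTranspose_apply]
    push_cast
    refine Finset.sum_congr rfl fun i _ => Finset.sum_congr rfl fun j _ => ?_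
    rw [Complex.star_def, Complex.conj_mul']
  rw [h2] at h
  rw [fro_sq]
  refine Complex.ofReal_injective ?_
  rw [h, Complex.ofReal_sum]
  rfl

lemma eigenvalues_nonneg' (M : Matrix ι ι ℂ) (i : ι) :
    0 ≤ (Matrix.isHermitian_conjTranspose_mul_self M).eigenvalues i :=
  (Matrix.posSemidef_conjTranspose_mul_self M).eigenvalues_nonneg i

/-- The two norms are the `ℓ²` and the `ℓ¹` norm of the vector of singular values. -/
lemma fro_le_traceNorm (M : Matrix ι ι ℂ) : fro M ≤ traceNorm M := by
  have h0 : 0 ≤ traceNorm M := Finset.sum_nonneg fun _ _ => Real.sqrt_nonneg _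
  refine le_of_sq_le_sq ?_ h0
  rw [← sum_eigenvalues_eq]
  have := Finset.sum_sq_le_sq_sum_of_nonneg (s := Finset.univ) (f := fun i =>
    √((Matrix.isHermitian_conjTranspose_mul_self M).eigenvalues i)) (fun _ _ => Real.sqrt_nonneg _)
  simp only [Real.sq_sqrt (eigenvalues_nonneg' M _)] at this
  exact this

/-- The Cauchy–Schwarz inequality gives the square root of the dimension as a factor; the dimension
itself is good enough and stays rational. -/
lemma traceNorm_le (M : Matrix ι ι ℂ) : traceNorm M ≤ Fintype.card ι * fro M := by
  rcases isEmpty_or_nonempty ι with h | h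
  · simp [traceNorm]
  have h1 : traceNorm M ^ 2 ≤ Fintype.card ι * fro M ^ 2 := by
    rw [← sum_eigenvalues_eq]
    have := sq_sum_le_card_mul_sum_sq (s := Finset.univ) (f := fun i =>
      √((Matrix.isHermitian_conjTranspose_mul_self M).eigenvalues i))
    simp only [Real.sq_sqrt (eigenvalues_nonneg' M _)] at this
    exact this
  have hc : (1 : ℝ) ≤ Fintype.card ι := by exact_mod_cast Fintype.card_pos
  refine le_of_sq_le_sq (h1.trans ?_) (mul_nonneg (by positivity) (fro_nonneg M))
  rw [mul_pow]
  refine mul_le_mul_of_nonneg_right ?_ (sq_nonneg _)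
  nlinarith

end Norm

/-- The trace distance is replaced by the Frobenius norm because the square of the latter is
quadratic in the entries and their conjugates, hence open to exact arithmetic. The loss of a factor
of the order of `2 ^ n` is made up for by higher precision. -/
lemma fro_le_of_traceDist {n : ℕ} (ρ σ : QState n) : fro (ρ.mat - σ.mat) ≤ 2 * traceDist ρ σ := by
  have := fro_le_traceNorm (ρ.mat - σ.mat)
  rw [traceDist]; linarith

lemma traceDist_le_of_fro {n : ℕ} (ρ σ : QState n) :
    traceDist ρ σ ≤ 2 ^ n * fro (ρ.mat - σ.mat) / 2 := by
  have := traceNorm_le (ρ.mat - σ.mat)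
  rw [traceDist]
  simp at this
  linarith

/-! ### The initial tape as a sum of terms -/

/-- The cells in the state `1` of the `r`-th basis state of the cells `1, …, m`. -/
def ones (m r : ℕ) : List ℤ :=
  List.map (fun i : ℕ => (i : ℤ) + 1) ((List.range m).filter fun i => r.testBit (m - 1 - i))

lemma bas_of_nodup {l : List ℤ} (h : l.Nodup) (i : ℤ) : bas l i = decide (i ∈ l) := by
  by_cases hi : i ∈ l
  · simp [bas, List.count_eq_one_of_mem h hi, hi]
  · simp [bas, List.count_eq_zero_of_not_mem hi, hi]

lemma nodup_ones (m r : ℕ) : (ones m r).Nodup :=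
  (List.nodup_range.filter _).map fun a b h => by simpa using h

lemma restr_bas_ones (m : ℕ) (r : Fin (2 ^ m)) : restr m (bas (ones m r)) = basisVec m r := by
  funext i
  simp only [restr, bas_of_nodup (nodup_ones m r), basisVec]
  by_cases h : (r : ℕ).testBit (m - 1 - i) <;> simp [ones, h]

lemma bas_ones_off (m r : ℕ) (i : ℤ) (h : ¬(1 ≤ i ∧ i ≤ m)) : bas (ones m r) i = false := by
  rw [bas_of_nodup (nodup_ones m r), decide_eq_false_iff_not]
  simp only [ones, List.mem_map, List.mem_filter, List.mem_range]
  rintro ⟨j, ⟨hj, -⟩, rfl⟩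
  exact h (by omega)

lemma basisVec_bijective (m : ℕ) : Function.Bijective (basisVec m) := by
  rw [Fintype.bijective_iff_injective_and_card]
  refine ⟨fun r s h => Fin.ext (Nat.eq_of_testBit_eq fun i => ?_), by simp⟩
  by_cases hi : i < m
  · have := congrFun h ⟨m - 1 - i, by omega⟩
    simp only [basisVec] at this
    rwa [show m - 1 - (m - 1 - i) = i by omega] at this
  · have h2 : 2 ^ m ≤ 2 ^ i := Nat.pow_le_pow_right (by norm_num) (by omega)
    rw [Nat.testBit_lt_two_pow (r.2.trans_le h2), Nat.testBit_lt_two_pow (s.2.trans_le h2)]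

/-- The index of the real part of the entry in row `r` and column `s`, if the real and imaginary
parts of the entries are listed row by row. -/
def entryPos (m r s : ℕ) : ℕ := 2 * (r * 2 ^ m + s)

lemma entryPos_lt {m r s : ℕ} (hr : r < 2 ^ m) (hs : s < 2 ^ m) : entryPos m r s + 1 < 2 * 4 ^ m := by
  have h4 : (4 : ℕ) ^ m = 2 ^ m * 2 ^ m := by rw [← mul_pow]; norm_num
  have : (r + 1) * 2 ^ m ≤ 2 ^ m * 2 ^ m := Nat.mul_le_mul_right _ hr
  rw [entryPos, h4]
  nlinarith

/-- The real and imaginary parts of the entries, with their indices and their positions. -/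
def entryIdx (m : ℕ) : List (ℕ × List ℤ × List ℤ) :=
  (List.range (2 ^ m)).flatMap fun r => (List.range (2 ^ m)).flatMap fun s =>
    [(entryPos m r s, ones m r, ones m s), (entryPos m r s + 1, ones m r, ones m s)]

lemma entryIdx_lt {m : ℕ} {t : ℕ × List ℤ × List ℤ} (ht : t ∈ entryIdx m) : t.1 < 2 * 4 ^ m := by
  simp only [entryIdx, List.mem_flatMap, List.mem_range, List.mem_cons, List.not_mem_nil,
    or_false] at ht
  obtain ⟨r, hr, s, hs, rfl | rfl⟩ := ht
  · exact (Nat.lt_succ_self _).trans (entryPos_lt hr hs)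
  · exact entryPos_lt hr hs

lemma length_entryIdx (m : ℕ) : (entryIdx m).length = 2 * 4 ^ m := by
  have h4 : (4 : ℕ) ^ m = 2 ^ m * 2 ^ m := by rw [← mul_pow]; norm_num
  simp [entryIdx, List.length_flatMap, h4]
  ring

/-- The matrix on the cells `1, …, m` with the given real and imaginary parts of the entries, the
latter multiplied by the imaginary unit. -/
def entryTerms (m : ℕ) (c : ℕ → ℂ) : List CTerm := (entryIdx m).map fun t => (c t.1, t.2)

lemma sum_map_range {M : Type*} [AddCommMonoid M] (n : ℕ) (f : ℕ → M) :
    ((List.range n).map f).sum = ∑ i : Fin n, f i := by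
  rw [← List.sum_ofFn, List.ofFn_eq_map, ← List.map_coe_finRange_eq_range, List.map_map]
  rfl

open Classical in
theorem init_eq_sem {m : ℕ} (ρ : QState m) (c : ℕ → ℂ)
    (hc : ∀ r s : Fin (2 ^ m), c (entryPos m r s) + c (entryPos m r s + 1) =
      ρ.mat (basisVec m r) (basisVec m s)) :
    QTape.init ρ = sem (entryTerms m c) := by
  funext x y
  have h1 : sem (entryTerms m c) x y = ∑ r : Fin (2 ^ m), ∑ s : Fin (2 ^ m),
      if bas (ones m r) = x ∧ bas (ones m s) = y then ρ.mat (basisVec m r) (basisVec m s)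
      else 0 := by
    simp only [sem, entryTerms, List.map_map, entryIdx, sum_map_flatMap, sum_map_range]
    refine Finset.sum_congr rfl fun r _ => Finset.sum_congr rfl fun s _ => ?_
    rw [← hc]
    by_cases h : bas (ones m r) = x ∧ bas (ones m s) = y <;> simp [h]
  rw [h1]
  simp only [QTape.init]
  split_ifs with h
  · obtain ⟨r, hr⟩ := (basisVec_bijective m).2 (restr m x)
    obtain ⟨s, hs⟩ := (basisVec_bijective m).2 (restr m y)
    have e : ∀ (z : QBasis) (r r' : Fin (2 ^ m)), (∀ i : ℤ, ¬(1 ≤ i ∧ i ≤ m) → z i = false) →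
        basisVec m r = restr m z → (bas (ones m r') = z ↔ r' = r) := by
      intro z r r' hz hr
      constructor
      · rintro rfl
        rw [restr_bas_ones] at hr
        exact ((basisVec_bijective m).1 hr).symm
      · rintro rfl
        refine eq_of_restr_of_offEq (m := m) (by rw [restr_bas_ones, hr]) fun i hi => ?_
        rw [bas_ones_off m r' i hi, hz i hi]
    rw [Finset.sum_eq_single r, Finset.sum_eq_single s]
    · rw [if_pos ⟨(e x r r (fun i hi => (h i hi).1) hr).2 rfl,
        (e y s s (fun i hi => (h i hi).2) hs).2 rfl⟩, hr, hs]
      rfl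
    · intro s' _ hs'
      rw [if_neg]
      rintro ⟨-, h2⟩
      exact hs' ((e y s s' (fun i hi => (h i hi).2) hs).1 h2)
    · simp
    · intro r' _ hr'
      refine Finset.sum_eq_zero fun s' _ => ?_
      rw [if_neg]
      rintro ⟨h2, -⟩
      exact hr' ((e x r r' (fun i hi => (h i hi).1) hr).1 h2)
    · simp
  · symm
    refine Finset.sum_eq_zero fun r _ => Finset.sum_eq_zero fun s _ => ?_
    rw [if_neg]
    rintro ⟨rfl, rfl⟩
    exact h fun i hi => ⟨bas_ones_off m r i hi, bas_ones_off m s i hi⟩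

/-! ### Linearity and continuity in the coefficients -/

lemma red_append (m : ℕ) (l l' : List CTerm) : red m (l ++ l') = red m l + red m l' := by
  ext a b
  simp [red]

lemma red_flatMap {α : Type*} (m : ℕ) (l : List α) (f : α → List CTerm) :
    red m (l.flatMap f) = (l.map fun t => red m (f t)).sum := by
  induction l with
  | nil => ext a b; simp [red]
  | cons t l ih => rw [List.flatMap_cons, red_append, ih]; simp

lemma red_map_mul (m : ℕ) (l : List CTerm) (c : ℂ) :
    red m (l.map fun t => (c * t.1, t.2)) = c • red m l := by
  ext a b
  simp only [red, Matrix.of_apply, Matrix.smul_apply, List.map_map, smul_eq_mul]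
  rw [← list_sum_map_mul_left]
  congr 1
  refine List.map_congr_left fun t _ => ?_
  simp [mul_ite]

lemma gateC_mul (g : Gate) (j : ℤ) (c : ℂ) (t : CTerm) :
    gateC g j (c * t.1, t.2) = (gateC g j t).map fun t => (c * t.1, t.2) := by
  simp only [gateC, List.map_flatMap, List.map_map]
  congr 1
  funext p
  refine List.map_congr_left fun q _ => ?_
  simp [mul_assoc]

lemma Circuit.terms_map_mul (C : Circuit) (j : ℤ) (c : ℂ) (l : List CTerm) :
    C.terms j (l.map fun t => (c * t.1, t.2)) = (C.terms j l).map fun t => (c * t.1, t.2) := by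
  induction C generalizing j l with
  | nil => rfl
  | cons a C ih =>
    rw [Circuit.terms, Circuit.terms, ← ih]
    congr 1
    rw [List.map_flatMap, List.flatMap_map]
    congr 1
    funext t
    exact gateC_mul _ _ _ _

/-- Linearity in the coefficients: the circuit only has to be followed on bare matrix units. -/
lemma red_terms (m : ℕ) (C : Circuit) (j : ℤ) (l : List CTerm) :
    red m (C.terms j l) = (l.map fun t => t.1 • red m (C.terms j [(1, t.2)])).sum := by
  rw [Circuit.terms_flatMap, red_flatMap]
  congr 1
  refine List.map_congr_left fun t _ => ?_
  rw [← red_map_mul, ← Circuit.terms_map_mul]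
  simp

/-- The sum of the absolute values of the coefficients. -/
def norm1 (l : List CTerm) : ℝ := (l.map fun t => ‖t.1‖).sum

lemma norm1_flatMap_le (l : List CTerm) (f : CTerm → List CTerm) (c : ℝ)
    (hf : ∀ t, norm1 (f t) ≤ c * ‖t.1‖) : norm1 (l.flatMap f) ≤ c * norm1 l := by
  induction l with
  | nil => simp [norm1]
  | cons t l ih =>
    have := hf t
    simp only [norm1, List.flatMap_cons, List.map_append, List.sum_append, List.map_cons,
      List.sum_cons] at ih this ⊢
    linarith

/-- The worst case is the Hadamard gate, with four pairs of branches of weight `1 / 2` each. -/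
lemma norm1_gateC (g : Gate) (j : ℤ) (t : CTerm) : norm1 (gateC g j t) ≤ 2 * ‖t.1‖ := by
  have h0 := norm_nonneg t.1
  have h1 := norm_zeta8
  have h2 : |√2| ^ 2 = 2 := by rw [sq_abs]; norm_num
  cases g <;> simp [norm1, gateC, half, Gate.amp, h1, h2] <;> linarith

lemma norm1_terms (C : Circuit) (j : ℤ) (l : List CTerm) :
    norm1 (C.terms j l) ≤ 2 ^ C.length * norm1 l := by
  induction C generalizing j l with
  | nil => simp [Circuit.terms]
  | cons a C ih =>
    refine (ih _ _).trans ?_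
    have := norm1_flatMap_le l (gateC a.1 j) 2 (norm1_gateC _ _)
    rw [List.length_cons, pow_succ, mul_assoc]
    gcongr

lemma sum_norm_red_le (m : ℕ) (l : List CTerm) : ∑ a, ∑ b, ‖red m l a b‖ ≤ norm1 l := by
  classical
  induction l with
  | nil => simp [red, norm1]
  | cons t l ih =>
    have h1 : ∀ a b, red m (t :: l) a b = red m [t] a b + red m l a b := fun a b => by
      rw [← Matrix.add_apply, ← red_append]; rfl
    have h2 : ∑ a, ∑ b, ‖red m [t] a b‖ ≤ ‖t.1‖ := by
      rw [Finset.sum_eq_single (restr m (bas t.2.1)), Finset.sum_eq_single (restr m (bas t.2.2))]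
      · simp only [red, Matrix.of_apply, List.map_cons, List.map_nil, List.sum_cons, List.sum_nil,
          add_zero]
        split_ifs <;> simp
      · intro b _ hb
        simp [red, Ne.symm hb]
      · simp
      · intro a _ ha
        simp [red, Ne.symm ha]
      · simp
    calc ∑ a, ∑ b, ‖red m (t :: l) a b‖
        ≤ ∑ a, ∑ b, (‖red m [t] a b‖ + ‖red m l a b‖) := by
          refine Finset.sum_le_sum fun a _ => Finset.sum_le_sum fun b _ => ?_
          rw [h1]
          exact norm_add_le _ _
      _ = ∑ a, ∑ b, ‖red m [t] a b‖ + ∑ a, ∑ b, ‖red m l a b‖ := by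
          simp only [Finset.sum_add_distrib]
      _ ≤ ‖t.1‖ + norm1 l := add_le_add h2 ih
      _ = norm1 (t :: l) := by simp [norm1]

/-- The approximate coefficients need not come from a state, so the estimate is made for arbitrary
ones. Its exponential constant is harmless, since the precision of the entries is chosen after the
circuit is known. -/
theorem fro_red_sub_le (n m : ℕ) (C : Circuit) (j : ℤ) (c c' : ℕ → ℂ) (δ : ℝ)
    (h : ∀ i < 2 * 4 ^ m, ‖c i - c' i‖ ≤ δ) :
    fro (red n (C.terms j (entryTerms m c)) - red n (C.terms j (entryTerms m c'))) ≤
      2 ^ C.length * (2 * 4 ^ m * δ) := by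
  have h1 : red n (C.terms j (entryTerms m c)) - red n (C.terms j (entryTerms m c')) =
      red n (C.terms j (entryTerms m fun i => c i - c' i)) := by
    rw [red_terms, red_terms, red_terms]
    simp only [entryTerms, List.map_map, Function.comp_def]
    generalize entryIdx m = L
    induction L with
    | nil => simp
    | cons t L ih =>
      rw [List.map_cons, List.map_cons, List.map_cons, List.sum_cons, List.sum_cons, List.sum_cons,
        ← ih, sub_smul]
      abel
  rw [h1]
  refine (fro_le_sum _).trans ((sum_norm_red_le _ _).trans ((norm1_terms _ _ _).trans ?_))
  refine mul_le_mul_of_nonneg_left ?_ (by positivity)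
  have h2 : norm1 (entryTerms m fun i => c i - c' i) ≤
      (((entryIdx m).map fun _ => δ).sum : ℝ) := by
    simp only [norm1, entryTerms, List.map_map]
    refine List.sum_le_sum fun t ht => ?_
    exact h _ (entryIdx_lt ht)
  refine h2.trans (le_of_eq ?_)
  rw [List.map_const', List.sum_replicate, length_entryIdx, nsmul_eq_mul]
  push_cast
  ring

/-! ### Integral terms -/

/-- A term `(w, k, u, v)` stands for `w` times the `k`-th power of the eighth root of unity times
the matrix unit of `u` and `v`. -/
abbrev NTerm := ℕ × ℕ × List ℤ × List ℤ

/-- Twice the effect of a gate on a term. -/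
def gateN (g : Gate) (j : ℤ) (t : NTerm) : List NTerm :=
  (half g j t.2.2.1).flatMap fun p => (half g j t.2.2.2).map fun q =>
    (t.1 * g.scale, t.2.1 + p.1 + 7 * q.1, p.2, q.2)

/-- The effect of a circuit on a list of terms, up to a power of two. -/
def Circuit.termsN : Circuit → ℤ → List NTerm → List NTerm
  | [], _, l => l
  | a :: C, j, l => Circuit.termsN C (j + a.2.toInt) (l.flatMap (gateN a.1 j))

/-- A term with the coefficient scaled by `s`. -/
def NTerm.toC (s : ℝ) (t : NTerm) : CTerm := ((s : ℂ) * t.1 * zeta8 ^ t.2.1, t.2.2)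

/-- A pair of branches has weight `1` or `1 / 2`. Doubling it gives the natural number `g.scale`,
and the compensating factor is moved into the global scale `s`. -/
lemma map_toC_gateN (g : Gate) (j : ℤ) (s : ℝ) (t : NTerm) :
    (gateN g j t).map (NTerm.toC (s / 2)) = gateC g j (t.toC s) := by
  have h : (g.amp : ℂ) ^ 2 = (g.scale : ℂ) / 2 := by
    have := congrArg (fun r : ℝ => (r : ℂ)) g.amp_sq
    push_cast at this
    exact this
  simp only [gateN, gateC, List.map_flatMap, List.map_map, NTerm.toC]
  congr 1
  funext p
  refine List.map_congr_left fun q _ => ?_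
  simp only [Function.comp, NTerm.toC, h, Prod.mk.injEq, and_true]
  push_cast
  rw [pow_add, pow_add]
  ring

lemma map_toC_termsN (C : Circuit) (j : ℤ) (s : ℝ) (l : List NTerm) :
    (C.termsN j l).map (NTerm.toC (s / 2 ^ C.length)) = C.terms j (l.map (NTerm.toC s)) := by
  induction C generalizing j s l with
  | nil => simp [Circuit.termsN, Circuit.terms]
  | cons a C ih =>
    have := ih (j + a.2.toInt) (s / 2) (l.flatMap (gateN a.1 j))
    rw [Circuit.termsN, Circuit.terms, List.length_cons, pow_succ', ← div_div, this,
      List.map_flatMap, List.flatMap_map]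
    simp only [map_toC_gateN]

/-- A test for agreement off the cells `1, …, m`. -/
def offTest (m : ℕ) (u v : List ℤ) : Prop := ∀ i ∈ u ++ v, (1 ≤ i ∧ i ≤ m) ∨ bas u i = bas v i

/-- A test for agreement on the cells `1, …, m`. -/
def onTest (m : ℕ) (u v : List ℤ) : Prop := ∀ i ∈ u ++ v, ¬(1 ≤ i ∧ i ≤ m) ∨ bas u i = bas v i

instance (m : ℕ) (u v : List ℤ) : Decidable (offTest m u v) := by unfold offTest; infer_instance

instance (m : ℕ) (u v : List ℤ) : Decidable (onTest m u v) := by unfold onTest; infer_instance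

lemma bas_eq_of_not_mem {u v : List ℤ} {i : ℤ} (h : i ∉ u ++ v) : bas u i = bas v i := by
  rw [List.mem_append, not_or] at h
  simp [bas, List.count_eq_zero_of_not_mem h.1, List.count_eq_zero_of_not_mem h.2]

/-- Cells outside both lists hold `0` in either assignment, so a finite check decides an equality on
infinitely many cells. -/
lemma offTest_iff (m : ℕ) (u v : List ℤ) : offTest m u v ↔ OffEq m (bas u) (bas v) := by
  constructor
  · intro h i hi
    by_cases hm : i ∈ u ++ v
    · exact (h i hm).resolve_left hi
    · exact bas_eq_of_not_mem hm
  · intro h i _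
    exact or_iff_not_imp_left.2 (h i)

lemma onTest_iff (m : ℕ) (u v : List ℤ) : onTest m u v ↔ restr m (bas u) = restr m (bas v) := by
  constructor
  · intro h
    funext i
    simp only [restr]
    by_cases hm : ((i : ℕ) : ℤ) + 1 ∈ u ++ v
    · exact (h _ hm).resolve_left (fun h => h (by omega))
    · exact bas_eq_of_not_mem hm
  · intro h i _
    refine or_iff_not_imp_left.2 fun hi => ?_
    have hi := not_not.1 hi
    have := congrFun h ⟨(i - 1).toNat, by omega⟩
    simp only [restr] at this
    have e : (((i - 1).toNat : ℕ) : ℤ) + 1 = i := by omega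
    rwa [e] at this

/-- Whether a pair of terms contributes to the square of the Frobenius norm of the reduced matrix. -/
def Meet (m : ℕ) (t t' : List ℤ × List ℤ) : Prop :=
  (offTest m t.1 t.2 ∧ offTest m t'.1 t'.2) ∧ onTest m t.1 t'.1 ∧ onTest m t.2 t'.2

instance (m : ℕ) (t t' : List ℤ × List ℤ) : Decidable (Meet m t t') := by
  unfold Meet; infer_instance

/-- The sum of `|z|² = z * star z` over the entries is expanded into pairs of terms. Each term lies
in at most one entry, so a pair contributes once, and only if both terms survive the partial trace
and share that entry. -/
lemma fro_red_sq (m : ℕ) (l : List CTerm) :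
    ((fro (red m l) ^ 2 : ℝ) : ℂ) = (l.map fun t => (l.map fun t' =>
      if Meet m t.2 t'.2 then t.1 * star t'.1 else 0).sum).sum := by
  classical
  rw [fro_sq]
  push_cast
  have h1 : ∀ L : List CTerm, ∀ a b, star (red m L a b) = (L.map fun t =>
      if OffEq m (bas t.2.1) (bas t.2.2) ∧ restr m (bas t.2.1) = a ∧ restr m (bas t.2.2) = b
      then star t.1 else 0).sum := by
    intro L a b
    induction L with
    | nil => simp [red]
    | cons t L ih =>
      simp only [red, Matrix.of_apply, List.map_cons, List.sum_cons, star_add] at ih ⊢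
      rw [ih]
      split_ifs <;> simp
  have h2 : ∀ a b, ((‖red m l a b‖ : ℂ)) ^ 2 = (l.map fun t => (l.map fun t' =>
      if (OffEq m (bas t.2.1) (bas t.2.2) ∧ restr m (bas t.2.1) = a ∧ restr m (bas t.2.2) = b) ∧
        (OffEq m (bas t'.2.1) (bas t'.2.2) ∧ restr m (bas t'.2.1) = a ∧ restr m (bas t'.2.2) = b)
      then t.1 * star t'.1 else 0).sum).sum := by
    intro a b
    rw [← Complex.mul_conj', ← Complex.star_def, h1]
    simp only [red, Matrix.of_apply]
    rw [← list_sum_map_mul_right]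
    congr 1
    refine List.map_congr_left fun t _ => ?_
    rw [← list_sum_map_mul_left]
    congr 1
    refine List.map_congr_left fun t' _ => ?_
    rw [ite_and (P := _ ∧ _), ite_mul, zero_mul, mul_ite, mul_zero]
  simp only [h2, list_sum_map_comm]
  congr 1
  refine List.map_congr_left fun t _ => ?_
  congr 1
  refine List.map_congr_left fun t' _ => ?_
  rw [Finset.sum_eq_single (restr m (bas t.2.1)), Finset.sum_eq_single (restr m (bas t.2.2))]
  · refine if_congr ?_ rfl rfl
    simp only [Meet, offTest_iff, onTest_iff, and_true]
    rw [eq_comm (a := restr m (bas t.2.1)), eq_comm (a := restr m (bas t.2.2))]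
    tauto
  · intro b _ hb
    simp [Ne.symm hb]
  · simp
  · intro a _ ha
    simp [Ne.symm ha]
  · simp

/-- The total weight of the pairs of terms that contribute with the `j`-th power of the eighth root
of unity to the square of the Frobenius norm. -/
def froCount (m : ℕ) (l : List NTerm) (j : ℕ) : ℕ :=
  (l.map fun t => (l.map fun t' =>
    if Meet m t.2.2 t'.2.2 ∧ (t.2.1 + 7 * t'.2.1) % 8 = j then t.1 * t'.1 else 0).sum).sum

/-- The product of one coefficient with the conjugate of another has the phase exponent `k + 7 k'`,
and only its residue modulo 8 matters. -/
lemma fro_red_toC_sq' (m : ℕ) (l : List NTerm) (s : ℝ) :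
    ((fro (red m (l.map (NTerm.toC s))) ^ 2 : ℝ) : ℂ) =
      (s : ℂ) ^ 2 * ∑ j ∈ Finset.range 8, (froCount m l j : ℂ) * zeta8 ^ j := by
  rw [fro_red_sq]
  have h1 : ∀ j, (froCount m l j : ℂ) * zeta8 ^ j = (l.map fun t => (l.map fun t' =>
      if Meet m t.2.2 t'.2.2 ∧ (t.2.1 + 7 * t'.2.1) % 8 = j then (t.1 : ℂ) * t'.1 * zeta8 ^ j
      else 0).sum).sum := by
    intro j
    simp only [froCount, Nat.cast_list_sum, List.map_map, Function.comp_def]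
    rw [← list_sum_map_mul_right]
    congr 1
    refine List.map_congr_left fun t _ => ?_
    rw [← list_sum_map_mul_right]
    congr 1
    refine List.map_congr_left fun t' _ => ?_
    split_ifs <;> simp
  simp only [h1, list_sum_map_comm, ← list_sum_map_mul_left, List.map_map, Function.comp_def]
  congr 1
  refine List.map_congr_left fun t _ => ?_
  congr 1
  refine List.map_congr_left fun t' _ => ?_
  have h3 : ∀ j : ℕ, (if Meet m t.2.2 t'.2.2 ∧ (t.2.1 + 7 * t'.2.1) % 8 = j then
      (t.1 : ℂ) * t'.1 * zeta8 ^ j else 0) = if j = (t.2.1 + 7 * t'.2.1) % 8 then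
      (if Meet m t.2.2 t'.2.2 then (t.1 : ℂ) * t'.1 * zeta8 ^ j else 0) else 0 := by
    intro j
    by_cases h : Meet m t.2.2 t'.2.2 <;> by_cases h' : (t.2.1 + 7 * t'.2.1) % 8 = j
    · simp [h, h']
    · simp [h, h', Ne.symm h']
    · simp [h]
    · simp [h]
  simp only [h3]
  have hr : (t.2.1 + 7 * t'.2.1) % 8 ∈ Finset.range 8 :=
    Finset.mem_range.2 (Nat.mod_lt _ (by norm_num))
  rw [Finset.sum_ite_eq' (Finset.range 8)]
  by_cases hM : Meet m t.2.2 t'.2.2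
  · simp only [hM, hr, if_true, NTerm.toC]
    have h2 : zeta8 ^ ((t.2.1 + 7 * t'.2.1) % 8) = zeta8 ^ t.2.1 * zeta8 ^ (7 * t'.2.1) := by
      rw [← pow_add]
      conv_rhs => rw [← Nat.div_add_mod (t.2.1 + 7 * t'.2.1) 8]
      rw [pow_add, pow_mul, zeta8_pow_eight, one_pow, one_mul]
    rw [h2, star_mul', star_mul', star_zeta8_pow]
    simp only [Complex.star_def, Complex.conj_ofReal, map_natCast]
    ring
  · simp [hM, NTerm.toC]

/-- The left side is real, so real parts suffice. The powers 2 and 6 of `zeta8` are imaginary, and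
the others have real part `±1` or `±1 / √2`. -/
theorem fro_red_toC_sq (m : ℕ) (l : List NTerm) (s : ℝ) :
    fro (red m (l.map (NTerm.toC s))) ^ 2 = s ^ 2 * ((froCount m l 0 - froCount m l 4 : ℝ) +
      (froCount m l 1 + froCount m l 7 - froCount m l 3 - froCount m l 5) * (1 / √2)) := by
  have h := congrArg Complex.re (fro_red_toC_sq' m l s)
  have e1 : zeta8.re = 1 / √2 := by
    rw [zeta8_eq, Complex.add_re, Complex.ofReal_re, Complex.re_ofReal_mul, Complex.I_re]; ring
  have e1' : zeta8.im = 1 / √2 := by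
    rw [zeta8_eq, Complex.add_im, Complex.ofReal_im, Complex.im_ofReal_mul, Complex.I_im]; ring
  have e3 : (zeta8 ^ 3).re = -(1 / √2) := by
    rw [pow_succ, zeta8_sq, Complex.mul_re]; simp [e1']
  have e4 := zeta8_pow_four
  have e5 : (zeta8 ^ 5).re = -(1 / √2) := by rw [pow_succ, e4]; simp [e1]
  have e6 : (zeta8 ^ 6).re = 0 := by
    rw [show zeta8 ^ 6 = zeta8 ^ 4 * zeta8 ^ 2 by ring, e4, zeta8_sq]; simp
  have e7 : (zeta8 ^ 7).re = 1 / √2 := by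
    rw [← star_zeta8, Complex.star_def, Complex.conj_re, e1]
  rw [Complex.ofReal_re, ← Complex.ofReal_pow, Complex.re_ofReal_mul] at h
  rw [h]
  congr 1
  simp only [Finset.sum_range_succ, Finset.sum_range_zero, Complex.add_re, ← Complex.ofReal_natCast,
    Complex.re_ofReal_mul, e3, e4, e5, e6, e7, zeta8_sq, pow_one, e1]
  simp
  ring

/-! ### The classical control of a machine -/

namespace DcqTM

variable (T : DcqTM)

/-- The state, the symbols written (most recent first), the position of the classical head, and the
gates applied with the subsequent moves of the quantum head. -/
abbrev Ctl := T.Q × List (ℤ × Option Bool) × ℤ × Circuit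

/-- The classical tape that holds `w` from cell `1` on, after the given symbols have been written. -/
def cell (w : List (Option Bool)) (l : List (ℤ × Option Bool)) (i : ℤ) : Option Bool :=
  (l.lookup i).getD (if 1 ≤ i then w.getD (i - 1).toNat none else none)

open Classical in
/-- One step of the classical control, if the classical input is `w`. -/
def ctlStep (w : List (Option Bool)) (c : T.Ctl) : T.Ctl :=
  if c.1 = T.halt then c
  else
    ((T.δ (c.1, cell w c.2.1 c.2.2.1)).2.2.2.2,
      (c.2.2.1, (T.δ (c.1, cell w c.2.1 c.2.2.1)).2.2.1) :: c.2.1,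
      c.2.2.1 + (T.δ (c.1, cell w c.2.1 c.2.2.1)).2.2.2.1.toInt,
      c.2.2.2 ++ [((T.δ (c.1, cell w c.2.1 c.2.2.1)).1, (T.δ (c.1, cell w c.2.1 c.2.2.1)).2.1)])

/-- The classical control after `t` steps. -/
def ctl (w : List (Option Bool)) (t : ℕ) : T.Ctl := (T.ctlStep w)^[t] (T.start, [], 0, [])

/-- The cells that hold the input `x □ s`. -/
def inputCells (x s : BStr) : List (Option Bool) := x.map some ++ none :: s.map some

/-- The cells that hold the output `y □ s □`. -/
def outputCells (y s : BStr) : List (Option Bool) := y.map some ++ none :: (s.map some ++ [none])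

/-- On the classical input `w` the machine halts within `t` steps with `y □ s □` on its tape, after
having applied the gates `C`. -/
def Runs (w : List (Option Bool)) (t : ℕ) (y s : BStr) (C : Circuit) : Prop :=
  (T.ctl w t).1 = T.halt ∧
    (List.range (outputCells y s).length).map (fun i : ℕ => cell w (T.ctl w t).2.1 (i + 1)) =
      outputCells y s ∧
    (T.ctl w t).2.2.2 = C

variable {T}

/-- The classical control describes the configuration, if the quantum tape was `q` initially. -/
def Ctl.Describes (w : List (Option Bool)) (q : QTape) (s : T.Ctl) (c : T.Config) : Prop :=
  c.state = s.1 ∧ (∀ i, c.ctape i = cell w s.2.1 i) ∧ c.chead = s.2.2.1 ∧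
    (c.qtape, c.qhead) = Circuit.run s.2.2.2 (q, 0)

lemma Ctl.Describes.step {w : List (Option Bool)} {q : QTape} {s : T.Ctl} {c : T.Config}
    (h : s.Describes w q c) : (T.ctlStep w s).Describes w q (T.step c) := by
  classical
  obtain ⟨h1, h2, h3, h4⟩ := h
  rw [ctlStep, DcqTM.step, ← h1, ← h3, ← h2]
  split_ifs with hh
  · exact ⟨h1, h2, h3, h4⟩
  · refine ⟨rfl, fun i => ?_, rfl, ?_⟩
    · simp only [cell, List.lookup_cons, Function.update_apply, beq_eq_decide]
      by_cases hi : i = c.chead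
      · simp [hi]
      · rw [if_neg hi, h2]
        simp [hi, cell]
    · rw [Circuit.run_append, ← h4]
      rfl

lemma ctl_succ (w : List (Option Bool)) (t : ℕ) : T.ctl w (t + 1) = T.ctlStep w (T.ctl w t) := by
  rw [ctl, ctl, Function.iterate_succ_apply']

lemma ctl_describes (x : BStr) {n : ℕ} (ρ : QState n) (t : ℕ) :
    (T.ctl (inputCells x (natStr n)) t).Describes (inputCells x (natStr n)) (QTape.init ρ)
      (T.step^[t] (T.init x ρ)) := by
  induction t with
  | zero => exact ⟨rfl, fun i => rfl, rfl, rfl⟩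
  | succ t ih => rw [ctl_succ, Function.iterate_succ_apply']; exact ih.step

lemma readsOutput_iff (f : ℤ → Option Bool) (y : BStr) (m : ℕ) :
    ReadsOutput f y m ↔ (List.range (outputCells y (natStr m)).length).map
      (fun i : ℕ => f (i + 1)) = outputCells y (natStr m) := by
  constructor
  · intro h
    refine List.ext_getElem (by simp) fun i h1 h2 => ?_
    rw [List.getElem_map, List.getElem_range]
    exact h i h2
  · intro h i hi
    have := List.getElem_of_eq h (i := i) (by rw [List.length_map, List.length_range]; exact hi)
    rw [List.getElem_map, List.getElem_range] at this
    exact this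

/-- The quantum tape is never read by the control. Thus a computation separates into a classical one
that lists gates and the action of these gates on the input state. -/
theorem outputs_iff (x : BStr) {n : ℕ} (ρ : QState n) (y : BStr) {m : ℕ} (σ : QState m) :
    T.Outputs x ρ y σ ↔ ∃ t C, T.Runs (inputCells x (natStr n)) t y (natStr m) C ∧
      (C.run (QTape.init ρ, 0)).1.reduced m = σ.mat := by
  have key : ∀ t, ((T.step^[t] (T.init x ρ)).state = T.halt ∧
      ReadsOutput (T.step^[t] (T.init x ρ)).ctape y m) ↔
      T.Runs (inputCells x (natStr n)) t y (natStr m)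
        (T.ctl (inputCells x (natStr n)) t).2.2.2 := by
    intro t
    obtain ⟨h1, h2, -, -⟩ := ctl_describes (T := T) x ρ t
    rw [Runs, readsOutput_iff, h1]
    simp only [h2, and_true]
  have key2 : ∀ t, (T.step^[t] (T.init x ρ)).qtape =
      (Circuit.run (T.ctl (inputCells x (natStr n)) t).2.2.2 (QTape.init ρ, 0)).1 := fun t => by
    rw [← (ctl_describes (T := T) x ρ t).2.2.2]
  constructor
  · rintro ⟨t, h1, h2, h3⟩
    exact ⟨t, _, (key t).1 ⟨h1, h2⟩, key2 t ▸ h3⟩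
  · rintro ⟨t, C, h1, h2⟩
    obtain rfl := h1.2.2
    exact ⟨t, ((key t).2 h1).1, ((key t).2 h1).2, by rw [key2]; exact h2⟩

/-! ### Uniqueness of the result of a run -/

lemma ctl_of_halt {w : List (Option Bool)} {t t' : ℕ} (h : (T.ctl w t).1 = T.halt) (ht : t ≤ t') :
    T.ctl w t' = T.ctl w t := by
  induction t', ht using Nat.le_induction with
  | base => rfl
  | succ t' _ ih => rw [ctl_succ, ih, ctlStep, if_pos h]

lemma Runs.mono {w : List (Option Bool)} {t t' : ℕ} {y s : BStr} {C : Circuit}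
    (h : T.Runs w t y s C) (ht : t ≤ t') : T.Runs w t' y s C := by
  rw [Runs, ctl_of_halt h.1 ht]
  exact h

/-- Strings contain no blanks, so the first blank on the tape determines where the string ends. The
remainders are again prefixes of one list, which allows a second application to the qubit count. -/
lemma eq_of_prefix {y y' : BStr} {A A' l : List (Option Bool)}
    (h : y.map some ++ none :: A <+: l) (h' : y'.map some ++ none :: A' <+: l) :
    y = y' ∧ ∃ l', A <+: l' ∧ A' <+: l' := by
  induction y generalizing y' l with
  | nil =>
    cases l with
    | nil => simp at h
    | cons a l =>
      cases y' with
      | nil => exact ⟨rfl, l, by simp_all [List.cons_prefix_cons]⟩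
      | cons b y' => simp only [List.map_nil, List.nil_append, List.map_cons, List.cons_append,
          List.cons_prefix_cons] at h h'; exact absurd (h'.1.trans h.1.symm) (by simp)
  | cons b y ih =>
    cases l with
    | nil => simp at h
    | cons a l =>
      cases y' with
      | nil => simp only [List.map_nil, List.nil_append, List.map_cons, List.cons_append,
          List.cons_prefix_cons] at h h'; exact absurd (h'.1.trans h.1.symm) (by simp)
      | cons b' y' =>
        simp only [List.map_cons, List.cons_append, List.cons_prefix_cons] at h h'
        obtain ⟨rfl, hl⟩ := ih h.2 h'.2
        exact ⟨by rw [Option.some.inj (h.1.trans h'.1.symm)], hl⟩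

/-- A halted control does not change any more, so both runs may be compared at the later of the two
times. -/
theorem Runs.unique {w : List (Option Bool)} {t t' : ℕ} {y y' s s' : BStr} {C C' : Circuit}
    (h : T.Runs w t y s C) (h' : T.Runs w t' y' s' C') : y = y' ∧ s = s' ∧ C = C' := by
  obtain ⟨-, h2, h3⟩ := h.mono (le_max_left t t')
  obtain ⟨-, h2', h3'⟩ := h'.mono (le_max_right t t')
  have hp : ∀ (f : ℕ → Option Bool) (L : List (Option Bool)) (N : ℕ), L.length ≤ N →
      (List.range L.length).map f = L → L <+: (List.range N).map f := by
    intro f L N hN h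
    conv_lhs => rw [← h]
    exact (List.prefix_iff_eq_take.2 (by simp [List.take_range, hN])).map f
  obtain ⟨hy, l', g, g'⟩ := eq_of_prefix (hp _ _ _ (le_max_left _ _) h2)
    (hp _ _ _ (le_max_right _ _) h2')
  exact ⟨hy, (eq_of_prefix g g').1, h3.symm.trans h3'⟩

end DcqTM

/-! ### Injectivity of the encodings -/

lemma strTuple_cons_inj {x x' y y' : BStr} {l l' : List BStr}
    (h : strTuple (x :: y :: l) = strTuple (x' :: y' :: l')) :
    x = x' ∧ strTuple (y :: l) = strTuple (y' :: l') := by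
  have key : ∀ (n n' : ℕ) (u u' : BStr), List.replicate n true ++ false :: u =
      List.replicate n' true ++ false :: u' → n = n' ∧ u = u' := by
    intro n
    induction n with
    | zero => intro n' u u' h; cases n' <;> simp_all [List.replicate_succ]
    | succ n ih =>
      intro n' u u' h
      cases n' with
      | zero => simp [List.replicate_succ] at h
      | succ n' =>
        simp only [List.replicate_succ, List.cons_append, List.cons.injEq, true_and] at h
        obtain ⟨rfl, rfl⟩ := ih _ _ _ h
        exact ⟨rfl, rfl⟩
  obtain ⟨h1, h2⟩ := key _ _ _ _ h
  exact List.append_inj h2 h1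

/-- The unary length prefixes separate the components, but the last one has none: the number of
components must be known. -/
lemma strTuple_inj {l l' : List BStr} (hl : l.length = l'.length) (h : strTuple l = strTuple l') :
    l = l' := by
  induction l generalizing l' with
  | nil => exact (List.length_eq_zero_iff.1 hl.symm).symm
  | cons x l ih =>
    cases l' with
    | nil => simp at hl
    | cons x' l' =>
      cases l with
      | nil =>
        obtain rfl : l' = [] := by simpa using hl.symm
        rw [show x = x' from h]
      | cons y l =>
        cases l' with
        | nil => simp at hl
        | cons y' l' =>
          obtain ⟨rfl, h2⟩ := strTuple_cons_inj h
          rw [ih (by simpa using hl) h2]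

/-- The number of a string. -/
def strNat (s : BStr) : ℕ := strCode s.reverse - 1

lemma bits_strCode (x : BStr) : (strCode x).bits = x ++ [true] := by
  induction x with
  | nil => simp [strCode]
  | cons b x ih =>
    rw [strCode, Nat.bits_append_bit _ _ fun h => absurd h (strCode_pos x).ne', ih]
    rfl

/-- Together with injectivity this makes `strCode` a bijection onto the positive numbers, which is
why `strNat` subtracts `1`. -/
lemma exists_strCode {n : ℕ} (hn : 0 < n) : ∃ x, strCode x = n := by
  induction n using Nat.strong_induction_on with
  | _ n ih =>
    rcases Nat.lt_or_ge n 2 with h | h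
    · exact ⟨[], by simp [strCode]; omega⟩
    · obtain ⟨x, hx⟩ := ih (n / 2) (by omega) (by omega)
      refine ⟨n.bodd :: x, ?_⟩
      rw [strCode, hx, ← Nat.div2_val, Nat.bit_bodd_div2]

lemma natStr_strNat (s : BStr) : natStr (strNat s) = s := by
  have := strCode_pos s.reverse
  rw [natStr, strNat, Nat.sub_add_cancel this, bits_strCode]
  simp

lemma strNat_natStr (n : ℕ) : strNat (natStr n) = n := by
  obtain ⟨x, hx⟩ := exists_strCode n.succ_pos
  rw [natStr, ← Nat.succ_eq_add_one, ← hx, bits_strCode, strNat]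
  simp [hx]

/-! ### Primitive recursive operations -/

instance : Finite Gate := Finite.of_surjective (fun i : Fin 6 => Gate.ofNat i) fun g => by
  cases g
  exacts [⟨0, rfl⟩, ⟨1, rfl⟩, ⟨2, rfl⟩, ⟨3, rfl⟩, ⟨4, rfl⟩, ⟨5, rfl⟩]

instance : Finite Dir := Finite.of_surjective (fun i : Fin 3 => Dir.ofNat i) fun d => by
  cases d
  exacts [⟨0, rfl⟩, ⟨1, rfl⟩, ⟨2, rfl⟩]

instance : Primcodable Gate := Primcodable.ofEquiv _ (Finite.equivFin Gate)

instance : Primcodable Dir := Primcodable.ofEquiv _ (Finite.equivFin Dir)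

instance (T : DcqTM) : Finite T.Q := T.finite

instance (T : DcqTM) : Primcodable T.Q := Primcodable.ofEquiv _ (Finite.equivFin T.Q)

instance : DecidableEq Gate := Classical.decEq _

namespace Primrec

variable {α β γ : Type*} [Primcodable α] [Primcodable β] [Primcodable γ]

lemma nat_pow : Primrec₂ ((· ^ ·) : ℕ → ℕ → ℕ) := Primrec₂.unpaired'.1 Nat.Primrec.pow

lemma list_sum : Primrec (List.sum : List ℕ → ℕ) :=
  (list_foldr .id (const 0) (nat_add.comp (fst.comp snd) (snd.comp snd)).to₂).of_eq fun _ => rfl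

/-- Nonnegative integers have even codes and negative ones odd codes; the arithmetic on integers
below is reduced to parity cases. -/
lemma int_encode (z : ℤ) :
    Encodable.encode z = if 0 ≤ z then 2 * z.toNat else 2 * (-z).toNat - 1 := by
  rcases z with n | n
  · exact (if_pos (Int.natCast_nonneg n)).symm
  · rw [if_neg (by omega)]
    change 2 * n + 1 = _
    omega

lemma int_natCast : Primrec ((↑) : ℕ → ℤ) :=
  encode_iff.1 (nat_double.of_eq fun n => by rw [int_encode]; simp)

lemma int_toNat : Primrec Int.toNat := by
  refine (ite (Primrec.eq.comp (nat_mod.comp .encode (const 2)) (const 0))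
    (nat_div.comp .encode (const 2)) (const 0)).of_eq fun z => ?_
  rw [int_encode]
  split_ifs <;> omega

lemma int_succ : Primrec fun z : ℤ => z + 1 := by
  refine encode_iff.1 ((ite (Primrec.eq.comp (nat_mod.comp .encode (const 2)) (const 0))
    (nat_add.comp .encode (const 2)) (ite (Primrec.eq.comp .encode (const 1)) (const 0)
    (nat_sub.comp .encode (const 2)))).of_eq fun z => ?_)
  rw [int_encode, int_encode]
  split_ifs <;> omega

lemma int_pred : Primrec fun z : ℤ => z - 1 := by
  refine encode_iff.1 ((ite (Primrec.eq.comp .encode (const 0)) (const 1)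
    (ite (Primrec.eq.comp (nat_mod.comp .encode (const 2)) (const 0))
    (nat_sub.comp .encode (const 2)) (nat_add.comp .encode (const 2)))).of_eq fun z => ?_)
  rw [int_encode, int_encode]
  split_ifs <;> omega

lemma int_one_le {f : α → ℤ} (hf : Primrec f) : PrimrecPred fun a => 1 ≤ f a :=
  (nat_le.comp (const 1) (int_toNat.comp hf)).of_eq fun a => by omega

lemma move {f : α → ℤ} {g : α → Dir} (hf : Primrec f) (hg : Primrec g) :
    Primrec fun a => f a + (g a).toInt := by
  classical
  refine (ite (Primrec.eq.comp hg (const Dir.L)) (int_pred.comp hf)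
    (ite (Primrec.eq.comp hg (const Dir.R)) (int_succ.comp hf) hf)).of_eq fun a => ?_
  cases g a <;> simp [Dir.toInt]
  rfl

lemma strCode {f : α → BStr} (hf : Primrec f) : Primrec fun a => strCode (f a) := by
  refine (list_foldr hf (const 1) (cond (fst.comp snd) (nat_double_succ.comp (snd.comp snd))
    (nat_double.comp (snd.comp snd))).to₂).of_eq fun a => ?_
  induction f a with
  | nil => rfl
  | cons b x ih => rw [List.foldr_cons, ih]; cases b <;> rfl

lemma strNat {f : α → BStr} (hf : Primrec f) : Primrec fun a => strNat (f a) :=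
  nat_sub.comp (strCode (list_reverse.comp hf)) (const 1)

lemma list_eq_nil {f : α → List β} (hf : Primrec f) : PrimrecPred fun a => f a = [] := by
  classical
  exact Primrec.eq.comp hf (const [])

lemma strTuple {f : α → List BStr} (hf : Primrec f) : Primrec fun a => strTuple (f a) := by
  classical
  have h : Primrec fun l : List BStr => _root_.strTuple l := by
    refine (list_rec (f := id) (g := fun _ => []) (h := fun _ t => if t.2.1 = [] then t.1 else
      t.1.map (fun _ => true) ++ false :: (t.1 ++ t.2.2)) .id (const [])
      (ite (list_eq_nil (fst.comp (snd.comp snd))) (fst.comp snd)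
        (list_append.comp (list_map (fst.comp snd) (const true).to₂)
          (list_cons.comp (const false) (list_append.comp (fst.comp snd)
            (snd.comp (snd.comp snd)))))).to₂).of_eq fun l => ?_
    induction l with
    | nil => rfl
    | cons x l ih =>
      cases l with
      | nil => rfl
      | cons y l =>
        simp only [id] at ih ⊢
        rw [ih, if_neg (by simp), List.map_const']
        rfl
  exact h.comp hf

lemma pair3 {δ : Type*} [Primcodable δ] {f : α → β} {g : α → γ} {h : α → δ} (hf : Primrec f)
    (hg : Primrec g) (hh : Primrec h) : Primrec fun a => (f a, g a, h a) := pair hf (pair hg hh)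

/-! ### Primitive recursiveness of the simulation -/

lemma cell {w : α → List (Option Bool)} {l : α → List (ℤ × Option Bool)} {i : α → ℤ}
    (hw : Primrec w) (hl : Primrec l) (hi : Primrec i) :
    Primrec fun a => DcqTM.cell (w a) (l a) (i a) :=
  option_getD.comp (listLookup.comp hi hl) (ite (int_one_le hi)
    ((list_getD none).comp hw (int_toNat.comp (int_pred.comp hi))) (const none))

/-- The transition table is a function on a finite type, hence primitive recursive, and the control
is its bounded iteration. -/
lemma ctl (T : DcqTM) {w : α → List (Option Bool)} {t : α → ℕ} (hw : Primrec w) (ht : Primrec t) :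
    Primrec fun a => T.ctl (w a) (t a) := by
  classical
  refine nat_iterate ht (const _) (h := fun a c => T.ctlStep (w a) c) ?_
  have hw' : Primrec fun p : α × T.Ctl => w p.1 := hw.comp fst
  have hq : Primrec fun p : α × T.Ctl => p.2.1 := fst.comp snd
  have hl : Primrec fun p : α × T.Ctl => p.2.2.1 := fst.comp (snd.comp snd)
  have hi : Primrec fun p : α × T.Ctl => p.2.2.2.1 := fst.comp (snd.comp (snd.comp snd))
  have hC : Primrec fun p : α × T.Ctl => p.2.2.2.2 := snd.comp (snd.comp (snd.comp snd))
  have hδ : Primrec fun p : α × T.Ctl =>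
      T.δ (p.2.1, DcqTM.cell (w p.1) p.2.2.1 p.2.2.2.1) :=
    (dom_finite T.δ).comp (pair hq (cell hw' hl hi))
  exact (ite (Primrec.eq.comp hq (const _)) snd
    (pair (snd.comp (snd.comp (snd.comp (snd.comp hδ)))) (pair
      (list_cons.comp (pair hi (fst.comp (snd.comp (snd.comp hδ)))) hl) (pair
      (move hi (fst.comp (snd.comp (snd.comp (snd.comp hδ)))))
      (list_concat.comp hC (pair (fst.comp hδ) (fst.comp (snd.comp hδ)))))))).to₂

lemma inputCells {x s : α → BStr} (hx : Primrec x) (hs : Primrec s) :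
    Primrec fun a => DcqTM.inputCells (x a) (s a) :=
  list_append.comp (list_map hx (option_some.comp snd).to₂)
    (list_cons.comp (const none) (list_map hs (option_some.comp snd).to₂))

lemma outputCells {x s : α → BStr} (hx : Primrec x) (hs : Primrec s) :
    Primrec fun a => DcqTM.outputCells (x a) (s a) :=
  list_append.comp (list_map hx (option_some.comp snd).to₂)
    (list_cons.comp (const none) (list_concat.comp (list_map hs (option_some.comp snd).to₂)
      (const none)))

/-- The time `t` is part of the data, so that halting is checked and not searched for. -/
lemma runs (T : DcqTM) {w : α → List (Option Bool)} {t : α → ℕ} {y s : α → BStr} {C : α → Circuit}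
    (hw : Primrec w) (ht : Primrec t) (hy : Primrec y) (hs : Primrec s) (hC : Primrec C) :
    PrimrecPred fun a => T.Runs (w a) (t a) (y a) (s a) (C a) := by
  classical
  have h := ctl T hw ht
  have ho := outputCells hy hs
  exact (Primrec.eq.comp (fst.comp h) (const _)).and ((Primrec.eq.comp
    (list_map (list_range.comp (list_length.comp ho))
      (cell (hw.comp fst) (fst.comp (snd.comp (h.comp fst))) (int_succ.comp
        (int_natCast.comp snd))).to₂) ho).and
    (Primrec.eq.comp (snd.comp (snd.comp (snd.comp h))) hC))

/-! ### Primitive recursiveness of the semantics of circuits -/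

lemma bas {l : α → List ℤ} {i : α → ℤ} (hl : Primrec l) (hi : Primrec i) :
    Primrec fun a => bas (l a) (i a) := by
  classical
  refine (Primrec.eq.comp (nat_mod.comp (list_sum.comp (list_map hl
    (ite (Primrec.eq.comp snd (hi.comp fst)) (const 1) (const 0)).to₂)) (const 2))
    (const 1)).decide.of_eq fun a => ?_
  have : ∀ l : List ℤ, (l.map fun z => if z = i a then 1 else 0).sum = l.count (i a) := fun l => by
    induction l with
    | nil => rfl
    | cons z l ih => simp [ih, List.count_cons, add_comm]
  rw [this]
  rfl

lemma half {g : α → Gate} {j : α → ℤ} {l : α → List ℤ} (hg : Primrec g) (hj : Primrec j)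
    (hl : Primrec l) : Primrec fun a => half (g a) (j a) (l a) := by
  have hj' := int_succ.comp hj
  have hb := bas hl hj
  have hn : Primrec fun a => (_root_.bas (l a) (j a)).toNat := (dom_finite _).comp hb
  have one : ∀ {n : α → ℕ} {l : α → List ℤ}, Primrec n → Primrec l → Primrec fun a => [(n a, l a)] :=
    fun hn hl => list_cons.comp (pair hn hl) (const [])
  refine (ite (Primrec.eq.comp hg (const .id)) (one (const 0) hl)
    (ite (Primrec.eq.comp hg (const .had)) (list_cons.comp (pair (nat_mul.comp (const 4) hn) hl)
      (one (const 0) (list_cons.comp hj hl)))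
    (ite (Primrec.eq.comp hg (const .phase)) (one (nat_mul.comp (const 2) hn) hl)
    (ite (Primrec.eq.comp hg (const .piEighth)) (one hn hl)
    (ite (Primrec.eq.comp hg (const .swap)) (one (const 0) (ite (Primrec.eq.comp hb (bas hl hj')) hl
      (list_cons.comp hj (list_cons.comp hj' hl))))
    (one (const 0) (ite (Primrec.eq.comp hb (const true)) (list_cons.comp hj' hl) hl))))))).of_eq
    fun a => ?_
  cases g a <;> simp [_root_.half]

lemma gateN {g : α → Gate} {j : α → ℤ} {t : α → NTerm} (hg : Primrec g) (hj : Primrec j)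
    (ht : Primrec t) : Primrec fun a => gateN (g a) (j a) (t a) :=
  list_flatMap (half hg hj (fst.comp (snd.comp (snd.comp ht))))
    (list_map ((half hg hj (snd.comp (snd.comp (snd.comp ht)))).comp fst)
      (pair3 (nat_mul.comp (fst.comp (ht.comp (fst.comp fst)))
          ((dom_finite Gate.scale).comp (hg.comp (fst.comp fst))))
        (nat_add.comp (nat_add.comp (fst.comp (snd.comp (ht.comp (fst.comp fst))))
          (fst.comp (snd.comp fst))) (nat_mul.comp (const 7) (fst.comp snd)))
        (pair (snd.comp (snd.comp fst)) (snd.comp snd))).to₂).to₂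

lemma termsN {C : α → Circuit} {j : α → ℤ} {l : α → List NTerm} (hC : Primrec C) (hj : Primrec j)
    (hl : Primrec l) : Primrec fun a => Circuit.termsN (C a) (j a) (l a) := by
  -- The recursion of `Circuit.termsN` changes its other arguments too, so it is rewritten as a left
  -- fold that carries the head position and the list.
  have h : Primrec fun a => (C a).foldl (fun (p : ℤ × List NTerm) b =>
      (p.1 + b.2.toInt, p.2.flatMap (_root_.gateN b.1 p.1))) (j a, l a) := by
    refine list_foldl hC (pair hj hl) (h := fun _ p =>
      (p.1.1 + p.2.2.toInt, p.1.2.flatMap (_root_.gateN p.2.1 p.1.1))) ?_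
    exact (pair (move (fst.comp (fst.comp snd)) (snd.comp (snd.comp snd)))
      (list_flatMap (snd.comp (fst.comp snd)) (gateN (fst.comp (snd.comp (snd.comp fst)))
        (fst.comp (fst.comp (snd.comp fst))) snd).to₂)).to₂
  refine (snd.comp h).of_eq fun a => ?_
  generalize j a = j
  generalize l a = l
  induction C a generalizing j l with
  | nil => rfl
  | cons b C ih => rw [List.foldl_cons, ih]; rfl

lemma forall_mem {l : α → List β} {p : α → β → Prop} (hl : Primrec l) (hp : PrimrecRel p) :
    PrimrecPred fun a => ∀ b ∈ l a, p a b := by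
  have : PrimrecRel fun b a => p a b := PrimrecRel.comp₂ hp Primrec₂.right Primrec₂.left
  exact this.forall_mem_list.comp hl .id

lemma between {n : α → ℕ} {i : α → ℤ} (hn : Primrec n) (hi : Primrec i) :
    PrimrecPred fun a => 1 ≤ i a ∧ i a ≤ n a :=
  ((nat_le.comp (const 1) (int_toNat.comp hi)).and (nat_le.comp (int_toNat.comp hi) hn)).of_eq
    fun a => by omega

lemma offTest {n : α → ℕ} {u v : α → List ℤ} (hn : Primrec n) (hu : Primrec u) (hv : Primrec v) :
    PrimrecPred fun a => offTest (n a) (u a) (v a) :=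
  forall_mem (list_append.comp hu hv) ((between (hn.comp fst) snd).or
    (Primrec.eq.comp (bas (hu.comp fst) snd) (bas (hv.comp fst) snd)))

lemma onTest {n : α → ℕ} {u v : α → List ℤ} (hn : Primrec n) (hu : Primrec u) (hv : Primrec v) :
    PrimrecPred fun a => onTest (n a) (u a) (v a) :=
  forall_mem (list_append.comp hu hv) ((between (hn.comp fst) snd).not.or
    (Primrec.eq.comp (bas (hu.comp fst) snd) (bas (hv.comp fst) snd)))

lemma meet {n : α → ℕ} {t t' : α → List ℤ × List ℤ} (hn : Primrec n) (ht : Primrec t)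
    (ht' : Primrec t') : PrimrecPred fun a => Meet (n a) (t a) (t' a) :=
  ((offTest hn (fst.comp ht) (snd.comp ht)).and (offTest hn (fst.comp ht') (snd.comp ht'))).and
    ((onTest hn (fst.comp ht) (fst.comp ht')).and (onTest hn (snd.comp ht) (snd.comp ht')))

lemma froCount {n : α → ℕ} {l : α → List NTerm} (hn : Primrec n) (hl : Primrec l) (j : ℕ) :
    Primrec fun a => froCount (n a) (l a) j :=
  list_sum.comp (list_map hl (list_sum.comp (list_map (hl.comp fst)
    (ite ((meet (hn.comp (fst.comp fst)) (snd.comp (snd.comp (snd.comp fst)))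
      (snd.comp (snd.comp snd))).and (Primrec.eq.comp (nat_mod.comp (nat_add.comp
        (fst.comp (snd.comp (snd.comp fst))) (nat_mul.comp (const 7) (fst.comp (snd.comp snd))))
        (const 8)) (const j)))
      (nat_mul.comp (fst.comp (snd.comp fst)) (fst.comp snd)) (const 0)).to₂)).to₂)

lemma testBit {f g : α → ℕ} (hf : Primrec f) (hg : Primrec g) :
    Primrec fun a => (f a).testBit (g a) :=
  (Primrec.eq.comp (nat_mod.comp (nat_div.comp hf (nat_pow.comp (const 2) hg)) (const 2))
    (const 1)).decide.of_eq fun a => by rw [Nat.testBit_eq_decide_div_mod_eq]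

lemma ones {m r : α → ℕ} (hm : Primrec m) (hr : Primrec r) : Primrec fun a => ones (m a) (r a) := by
  have h : PrimrecRel fun (i : ℕ) (a : α) => (r a).testBit (m a - 1 - i) = true :=
    Primrec.eq.comp (testBit (hr.comp snd) (nat_sub.comp (nat_sub.comp (hm.comp snd) (const 1)) fst))
      (const true)
  exact list_map ((h.listFilter.comp (list_range.comp hm) .id).of_eq fun a => by
    congr 1; funext i; simp) (int_succ.comp (int_natCast.comp snd)).to₂

lemma entryIdx : Primrec entryIdx := by
  have hr : Primrec fun p : (ℕ × ℕ) × ℕ => p.1.2 := snd.comp fst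
  have hm : Primrec fun p : (ℕ × ℕ) × ℕ => p.1.1 := fst.comp fst
  have hp : Primrec fun p : (ℕ × ℕ) × ℕ => entryPos p.1.1 p.1.2 p.2 :=
    nat_double.comp (nat_add.comp (nat_mul.comp hr (nat_pow.comp (const 2) hm)) snd)
  have ht : Primrec fun p : (ℕ × ℕ) × ℕ => (_root_.ones p.1.1 p.1.2, _root_.ones p.1.1 p.2) :=
    pair (ones hm hr) (ones hm snd)
  exact list_flatMap (list_range.comp (nat_pow.comp (const 2) .id))
    (list_flatMap (list_range.comp (nat_pow.comp (const 2) fst))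
      (list_cons.comp (pair hp ht) (list_cons.comp (pair (succ.comp hp) ht) (const []))).to₂).to₂

end Primrec

/-! ### The entries of a density matrix -/

/-- An index, a sign, a numerator, a denominator, and the remainder of the output. -/
abbrev Entry := BStr × Bool × BStr × BStr × BStr

/-- The numerator of an approximation of the absolute value, with denominator `D`. -/
def Entry.val (D : ℕ) (e : Entry) : ℕ := strNat e.2.2.1 * D / strNat e.2.2.2.1

/-- The matrix on the cells `1, …, m` with the given entries, with the common denominator `D`. -/
def entryTermsN (m D : ℕ) (es : List Entry) : List NTerm :=
  (entryIdx m).map fun t => ((es.getD t.1 ([], false, [], [], [])).val D,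
    2 * (t.1 % 2) + 4 * (es.getD t.1 ([], false, [], [], [])).2.1.toNat, t.2)

/-- The coefficients of `entryTermsN`. -/
def entryCoeff (D : ℕ) (es : List Entry) (i : ℕ) : ℂ :=
  ((1 / D : ℝ) : ℂ) * ((es.getD i ([], false, [], [], [])).val D : ℕ) *
    zeta8 ^ (2 * (i % 2) + 4 * (es.getD i ([], false, [], [], [])).2.1.toNat)

lemma map_toC_entryTermsN (m D : ℕ) (es : List Entry) :
    (entryTermsN m D es).map (NTerm.toC (1 / D)) = entryTerms m (entryCoeff D es) := by
  rw [entryTermsN, List.map_map]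
  rfl

/-- The difference of the matrix prepared by `C'` and the matrix obtained by `C` from the given
entries, up to the factor `D * 2 ^ (C.length + C'.length)`. -/
def diffTerms (m D : ℕ) (C C' : Circuit) (es : List Entry) : List NTerm :=
  C'.termsN 0 [(D * 2 ^ C.length, 0, [], [])] ++
    C.termsN 0 ((entryTermsN m D es).map fun t => (2 ^ C'.length * t.1, t.2.1 + 4, t.2.2))

/-- Both matrices are brought to the common denominator `D * 2 ^ (C.length + C'.length)`: each
circuit supplies its own power of two, and the weights supply the other one. The shift of the
exponent by 4 is the minus sign. -/
lemma red_diffTerms (n m D : ℕ) (hD : 0 < D) (C C' : Circuit) (es : List Entry) :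
    red n ((diffTerms m D C C' es).map
      (NTerm.toC (1 / (D * 2 ^ (C.length + C'.length) : ℕ)))) =
      red n (C'.terms 0 [(1, [], [])]) - red n (C.terms 0 (entryTerms m (entryCoeff D es))) := by
  have hD' : (D : ℝ) ≠ 0 := by positivity
  have hD'' : (D : ℂ) ≠ 0 := by exact_mod_cast hD.ne'
  rw [diffTerms, List.map_append, red_append, sub_eq_add_neg]
  congr 1
  · have h := map_toC_termsN C' 0 (1 / (D * 2 ^ C.length)) [(D * 2 ^ C.length, 0, [], [])]
    rw [show (1 / ((D * 2 ^ (C.length + C'.length) : ℕ) : ℝ)) =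
      1 / (D * 2 ^ C.length) / 2 ^ C'.length by push_cast; rw [pow_add]; field_simp, h]
    congr 2
    simp only [List.map_cons, List.map_nil, NTerm.toC, pow_zero, mul_one]
    congr 2
    push_cast
    field_simp
  · have h := map_toC_termsN C 0 (1 / (D * 2 ^ C'.length))
      ((entryTermsN m D es).map fun t => (2 ^ C'.length * t.1, t.2.1 + 4, t.2.2))
    rw [show (1 / ((D * 2 ^ (C.length + C'.length) : ℕ) : ℝ)) =
      1 / (D * 2 ^ C'.length) / 2 ^ C.length by push_cast; rw [pow_add]; field_simp, h,
      ← neg_one_smul ℂ, ← red_map_mul, ← Circuit.terms_map_mul, ← map_toC_entryTermsN]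
    congr 2
    rw [List.map_map, List.map_map]
    refine List.map_congr_left fun t _ => ?_
    simp only [Function.comp, NTerm.toC, Prod.mk.injEq, and_true]
    rw [pow_add, zeta8_pow_four]
    push_cast
    field_simp

/-! ### A test for the Frobenius norm -/

/-- A test for the Frobenius norm of `l / M` to be at most `1 / N`. It uses the approximations
`u / v ≤ 1 / √2 ≤ (u + 1) / v`. -/
def FroTest (n N M u v : ℕ) (l : List NTerm) : Prop :=
  0 < v ∧ 2 * u ^ 2 ≤ v ^ 2 ∧ v ^ 2 ≤ 2 * (u + 1) ^ 2 ∧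
    N ^ 2 * (v * froCount n l 0 + (u + 1) * (froCount n l 1 + froCount n l 7)) ≤
      N ^ 2 * (v * froCount n l 4 + u * (froCount n l 3 + froCount n l 5)) + v * M ^ 2

lemma froTest_bounds {u v : ℕ} : (2 * u ^ 2 ≤ v ^ 2 ↔ (u : ℝ) ≤ v * (1 / √2)) ∧
    (v ^ 2 ≤ 2 * (u + 1) ^ 2 ↔ v * (1 / √2) ≤ (u : ℝ) + 1) := by
  have h2 : (0 : ℝ) < √2 := by positivity
  have hs : √2 * √2 = 2 := Real.mul_self_sqrt (by norm_num)
  have hv : (0 : ℝ) ≤ v := by positivity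
  have hu : (0 : ℝ) ≤ u := by positivity
  rw [mul_one_div, le_div_iff₀ h2, div_le_iff₀ h2]
  constructor
  · rw [← @Nat.cast_le ℝ, ← abs_of_nonneg (a := (u : ℝ) * √2) (by positivity),
      ← abs_of_nonneg hv, ← sq_le_sq, mul_pow, sq √2, hs]
    push_cast
    rw [mul_comm]
  · rw [← @Nat.cast_le ℝ, ← abs_of_nonneg (a := ((u : ℝ) + 1) * √2) (by positivity),
      ← abs_of_nonneg hv, ← sq_le_sq, mul_pow, sq √2, hs]
    push_cast
    rw [mul_comm]

/-- In the test, `1 / √2` is replaced by its upper bound where its coefficient is positive and by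
its lower bound where it is negative, so the true value can only be smaller. -/
lemma fro_le_of_froTest {n N M u v : ℕ} {l : List NTerm} (h : FroTest n N M u v l) (hN : 0 < N)
    (hM : 0 < M) : fro (red n (l.map (NTerm.toC (1 / M)))) ≤ 1 / N := by
  obtain ⟨hv, h1, h2, h3⟩ := h
  have h1 := froTest_bounds.1.1 h1
  have h2 := froTest_bounds.2.1 h2
  have hN' : (0 : ℝ) < N := by exact_mod_cast hN
  have hM' : (0 : ℝ) < M := by exact_mod_cast hM
  have hv' : (0 : ℝ) < v := by exact_mod_cast hv
  refine abs_le_of_sq_le_sq' ?_ (by positivity) |>.2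
  rw [fro_red_toC_sq, div_pow, div_pow, one_pow, div_mul_eq_mul_div, one_mul, div_le_div_iff₀
    (by positivity) (by positivity), one_mul]
  have h3 : ((N ^ 2 * (v * froCount n l 0 + (u + 1) * (froCount n l 1 + froCount n l 7)) : ℕ) : ℝ) ≤
      ((N ^ 2 * (v * froCount n l 4 + u * (froCount n l 3 + froCount n l 5)) + v * M ^ 2 : ℕ) : ℝ) :=
    Nat.cast_le.2 h3
  push_cast at h3
  generalize (froCount n l 0 : ℝ) = c0 at *
  generalize (froCount n l 4 : ℝ) = c4 at *
  have p1 : (0 : ℝ) ≤ froCount n l 1 + froCount n l 7 := by positivity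
  have p3 : (0 : ℝ) ≤ froCount n l 3 + froCount n l 5 := by positivity
  have e : (froCount n l 1 : ℝ) + froCount n l 7 - froCount n l 3 - froCount n l 5 =
    (froCount n l 1 + froCount n l 7) - (froCount n l 3 + froCount n l 5) := by ring
  rw [e]
  generalize (froCount n l 1 + froCount n l 7 : ℝ) = c1 at *
  generalize (froCount n l 3 + froCount n l 5 : ℝ) = c3 at *
  have q1 := mul_le_mul_of_nonneg_right h2 p1
  have q3 := mul_le_mul_of_nonneg_right h1 p3
  have hN2 : (0 : ℝ) < (N : ℝ) ^ 2 := by positivity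
  refine le_of_mul_le_mul_left ?_ hv'
  nlinarith [mul_le_mul_of_nonneg_left q1 hN2.le, mul_le_mul_of_nonneg_left q3 hN2.le]

/-- The strict inequality leaves a gap that sufficiently good rational bounds of `1 / √2` fit into.
-/
lemma exists_froTest {n N M : ℕ} {l : List NTerm} (hN : 0 < N) (hM : 0 < M)
    (h : fro (red n (l.map (NTerm.toC (1 / M)))) < 1 / N) : ∃ u v, FroTest n N M u v l := by
  have hN' : (0 : ℝ) < N := by exact_mod_cast hN
  have hM' : (0 : ℝ) < M := by exact_mod_cast hM
  have h0 := fro_red_toC_sq n l (1 / M)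
  have h1 := pow_lt_pow_left₀ h (fro_nonneg _) two_ne_zero
  rw [h0, div_pow, div_pow, one_pow, div_mul_eq_mul_div, one_mul, div_lt_div_iff₀
    (by positivity) (by positivity), one_mul] at h1
  -- Rounding `v / √2` to integers changes the two sides by at most `N ^ 2` times the sum of the
  -- four counts. The denominator `v` is so large that `v` times the gap exceeds this.
  obtain ⟨v, hv⟩ := exists_nat_gt (max 1 ((N : ℝ) ^ 2 * (froCount n l 1 + froCount n l 7 +
    (froCount n l 3 + froCount n l 5)) / (M ^ 2 - (froCount n l 0 - froCount n l 4 +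
      (froCount n l 1 + froCount n l 7 - froCount n l 3 - froCount n l 5) * (1 / √2)) * N ^ 2)))
  obtain ⟨hv1, hv2⟩ := max_lt_iff.1 hv
  rw [div_lt_iff₀ (by linarith)] at hv2
  have hw : (0 : ℝ) ≤ v * (1 / √2) := by positivity
  have h2 := Nat.floor_le hw
  have h3 := (Nat.lt_floor_add_one ((v : ℝ) * (1 / √2))).le
  refine ⟨⌊(v : ℝ) * (1 / √2)⌋₊, v, ?_, froTest_bounds.1.2 h2, froTest_bounds.2.2 h3, ?_⟩
  · exact_mod_cast zero_lt_one.trans hv1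
  rw [← @Nat.cast_le ℝ]
  push_cast
  generalize (⌊(v : ℝ) * (1 / √2)⌋₊ : ℝ) = u at *
  generalize (froCount n l 0 : ℝ) = c0 at *
  generalize (froCount n l 4 : ℝ) = c4 at *
  have p1 : (0 : ℝ) ≤ froCount n l 1 + froCount n l 7 := by positivity
  have p3 : (0 : ℝ) ≤ froCount n l 3 + froCount n l 5 := by positivity
  have e : (froCount n l 1 : ℝ) + froCount n l 7 - froCount n l 3 - froCount n l 5 =
    (froCount n l 1 + froCount n l 7) - (froCount n l 3 + froCount n l 5) := by ring
  rw [e] at h1 hv2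
  generalize (froCount n l 1 + froCount n l 7 : ℝ) = c1 at *
  generalize (froCount n l 3 + froCount n l 5 : ℝ) = c3 at *
  generalize (1 / √2 : ℝ) = z at *
  have q1 := mul_nonneg (sub_nonneg.2 h2) p1
  have q3 := mul_nonneg (sub_nonneg.2 h3) p3
  have hN2 : (0 : ℝ) < (N : ℝ) ^ 2 := by positivity
  nlinarith [mul_nonneg q1 hN2.le, mul_nonneg q3 hN2.le]

/-! ### Classical descriptions of states -/

/-- The two-dimensional array of indices is flattened into one list, with real parts at even and
imaginary parts at odd positions. The factor `zeta8 ^ (2 * (i % 2))` is accordingly `1` or the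
imaginary unit. -/
lemma EncodesState.exists_coeff {U : DcqTM} {d : BStr} {m : ℕ} {σ : QState m}
    (h : EncodesState U d σ) : ∃ (L : List BStr) (x : ℕ → ℝ), d = strTuple (natStr m :: L) ∧
      L.length = 2 * 4 ^ m ∧ (∀ i (hi : i < L.length), ComputesReal U L[i] (x i)) ∧
      QTape.init σ = sem (entryTerms m fun i => zeta8 ^ (2 * (i % 2)) * x i) := by
  obtain ⟨e, f, hef, rfl⟩ := h
  have hp : 0 < 2 ^ m := by positivity
  -- The reduction modulo `2 ^ m` only makes the function total; it changes nothing at valid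
  -- positions.
  let row : ℕ → Fin (2 ^ m) := fun i => ⟨i / 2 / 2 ^ m % 2 ^ m, Nat.mod_lt _ hp⟩
  let col : ℕ → Fin (2 ^ m) := fun i => ⟨i / 2 % 2 ^ m, Nat.mod_lt _ hp⟩
  let g : ℕ → BStr := fun i => if i % 2 = 0 then e (row i) (col i) else f (row i) (col i)
  let x : ℕ → ℝ := fun i =>
    if i % 2 = 0 then (σ.mat (basisVec m (row i)) (basisVec m (col i))).re
    else (σ.mat (basisVec m (row i)) (basisVec m (col i))).im
  have hrc : ∀ (r s : Fin (2 ^ m)) (b : ℕ), b < 2 → row (2 * (r * 2 ^ m + s) + b) = r ∧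
      col (2 * (r * 2 ^ m + s) + b) = s := by
    intro r s b hb
    have h2 : (2 * ((r : ℕ) * 2 ^ m + s) + b) / 2 = r * 2 ^ m + s := by omega
    have h3 : ((r : ℕ) * 2 ^ m + s) / 2 ^ m = r := by
      rw [mul_comm, Nat.mul_add_div hp, Nat.div_eq_of_lt s.2, add_zero]
    constructor <;> ext
    · simp only [row, h2, h3, Nat.mod_eq_of_lt r.2]
    · simp only [col, h2]
      rw [mul_comm, Nat.mul_add_mod, Nat.mod_eq_of_lt s.2]
  have hL : (List.ofFn fun r => (List.ofFn fun s => [e r s, f r s]).flatten).flatten =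
      List.ofFn fun i : Fin (2 ^ m * (2 ^ m * 2)) => g i := by
    rw [List.ofFn_mul]
    congr 2
    funext r
    rw [List.ofFn_mul]
    congr 2
    funext s
    have e0 : (r : ℕ) * (2 ^ m * 2) + (s * 2 + 0) = 2 * (r * 2 ^ m + s) + 0 := by ring
    have e1 : (r : ℕ) * (2 ^ m * 2) + (s * 2 + 1) = 2 * (r * 2 ^ m + s) + 1 := by ring
    have h0 := hrc r s 0 (by norm_num)
    have h1 := hrc r s 1 (by norm_num)
    simp only [List.ofFn_succ, List.ofFn_zero, Fin.val_zero, Fin.val_succ, zero_add, e0, e1, g]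
    rw [h0.1, h0.2, h1.1, h1.2, if_pos (by omega), if_neg (by omega)]
  refine ⟨_, x, rfl, ?_, ?_, ?_⟩
  · rw [hL, List.length_ofFn, show (4 : ℕ) = 2 * 2 by norm_num, mul_pow]
    ring
  · intro i hi
    simp only [hL, List.getElem_ofFn, g, x]
    split_ifs
    · exact (hef _ _).1
    · exact (hef _ _).2
  · refine init_eq_sem σ _ fun r s => ?_
    have h0 := hrc r s 0 (by norm_num)
    have h1 := hrc r s 1 (by norm_num)
    rw [add_zero] at h0
    simp only [entryPos, x]
    rw [h0.1, h0.2, h1.1, h1.2, if_pos (by omega), if_neg (by omega),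
      show 2 * (2 * ((r : ℕ) * 2 ^ m + s) % 2) = 0 by omega,
      show 2 * ((2 * ((r : ℕ) * 2 ^ m + s) + 1) % 2) = 2 by omega, zeta8_sq, pow_zero, one_mul,
      mul_comm, Complex.re_add_im]

/-- One `1 / D` is the error of the rational number computed by the index, the other comes from
rounding its absolute value down to a multiple of `1 / D`. -/
lemma norm_sub_entryCoeff_le {U : DcqTM} {x : ℝ} {sD : BStr} {i t : ℕ} {C : Circuit}
    {es : List Entry} {e : Entry} (he : es.getD i ([], false, [], [], []) = e)
    (hx : ComputesReal U e.1 x) (hD : 0 < strNat sD)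
    (hr : U.Runs (DcqTM.inputCells (strTuple [e.1, sD]) []) t
      (strTuple [[e.2.1], e.2.2.1, e.2.2.2.1]) e.2.2.2.2 C) :
    ‖zeta8 ^ (2 * (i % 2)) * x - entryCoeff (strNat sD) es i‖ ≤ 2 / strNat sD := by
  obtain ⟨q, m, τ, ho, hq⟩ := hx (strNat sD) hD
  rw [natStr_strNat] at ho
  obtain ⟨t', C', ho, -⟩ := (DcqTM.outputs_iff _ _ _ _).1 ho
  rw [natStr_zero] at ho
  -- By uniqueness of outputs, the strings stored in the entry are the sign, the numerator and the
  -- denominator of `q`.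
  have h1 := strTuple_inj (by simp) (hr.unique ho).1
  simp only [List.cons.injEq, and_true] at h1
  obtain ⟨h1, h2, h3⟩ := h1
  have hD' : (0 : ℝ) < strNat sD := by exact_mod_cast hD
  have hz : ∀ n, ‖zeta8 ^ n‖ = 1 := fun n => by rw [norm_pow, norm_zeta8, one_pow]
  have h4 : (zeta8 ^ (4 * e.2.1.toNat) : ℂ) = ((if q < 0 then -1 else 1 : ℝ) : ℂ) := by
    rw [h1, pow_mul, zeta8_pow_four]
    by_cases h : q < 0 <;> simp [h]
  have h5 : zeta8 ^ (2 * (i % 2)) * x - entryCoeff (strNat sD) es i = zeta8 ^ (2 * (i % 2)) *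
      ((x - (if q < 0 then -1 else 1) * ((e.val (strNat sD) : ℝ) / strNat sD) : ℝ) : ℂ) := by
    rw [entryCoeff, he, pow_add, h4]
    push_cast
    ring
  rw [h5, norm_mul, hz, one_mul, Complex.norm_real, Real.norm_eq_abs]
  have h6 : |(q : ℝ) - (if q < 0 then -1 else 1) * ((e.val (strNat sD) : ℝ) / strNat sD)| ≤
      1 / strNat sD := by
    have hq' : (q : ℝ) = (if q < 0 then -1 else 1) * ((q.num.natAbs : ℝ) / q.den) := by
      conv_lhs => rw [Rat.cast_def]
      rw [Nat.cast_natAbs, Int.cast_abs]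
      split_ifs with h
      · rw [abs_of_neg (by exact_mod_cast Rat.num_neg.2 h)]; ring
      · rw [abs_of_nonneg (by exact_mod_cast Rat.num_nonneg.2 (not_lt.1 h))]; ring
    have hs : |(if q < 0 then -1 else 1 : ℝ)| = 1 := by split_ifs <;> simp
    rw [hq', ← mul_sub, abs_mul, hs, one_mul, Entry.val, h2, h3, strNat_natStr, strNat_natStr]
    have hd : (0 : ℝ) < q.den := by exact_mod_cast q.den_pos
    have hdm := Nat.div_add_mod (q.num.natAbs * strNat sD) q.den
    have hlt := Nat.mod_lt (q.num.natAbs * strNat sD) q.den_pos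
    generalize q.num.natAbs * strNat sD / q.den = z at *
    generalize q.num.natAbs * strNat sD % q.den = r at *
    have hdm' : (q.den : ℝ) * z + r = q.num.natAbs * strNat sD := by exact_mod_cast hdm
    have hlt' : (r : ℝ) < q.den := by exact_mod_cast hlt
    rw [div_sub_div _ _ hd.ne' hD'.ne', ← hdm', add_sub_cancel_left, abs_of_nonneg (by positivity),
      div_le_div_iff₀ (by positivity) hD', one_mul]
    exact mul_le_mul_of_nonneg_right hlt'.le hD'.le
  calc _ ≤ |x - q| + |(q : ℝ) - (if q < 0 then -1 else 1) * ((e.val (strNat sD) : ℝ) / strNat sD)| :=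
        abs_sub_le _ _ _
    _ ≤ 1 / strNat sD + 1 / strNat sD := add_le_add hq h6
    _ = _ := by ring

/-! ### Certificates -/

/-- The strings `p`, `sm`, `sk`, …, the numbers `t`, `u`, `v`, the circuits `C`, `C'` and the list
`es` certify that `C'` prepares a sufficiently good approximation of the output of the program `p`,
where `N₀` is the code of the tuple of `p`, of the representation of the quantum input, and of the
precision. -/
def Accepts (U : DcqTM) (N₀ : ℕ) (p sm sk sK sD sn y : BStr) (t u v : ℕ) (C C' : Circuit)
    (es : List Entry) : Prop :=
  (strCode (strTuple [p, strTuple (sm :: es.map Prod.fst), sk]) = N₀ ∧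
    es.length = 2 * 4 ^ strNat sm) ∧
  (U.Runs (DcqTM.inputCells (strTuple [p, [], sK]) sm) t y sn C ∧
    ∀ e ∈ es, U.Runs (DcqTM.inputCells (strTuple [e.1, sD]) []) t
      (strTuple [[e.2.1], e.2.2.1, e.2.2.2.1]) e.2.2.2.2
      (U.ctl (DcqTM.inputCells (strTuple [e.1, sD]) []) t).2.2.2) ∧
  (2 * (3 * 2 ^ strNat sn * strNat sk) ≤ strNat sK ∧
    4 * 4 ^ strNat sm * 2 ^ C.length * (3 * 2 ^ strNat sn * strNat sk) ≤ strNat sD) ∧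
  FroTest (strNat sn) (3 * 2 ^ strNat sn * strNat sk) (strNat sD * 2 ^ (C.length + C'.length)) u v
    (diffTerms (strNat sm) (strNat sD) C C' es)

namespace Primrec

variable {α : Type*} [Primcodable α]

lemma entryTermsN {m D : α → ℕ} {es : α → List Entry} (hm : Primrec m) (hD : Primrec D)
    (hes : Primrec es) : Primrec fun a => entryTermsN (m a) (D a) (es a) := by
  have hi : Primrec fun p : α × ℕ × List ℤ × List ℤ => p.2.1 := fst.comp snd
  have he := (list_getD ([], false, [], [], [])).comp (hes.comp fst) hi
  have hv := nat_div.comp (nat_mul.comp (strNat (fst.comp (snd.comp (snd.comp he))))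
    (hD.comp fst)) (strNat (fst.comp (snd.comp (snd.comp (snd.comp he)))))
  exact list_map (entryIdx.comp hm) (pair3 hv (nat_add.comp
    (nat_mul.comp (const 2) (nat_mod.comp hi (const 2)))
    (nat_mul.comp (const 4) ((dom_bool Bool.toNat).comp (fst.comp (snd.comp he)))))
    (snd.comp snd)).to₂

lemma diffTerms {m D : α → ℕ} {C C' : α → Circuit} {es : α → List Entry} (hm : Primrec m)
    (hD : Primrec D) (hC : Primrec C) (hC' : Primrec C') (hes : Primrec es) :
    Primrec fun a => diffTerms (m a) (D a) (C a) (C' a) (es a) :=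
  list_append.comp
    (termsN hC' (const 0) (list_cons.comp (pair (nat_mul.comp hD
      (nat_pow.comp (const 2) (list_length.comp hC))) (const _)) (const [])))
    (termsN hC (const 0) (list_map (entryTermsN hm hD hes) (pair3
      (nat_mul.comp (nat_pow.comp (const 2) (list_length.comp (hC'.comp fst))) (fst.comp snd))
      (nat_add.comp (fst.comp (snd.comp snd)) (const 4)) (snd.comp (snd.comp snd))).to₂))

lemma froTest {n N M u v : α → ℕ} {l : α → List NTerm} (hn : Primrec n) (hN : Primrec N)
    (hM : Primrec M) (hu : Primrec u) (hv : Primrec v) (hl : Primrec l) :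
    PrimrecPred fun a => FroTest (n a) (N a) (M a) (u a) (v a) (l a) := by
  have sq : ∀ {f : α → ℕ}, Primrec f → Primrec fun a => f a ^ 2 := fun hf => nat_pow.comp hf (const 2)
  have h := froCount hn hl
  have hu1 := nat_add.comp hu (const 1)
  exact (nat_lt.comp (const 0) hv).and ((nat_le.comp (nat_mul.comp (const 2) (sq hu)) (sq hv)).and
    ((nat_le.comp (sq hv) (nat_mul.comp (const 2) (sq hu1))).and (nat_le.comp
      (nat_mul.comp (sq hN) (nat_add.comp (nat_mul.comp hv (h 0))
        (nat_mul.comp hu1 (nat_add.comp (h 1) (h 7)))))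
      (nat_add.comp (nat_mul.comp (sq hN) (nat_add.comp (nat_mul.comp hv (h 4))
        (nat_mul.comp hu (nat_add.comp (h 3) (h 5))))) (nat_mul.comp hv (sq hM))))))

lemma accepts (U : DcqTM) {N₀ : α → ℕ} {p sm sk sK sD sn y : α → BStr} {t u v : α → ℕ}
    {C C' : α → Circuit} {es : α → List Entry} (hN₀ : Primrec N₀) (hp : Primrec p)
    (hsm : Primrec sm) (hsk : Primrec sk) (hsK : Primrec sK) (hsD : Primrec sD) (hsn : Primrec sn)
    (hy : Primrec y) (ht : Primrec t) (hu : Primrec u) (hv : Primrec v) (hC : Primrec C)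
    (hC' : Primrec C') (hes : Primrec es) :
    PrimrecPred fun a => Accepts U (N₀ a) (p a) (sm a) (sk a) (sK a) (sD a) (sn a) (y a) (t a) (u a)
      (v a) (C a) (C' a) (es a) := by
  have hN := nat_mul.comp (nat_mul.comp (const 3) (nat_pow.comp (const 2) (strNat hsn))) (strNat hsk)
  have h4 := nat_pow.comp (const 4) (strNat hsm)
  have two : ∀ {f g : α → BStr}, Primrec f → Primrec g → Primrec fun a => [f a, g a] :=
    fun hf hg => list_cons.comp hf (list_cons.comp hg (const []))
  have three : ∀ {f g h : α → BStr}, Primrec f → Primrec g → Primrec h →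
      Primrec fun a => [f a, g a, h a] := fun hf hg hh => list_cons.comp hf (two hg hh)
  have hw : Primrec fun q : α × Entry =>
      DcqTM.inputCells (_root_.strTuple [q.2.1, sD q.1]) [] :=
    inputCells (strTuple (list_cons.comp (fst.comp snd)
      (list_cons.comp (hsD.comp fst) (const [])))) (const [])
  have ho : Primrec fun q : α × Entry =>
      _root_.strTuple [[q.2.2.1], q.2.2.2.1, q.2.2.2.2.1] :=
    strTuple (list_cons.comp (list_cons.comp (fst.comp (snd.comp snd)) (const []))
      (list_cons.comp (fst.comp (snd.comp (snd.comp snd)))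
        (list_cons.comp (fst.comp (snd.comp (snd.comp (snd.comp snd)))) (const []))))
  have he := runs U hw (ht.comp fst) ho (snd.comp (snd.comp (snd.comp (snd.comp snd))))
    (snd.comp (snd.comp (snd.comp (ctl U hw (ht.comp fst)))))
  exact ((Primrec.eq.comp (strCode (strTuple (three hp (strTuple (list_cons.comp hsm
      (list_map hes (fst.comp snd).to₂))) hsk))) hN₀).and
    (Primrec.eq.comp (list_length.comp hes) (nat_mul.comp (const 2) h4))).and
    (((runs U (inputCells (strTuple (three hp (const []) hsK)) hsm) ht hy hsn hC).and
      (forall_mem hes he.primrecRel)).and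
    (((nat_le.comp (nat_mul.comp (const 2) hN) (strNat hsK)).and (nat_le.comp (nat_mul.comp
      (nat_mul.comp (nat_mul.comp (const 4) h4) (nat_pow.comp (const 2) (list_length.comp hC))) hN)
      (strNat hsD))).and
    (froTest (strNat hsn) hN (nat_mul.comp (strNat hsD) (nat_pow.comp (const 2)
      (nat_add.comp (list_length.comp hC) (list_length.comp hC')))) hu hv
      (diffTerms (strNat hsm) (strNat hsD) hC hC' hes))))

end Primrec

/-! ### Soundness and completeness of certificates -/

lemma strTuple_cons_inj' {x x' : BStr} {l l' : List BStr} (hl : l ≠ []) (hl' : l' ≠ [])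
    (h : strTuple (x :: l) = strTuple (x' :: l')) : x = x' ∧ strTuple l = strTuple l' := by
  obtain ⟨y, l, rfl⟩ := List.exists_cons_of_ne_nil hl
  obtain ⟨y', l', rfl⟩ := List.exists_cons_of_ne_nil hl'
  exact strTuple_cons_inj h

lemma reduced_run_empty (C : Circuit) (n : ℕ) :
    (C.run (QTape.init QState.empty, 0)).1.reduced n = red n (C.terms 0 [(1, [], [])]) := by
  rw [init_empty, Circuit.run_sem, reduced_sem]

section

variable {U : DcqTM} {n m : ℕ} {ρ : QState n} {σ : QState m} {p d : BStr} {k : ℕ}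

/-- If the entries have been computed with precision `1 / D`, then the circuit maps the approximate
matrix to an approximation of the image of the matrix. -/
lemma fro_red_entryCoeff_le {L : List BStr} {x : ℕ → ℝ} {es : List Entry} {sD : BStr} {t N : ℕ}
    (C : Circuit) (hL : L.length = 2 * 4 ^ m)
    (hx : ∀ i (hi : i < L.length), ComputesReal U L[i] (x i)) (hes : es.map Prod.fst = L)
    (hrun : ∀ e ∈ es, U.Runs (DcqTM.inputCells (strTuple [e.1, sD]) []) t
      (strTuple [[e.2.1], e.2.2.1, e.2.2.2.1]) e.2.2.2.2
      (U.ctl (DcqTM.inputCells (strTuple [e.1, sD]) []) t).2.2.2)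
    (hN : 0 < N) (hD : 4 * 4 ^ m * 2 ^ C.length * N ≤ strNat sD) :
    fro (red n (C.terms 0 (entryTerms m fun i => zeta8 ^ (2 * (i % 2)) * x i)) -
      red n (C.terms 0 (entryTerms m (entryCoeff (strNat sD) es)))) ≤ 1 / N := by
  subst hes
  have hD0 : 0 < strNat sD := lt_of_lt_of_le (by positivity) hD
  refine (fro_red_sub_le n m C 0 _ _ (2 / strNat sD) fun i hi => ?_).trans ?_
  · have hi' : i < (es.map Prod.fst).length := hL ▸ hi
    have hi'' : i < es.length := by simpa using hi'
    have h1 := hx i hi'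
    rw [List.getElem_map] at h1
    exact norm_sub_entryCoeff_le (List.getD_eq_getElem _ _ hi'') h1 hD0
      (hrun _ (List.getElem_mem hi''))
  · have hD0' : (0 : ℝ) < strNat sD := by exact_mod_cast hD0
    have hN' : (0 : ℝ) < N := by exact_mod_cast hN
    have hD' : ((4 * 4 ^ m * 2 ^ C.length * N : ℕ) : ℝ) ≤ strNat sD := Nat.cast_le.2 hD
    push_cast at hD'
    -- This product is the origin of the lower bound on `sD` in `Accepts`.
    rw [show (2 : ℝ) ^ C.length * (2 * 4 ^ m * (2 / strNat sD)) =
      4 * 4 ^ m * 2 ^ C.length / strNat sD by ring, div_le_div_iff₀ hD0' hN', one_mul]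
    exact hD'

/-- The certificate comes from a blind search, so nothing in it is trusted. Injectivity of the
encodings identifies its program, matrix description and precision with the given ones, and
determinism of `U` identifies its circuit `C` and number of qubits with those of the actual run. The
distance then splits into three Frobenius errors of at most `1 / N` each, for `N = 3 * 2 ^ n * k`:
that of the test, that of the entries, and that of the program `p`. -/
theorem Accepts.sound {p' sm sk sK sD sn y : BStr} {t u v : ℕ} {C C' : Circuit} {es : List Entry}
    (hd : EncodesState U d σ) (hp : ProgramFor U p ρ [] σ) (hk : 1 ≤ k)
    (h : Accepts U (strCode (strTuple [p, d, natStr k])) p' sm sk sK sD sn y t u v C C' es) :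
    sn = natStr n ∧ ∀ τ : QState n, (C'.run (QTape.init QState.empty, 0)).1.reduced n = τ.mat →
      traceDist τ ρ ≤ 1 / (k : ℝ) := by
  obtain ⟨⟨h1, h2⟩, ⟨h3, h4⟩, ⟨h5, h6⟩, h7⟩ := h
  have h0 := strTuple_inj (by simp) (strCode_injective h1)
  simp only [List.cons.injEq, and_true] at h0
  obtain ⟨rfl, h0, rfl⟩ := h0
  clear h1
  obtain ⟨L, x, rfl, hL, hx, hσ⟩ := hd.exists_coeff
  have hL0 : L ≠ [] := by
    rw [← List.length_pos_iff, hL]; positivity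
  have hes0 : es.map Prod.fst ≠ [] := by
    rw [← List.length_pos_iff, List.length_map, h2]; positivity
  obtain ⟨rfl, h1⟩ := strTuple_cons_inj' hes0 hL0 h0
  rw [strNat_natStr] at h2 h5 h6 h7
  rw [strNat_natStr] at h6 h7
  have h1 := strTuple_inj (by rw [List.length_map, h2, hL]) h1
  have hN : 0 < 3 * 2 ^ strNat sn * k := by positivity
  obtain ⟨y', τ', hτ', hD'⟩ := hp (strNat sK) (by omega)
  rw [natStr_strNat] at hτ'
  obtain ⟨t', C'', hr, hC⟩ := (DcqTM.outputs_iff _ _ _ _).1 hτ'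
  obtain ⟨-, rfl, rfl⟩ := h3.unique hr
  refine ⟨rfl, fun τ hτ => ?_⟩
  rw [strNat_natStr] at h5 h6 h7 hN
  rw [hσ, Circuit.run_sem, reduced_sem] at hC
  rw [reduced_run_empty] at hτ
  generalize hNN : 3 * 2 ^ n * k = N at *
  have hN' : (0 : ℝ) < N := by exact_mod_cast hN
  have g1 := fro_red_entryCoeff_le (n := n) C hL hx h1 h4 hN h6
  have hD0 : 0 < strNat sD := lt_of_lt_of_le (by positivity) h6
  have g2 := fro_le_of_froTest h7 hN (by positivity)
  rw [red_diffTerms _ _ _ hD0, hτ] at g2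
  rw [hC] at g1
  have g3 : fro (τ'.mat - ρ.mat) ≤ 1 / N := by
    refine (fro_le_of_traceDist τ' ρ).trans ?_
    -- The factor 2 makes up for the `½` in the trace distance.
    have hK : ((2 * N : ℕ) : ℝ) ≤ strNat sK := Nat.cast_le.2 h5
    push_cast at hK
    have : 1 / (strNat sK : ℝ) ≤ 1 / (2 * N) := one_div_le_one_div_of_le (by positivity) hK
    calc 2 * traceDist τ' ρ ≤ 2 * (1 / (2 * N)) := by linarith
      _ = 1 / N := by field_simp
  set B := red n (C.terms 0 (entryTerms m (entryCoeff (strNat sD) es)))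
  have g4 : fro (τ.mat - ρ.mat) ≤ 3 / N := by
    have e : τ.mat - ρ.mat = (τ.mat - B) + ((B - τ'.mat) + (τ'.mat - ρ.mat)) := by abel
    rw [e]
    have i1 := fro_add_le (τ.mat - B) ((B - τ'.mat) + (τ'.mat - ρ.mat))
    have i2 := fro_add_le (B - τ'.mat) (τ'.mat - ρ.mat)
    rw [fro_sub_comm B] at i2
    have e3 : (3 : ℝ) / N = 1 / N + 1 / N + 1 / N := by ring
    linarith
  have hk' : (0 : ℝ) < k := by exact_mod_cast hk
  have h2n : (0 : ℝ) < 2 ^ n := by positivity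
  calc traceDist τ ρ ≤ 2 ^ n * fro (τ.mat - ρ.mat) / 2 := traceDist_le_of_fro τ ρ
    _ ≤ 2 ^ n * (3 / N) / 2 := by gcongr
    _ = 1 / k / 2 := by rw [← hNN]; push_cast; field_simp
    _ ≤ 1 / k := by have : 0 < 1 / (k : ℝ) := by positivity
                    linarith

/-- Here the computability of `ρ` enters: it supplies a circuit `C'` that prepares a state near `ρ`,
while `p` and the entries of `σ` supply a matrix near `ρ`. All errors are taken small enough for the
test to hold with a strict inequality. -/
theorem exists_accepts (hd : EncodesState U d σ) (hp : ProgramFor U p ρ [] σ)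
    (hρ : DcqComputable ρ) (hk : 1 ≤ k) :
    ∃ (sm sk sK sD sn y : BStr) (t u v : ℕ) (C C' : Circuit) (es : List Entry),
      Accepts U (strCode (strTuple [p, d, natStr k])) p sm sk sK sD sn y t u v C C' es := by
  obtain ⟨L, x, rfl, hL, hx, hσ⟩ := hd.exists_coeff
  obtain ⟨N, hNN⟩ : ∃ N, N = 3 * 2 ^ n * k := ⟨_, rfl⟩
  have hN : 0 < N := by rw [hNN]; positivity
  have hN' : (0 : ℝ) < N := by exact_mod_cast hN
  obtain ⟨T, s, hT⟩ := hρ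
  -- Trace distance `1 / (8 * N)` means Frobenius distance at most `1 / (4 * N)`. With the same
  -- bound for `p` and for the entries, the total is `3 / (4 * N) < 1 / N`.
  obtain ⟨⟨T', hT'⟩, -, hs⟩ := hT (8 * N) (by omega)
  obtain ⟨_, C', -, hC'⟩ := (DcqTM.outputs_iff _ _ _ _).1 hT'
  rw [reduced_run_empty] at hC'
  obtain ⟨y, τ, hτ, hτd⟩ := hp (8 * N) (by omega)
  obtain ⟨t₀, C, hr, hC⟩ := (DcqTM.outputs_iff _ _ _ _).1 hτ
  rw [hσ, Circuit.run_sem, reduced_sem] at hC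
  obtain ⟨D, hDD⟩ : ∃ D, D = 4 * 4 ^ m * 2 ^ C.length * (4 * N) := ⟨_, rfl⟩
  have hD : 0 < D := by rw [hDD]; positivity
  have he : ∀ e ∈ L, ∃ (b : Bool) (a a' w : BStr) (t : ℕ) (C : Circuit),
      U.Runs (DcqTM.inputCells (strTuple [e, natStr D]) []) t (strTuple [[b], a, a']) w C := by
    intro e he
    obtain ⟨i, hi, rfl⟩ := List.getElem_of_mem he
    obtain ⟨q, m', τ', ho, -⟩ := hx i hi D hD
    obtain ⟨t, C, h, -⟩ := (DcqTM.outputs_iff _ _ _ _).1 ho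
    rw [natStr_zero] at h
    exact ⟨_, _, _, _, t, C, h⟩
  -- A single time bound must serve all entries and the run of `p`; the maximum is built up along
  -- the list, starting from `t₀`.
  have hes : ∀ l : List BStr, (∀ e ∈ l, e ∈ L) → ∃ (t : ℕ) (es : List Entry), t₀ ≤ t ∧
      es.map Prod.fst = l ∧ ∀ e ∈ es, U.Runs (DcqTM.inputCells (strTuple [e.1, natStr D]) []) t
        (strTuple [[e.2.1], e.2.2.1, e.2.2.2.1]) e.2.2.2.2
        (U.ctl (DcqTM.inputCells (strTuple [e.1, natStr D]) []) t).2.2.2 := by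
    intro l hl
    induction l with
    | nil => exact ⟨t₀, [], le_rfl, rfl, by simp⟩
    | cons e l ih =>
      obtain ⟨t, es, ht, h1, h2⟩ := ih fun e he => hl e (by simp [he])
      obtain ⟨b, a, a', w, t', C, h⟩ := he e (hl e (by simp))
      refine ⟨max t t', (e, b, a, a', w) :: es, ht.trans (le_max_left _ _), by simp [h1], ?_⟩
      intro e' he'
      rcases List.mem_cons.1 he' with rfl | he'
      · obtain ⟨i1, i2, -⟩ := h.mono (le_max_right t t')
        exact ⟨i1, i2, rfl⟩
      · obtain ⟨i1, i2, -⟩ := (h2 e' he').mono (le_max_left t t')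
        exact ⟨i1, i2, rfl⟩
  obtain ⟨t, es, ht, h1, h4⟩ := hes L fun _ h => h
  have g1 := fro_red_entryCoeff_le (n := n) (N := 4 * N) C hL hx h1 h4 (by omega)
    (by rw [strNat_natStr, hDD])
  rw [strNat_natStr, hC] at g1
  set B := red n (C.terms 0 (entryTerms m (entryCoeff D es))) with hB
  have hfro : fro (red n ((diffTerms m D C C' es).map
      (NTerm.toC (1 / (D * 2 ^ (C.length + C'.length) : ℕ))))) < 1 / N := by
    rw [red_diffTerms _ _ _ hD, hC', ← hB]
    have e : (s (8 * N)).mat - B =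
      ((s (8 * N)).mat - ρ.mat) + ((ρ.mat - τ.mat) + (τ.mat - B)) := by abel
    rw [e]
    have i1 := fro_add_le ((s (8 * N)).mat - ρ.mat) ((ρ.mat - τ.mat) + (τ.mat - B))
    have i2 := fro_add_le (ρ.mat - τ.mat) (τ.mat - B)
    have i3 := fro_le_of_traceDist ρ (s (8 * N))
    have i4 := fro_le_of_traceDist τ ρ
    rw [fro_sub_comm] at i1 i2
    rw [fro_sub_comm] at i3
    push_cast at hs hτd g1
    have e1 : 1 / (8 * (N : ℝ)) = 1 / N / 8 := by field_simp
    have e2 : 1 / (4 * (N : ℝ)) = 1 / N / 4 := by field_simp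
    have hp : 0 < 1 / (N : ℝ) := by positivity
    rw [e1] at hs hτd
    rw [e2] at g1
    rw [fro_sub_comm] at i3
    have i5 : fro ((s (8 * N)).mat - ρ.mat) = fro (ρ.mat - (s (8 * N)).mat) := fro_sub_comm _ _
    have i6 : fro (ρ.mat - τ.mat) = fro (τ.mat - ρ.mat) := fro_sub_comm _ _
    linarith
  obtain ⟨u, v, huv⟩ := exists_froTest hN (by positivity) hfro
  refine ⟨natStr m, natStr k, natStr (8 * N), natStr D, natStr n, y, t, u, v, C, C', es,
    ⟨by rw [h1], ?_⟩, ⟨hr.mono ht, h4⟩, ?_, ?_⟩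
  · rw [strNat_natStr, ← hL, ← h1, List.length_map]
  · simp only [strNat_natStr]
    rw [← hNN]
    refine ⟨by omega, ?_⟩
    rw [hDD]
    exact Nat.mul_le_mul_left _ (by omega)
  · simp only [strNat_natStr]
    rw [← hNN]
    exact huv

end

/-! ### The search for a certificate -/

/-- The type of certificates. -/
abbrev Cert := (BStr × BStr × BStr × BStr × BStr × BStr × BStr) × (ℕ × ℕ × ℕ) ×
  Circuit × Circuit × List Entry

/-- Acceptance of a certificate. -/
def Cert.Valid (U : DcqTM) (N₀ : ℕ) (c : Cert) : Prop :=
  Accepts U N₀ c.1.1 c.1.2.1 c.1.2.2.1 c.1.2.2.2.1 c.1.2.2.2.2.1 c.1.2.2.2.2.2.1 c.1.2.2.2.2.2.2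
    c.2.1.1 c.2.1.2.1 c.2.1.2.2 c.2.2.1 c.2.2.2.1 c.2.2.2.2

/-- The instructions to run the circuit of a certificate. -/
def Cert.result (c : Cert) : ℕ := strCode (progStr c.2.2.2.1 c.1.2.2.2.2.2.1)

lemma primrecRel_valid (U : DcqTM) : PrimrecRel fun N₀ c => Cert.Valid U N₀ c := by
  have a1 : Primrec fun q : ℕ × Cert => q.2.1 := Primrec.fst.comp Primrec.snd
  have a2 := Primrec.snd.comp a1
  have a3 := Primrec.snd.comp a2
  have a4 := Primrec.snd.comp a3
  have a5 := Primrec.snd.comp a4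
  have a6 := Primrec.snd.comp a5
  have b : Primrec fun q : ℕ × Cert => q.2.2 := Primrec.snd.comp Primrec.snd
  have b1 := Primrec.fst.comp b
  have b2 := Primrec.snd.comp b
  exact Primrec.accepts U Primrec.fst (Primrec.fst.comp a1) (Primrec.fst.comp a2)
    (Primrec.fst.comp a3) (Primrec.fst.comp a4) (Primrec.fst.comp a5) (Primrec.fst.comp a6)
    (Primrec.snd.comp a6) (Primrec.fst.comp b1) (Primrec.fst.comp (Primrec.snd.comp b1))
    (Primrec.snd.comp (Primrec.snd.comp b1)) (Primrec.fst.comp b2)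
    (Primrec.fst.comp (Primrec.snd.comp b2)) (Primrec.snd.comp (Primrec.snd.comp b2))

lemma Primrec.tokStr {α : Type*} [Primcodable α] {f : α → ℕ} (hf : Primrec f) :
    Primrec fun a => tokStr (f a) :=
  (list_concat.comp (list_map (list_range.comp hf) (const true).to₂) (const false)).of_eq
    fun a => by rw [List.map_const', List.length_range]; rfl

lemma primrec_result : Primrec Cert.result := by
  have a6 : Primrec fun c : Cert => c.1.2.2.2.2.2.1 :=
    .comp .fst (.comp .snd (.comp .snd (.comp .snd (.comp .snd (.comp .snd .fst)))))
  have b : Primrec fun c : Cert => c.2.2.2.1 := .comp .fst (.comp .snd (.comp .snd .snd))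
  exact Primrec.strCode (Primrec.list_append.comp
    (Primrec.list_flatMap b (Primrec.tokStr ((Primrec.dom_finite opTok).comp Primrec.snd)).to₂)
    (Primrec.list_append.comp (Primrec.const _) (Primrec.list_append.comp
      (Primrec.list_flatMap a6 (Primrec.tokStr ((Primrec.dom_bool fun b => 18 + b.toNat).comp
        Primrec.snd)).to₂) (Primrec.const _))))

/-- A search for an element with a decidable property is a partial recursive function. -/
theorem exists_partrec_search {α : Type*} [Primcodable α] {P : ℕ → α → Prop} (hP : PrimrecRel P)
    {g : α → ℕ} (hg : Primrec g) : ∃ f : ℕ →. ℕ, Partrec f ∧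
      ∀ x, (∃ a, P x a) → ∃ a, P x a ∧ g a ∈ f x := by
  classical
  let test : ℕ → ℕ → Bool := fun x i =>
    ((Encodable.decode (α := α) i).map fun a => decide (P x a)).getD false
  have htest : Primrec₂ test := Primrec.option_getD.comp
    (Primrec.option_map (Primrec.decode.comp Primrec.snd)
      (hP.decide.comp (Primrec.fst.comp Primrec.fst) Primrec.snd).to₂) (Primrec.const false)
  let out : ℕ → ℕ := fun i => ((Encodable.decode (α := α) i).map g).getD 0
  have hout : Primrec out := Primrec.option_getD.comp
    (Primrec.option_map Primrec.decode (hg.comp Primrec.snd).to₂) (Primrec.const 0)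
  let p : ℕ → ℕ →. Bool := fun x i => Part.some (test x i)
  have hp : Partrec₂ p := htest.to_comp.partrec₂
  refine ⟨fun x => (Nat.rfind (p x)).map out,
    (Partrec.rfind hp).map (hout.comp Primrec.snd).to_comp.to₂, ?_⟩
  rintro x ⟨a, ha⟩
  have hdom : (Nat.rfind (p x)).Dom :=
    -- The test is total, so the unbounded search terminates as soon as some code passes it.
    Nat.rfind_dom.2 ⟨Encodable.encode a, by simp [p, test, ha], fun _ => trivial⟩
  have hmem := Part.get_mem hdom
  have hspec : true ∈ p x _ := Nat.rfind_spec hmem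
  generalize (Nat.rfind (p x)).get hdom = i at *
  have hspec : true = test x i := Part.mem_some_iff.1 hspec
  simp only [test] at hspec
  cases h : (Encodable.decode i : Option α) with
  | none => simp [h] at hspec
  | some b =>
    refine ⟨b, by simpa [h] using hspec, Part.mem_map_iff _ |>.2 ⟨i, hmem, by simp [out, h]⟩⟩

/-- There is a machine that computes, from a program that computes a computable state with the help
of a physical state, and from any classical representation of the latter state. -/
theorem exists_dcqTM_programFor (U : DcqTM) : ∃ T : DcqTM, ∀ (n m : ℕ) (ρ : QState n) (σ : QState m)
    (p d : BStr), DcqComputable ρ → ProgramFor U p ρ [] σ → EncodesState U d σ →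
      ProgramFor T p ρ d QState.empty := by
  obtain ⟨f, hf, hfs⟩ := exists_partrec_search (primrecRel_valid U) primrec_result
  obtain ⟨T, hT⟩ := exists_dcqTM_of_partrec hf
  refine ⟨T, fun n m ρ σ p d hρ hp hd k hk => ?_⟩
  obtain ⟨sm, sk, sK, sD, sn, y, t, u, v, C, C', es, h⟩ := exists_accepts hd hp hρ hk
  obtain ⟨c, hc, hcf⟩ := hfs (strCode (strTuple [p, d, natStr k]))
    ⟨((p, sm, sk, sK, sD, sn, y), (t, u, v), C, C', es), h⟩
  -- The search may have found a certificate other than the one just exhibited; soundness covers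
  -- whichever it returns.
  obtain ⟨hsn, hdist⟩ := Accepts.sound hd hp hk hc
  obtain ⟨τ, hτ⟩ := exists_state_of_circuit c.2.2.2.1 n
  refine ⟨[], τ, hT _ c.2.2.2.1 n τ ?_ hτ, hdist τ hτ⟩
  rwa [Cert.result, hsn] at hcf

end

/-! ### The inequality between the complexities -/

theorem mainTheorem8 (U : DcqTM) (hU : U.IsUniversal) :
    ∃ c : ℕ, ∀ (n m : ℕ) (ρ : QState n) (σ : QState m), DcqComputable ρ → DcqComputable σ →
      condKRepr U ρ σ QState.empty ≤ condK U ρ [] σ + c := by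
  obtain ⟨T, hT⟩ := exists_dcqTM_programFor U
  obtain ⟨s, c, -, hs, hsU⟩ := hU.smn T
  refine ⟨c, fun n m ρ σ hρ _ => ?_⟩
  by_cases hne : ∃ p, ProgramFor U p ρ [] σ
  · have : Set.Nonempty {l : ℕ∞ | ∃ p : BStr, ProgramFor U p ρ [] σ ∧ l = p.length} :=
      ⟨_, hne.choose, hne.choose_spec, rfl⟩
    -- A nonempty set in `ℕ∞` contains its infimum, so there is a shortest program.
    obtain ⟨p, hp, hl⟩ := csInf_mem this
    rw [condK, hl]
    have hle : condKRepr U ρ σ QState.empty ≤ ((s p).length : ℕ∞) := by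
      refine sInf_le ⟨s p, fun d hd k hk => ?_, rfl⟩
      obtain ⟨y, τ, h1, h2⟩ := hT n m ρ σ p d hρ hp hd k hk
      -- The triple with components `s p`, `d`, `k` is by definition the pair of `s p` and the pair
      -- of `d` and `k`, so the s-m-n property for pairs applies.
      exact ⟨y, τ, (hsU p (strTuple [d, natStr k]) 0 QState.empty y n τ).2 h1, h2⟩
    exact hle.trans (by exact_mod_cast hs p)
  · have : condK U ρ [] σ = ⊤ := by
      rw [condK, sInf_eq_top]
      rintro l ⟨p, hp, -⟩
      exact absurd ⟨p, hp⟩ hne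
    rw [this, top_add]
    exact le_top
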